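/- For $\epsilon,a_1,a_2,\gamma\in\mathbb{R}$ let $g=g_{\epsilon,a_1,a_2,\gamma}$ be the homogeneous plane wave metric on $\mathbb{R}^4$ which, in the exponential coordinates $(x_1,x_2,x_3,x_4)$, is $$g=\big((\gamma^2+a_1)x_2^2+(\gamma^2+a_2)x_3^2-2\epsilon x_4\big)dx_1^2-2\gamma x_3\,dx_1dx_2+2\gamma x_2\,dx_1dx_3+2\,dx_1dx_4+dx_2^2+dx_3^2 ,$$ with Levi-Civita connection $\nabla$. (The values $\epsilon=0$ and $\epsilon=1$ give the two classical families of homogeneous plane waves.) A smooth field $k_b$ on $\mathbb{R}^4$ is a Killing vector if $\nabla_{(a}k_{b)}=0$, and a conformal Killing vector if $\nabla_{(a}k_{b)_0}=0$; here round brackets denote symmetrization and the subscript $0$ the trace-free part with respect to $g$. The space of reducible conformal Killing tensors is the real linear span of all $k_{(a}k'_{b)_0}$ with $k,k'$ conformal Killing vectors. The space of reducible Killing tensors is the real linear span of the metric $g$ and all $k_{(a}k'_{b)}$ with $k,k'$ Killing vectors. The space of reducible conformal Killing tensors of $g_{\epsilon,a_1,a_2,\gamma}$ has 1. dimension $27$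 if $a_1\neq a_2$; 2. dimension $84$ if $a_1=a_2$. The space of reducible Killing tensors (including the metric $g$) of $g_{\epsilon,a_1,a_2,\gamma}$ has 3. dimension $21$ if $\epsilon=0$ and $a_1\neq a_2$; 4. dimension $27$ if $\epsilon=0$ and $a_1=a_2\neq 0$; 5. dimension $22$ if $\epsilon\neq 0$ and $a_1\neq a_2$; 6. dimension $28$ if $\epsilon\neq 0$ and $a_1=a_2\neq 0$; 7. dimension $50$ if $a_1=a_2=0$. -/

import Mathlib

open scoped ContDiff

noncomputable section

namespace PlaneWave

/-- Coordinate space `ℝ⁴`. The coordinates `(x₁, x₂, x₃, x₄)` of `x : Point` are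
`(x 0, x 1, x 2, x 3)`. -/
abbrev Point : Type := Fin 4 → ℝ

/-- Covector fields `k_b` on `ℝ⁴`, in components. -/
abbrev CovectorField : Type := Point → Fin 4 → ℝ

/-- Covariant 2-tensor fields `T_{ab}` on `ℝ⁴` (metrics in particular), in components. -/
abbrev TensorField : Type := Point → Matrix (Fin 4) (Fin 4) ℝ

/-- The homogeneous plane wave metric `g_{ε,a₁,a₂,γ}` in exponential coordinates:
`((γ² + a₁) x₂² + (γ² + a₂) x₃² - 2 ε x₄) dx₁² - 2 γ x₃ dx₁ dx₂ + 2 γ x₂ dx₁ dx₃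
  + 2 dx₁ dx₄ + dx₂² + dx₃²`. -/
def metric (ε a₁ a₂ γ : ℝ) : TensorField := fun x =>
  !![(γ ^ 2 + a₁) * x 1 ^ 2 + (γ ^ 2 + a₂) * x 2 ^ 2 - 2 * ε * x 3, -(γ * x 2), γ * x 1, 1;
     -(γ * x 2), 1, 0, 0;
     γ * x 1, 0, 1, 0;
     1, 0, 0, 0]

/-- The partial derivative `∂_a f`. -/
def partialD (a : Fin 4) (f : Point → ℝ) (x : Point) : ℝ :=
  fderiv ℝ f x (Pi.single a 1)

/-- The Christoffel symbols `Γ^c_{ab}` of the Levi-Civita connection of `g`. -/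
def christoffel (g : TensorField) (c a b : Fin 4) (x : Point) : ℝ :=
  (1 / 2) * ∑ d, (g x)⁻¹ c d *
    (partialD a (fun y => g y d b) x + partialD b (fun y => g y d a) x
      - partialD d (fun y => g y a b) x)

/-- The covariant derivative `∇_a k_b` for the Levi-Civita connection of `g`. -/
def covD (g : TensorField) (k : CovectorField) (x : Point) (a b : Fin 4) : ℝ :=
  partialD a (fun y => k y b) x - ∑ c, christoffel g c a b x * k x c

/-- The symmetrized covariant derivative `∇_{(a} k_{b)}`. -/
def symCovD (g : TensorField) (k : CovectorField) : TensorField := fun x =>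
  Matrix.of fun a b => (1 / 2) * (covD g k x a b + covD g k x b a)

/-- The trace-free part `T_{ab} - (1/4) (g^{cd} T_{cd}) g_{ab}` of a symmetric 2-tensor field. -/
def traceFree (g T : TensorField) : TensorField := fun x =>
  T x - ((1 / 4) * ∑ c, ∑ d, (g x)⁻¹ c d * T x c d) • g x

/-- Killing vectors of `g` (with index lowered): smooth solutions of `∇_{(a} k_{b)} = 0`. -/
def IsKilling (g : TensorField) (k : CovectorField) : Prop :=
  ContDiff ℝ ∞ k ∧ symCovD g k = 0

/-- Conformal Killing vectors of `g` (with index lowered): smooth solutions of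
`∇_{(a} k_{b)₀} = 0`. -/
def IsConformalKilling (g : TensorField) (k : CovectorField) : Prop :=
  ContDiff ℝ ∞ k ∧ traceFree g (symCovD g k) = 0

/-- The symmetric product `k_{(a} k'_{b)}`. -/
def symProd (k k' : CovectorField) : TensorField := fun x =>
  Matrix.of fun a b => (1 / 2) * (k x a * k' x b + k x b * k' x a)

/-- The space of reducible Killing tensors of `g`: all linear combinations of the products
`k_{(a} k'_{b)}` of Killing vectors and of the metric. -/
def reducibleKillingTensors (g : TensorField) : Submodule ℝ TensorField :=
  Submodule.span ℝ
    (insert g {T | ∃ k k', IsKilling g k ∧ IsKilling g k' ∧ T = symProd k k'})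

/-- The space of reducible conformal Killing tensors of `g`: all linear combinations of the
products `k_{(a} k'_{b)₀}` of conformal Killing vectors. -/
def reducibleConformalKillingTensors (g : TensorField) : Submodule ℝ TensorField :=
  Submodule.span ℝ
    {T | ∃ k k', IsConformalKilling g k ∧ IsConformalKilling g k' ∧
      T = traceFree g (symProd k k')}

end PlaneWave

end

open scoped ContDiff

noncomputable section

namespace PlaneWave

/-! ### The ring of smooth functions and its coordinate derivations -/

/-! The dimensions come from three ingredients: solving the conformal Killing equation, exhibiting
bases of its solutions, and finding all linear relations among symmetric products of basis elements.
The computation takes place in the ring `Sm` of smooth functions, where only the coordinate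
derivations and their commutation matter.

Upper bounds. Write the equation as `symD K = f • G` and cross-differentiate. The component k₃ is
then quadratic in x₂ and x₃, and each remaining piece of the solution obeys a constant-coefficient
linear ODE in x₁. A solution is therefore fixed by finitely many derivatives at the origin: 15
numbers if a₁ = a₂ (`flatJet_injective`) and 7 if a₁ ≠ a₂ (`anisoJet_injective`). For Killing
vectors the numbers are 6 (a₁ ≠ a₂), 7 (a₁ = a₂ ≠ 0) and 10 (a₁ = a₂ = 0). Independent explicit
fields attain all these bounds. One family, `fam`, consists of four Heisenberg fields, a central
field, a translation, a homothety and, for a₁ = a₂, a rotation. The other, `ConeData.fam`, exists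
for a₁ = a₂: an isometric embedding E into the light cone of ℝ^{2,4} gives fifteen fields E_A dE_B −
E_B dE_A.

Relations. In the first family a Casimir relation expresses e • G through products, where e' = εe
(`casimir_relation`). If a₁ = a₂, one more relation holds among Killing products
(`angular_relation`). This gives 28 − 1 = 27 conformally for a₁ ≠ a₂, and 21 or 28 − 1 = 27 Killing
products in the two cases that are not flat. The metric lies in their span exactly when ε = 0: then
e = 1 and the homothety term disappears. Otherwise the metric adds one dimension. In the second
family there are 15 Plücker and 21 trace relations, leaving 120 − 36 = 84. In the flat case the ten
Killing fields have 55 products and 5 Plücker relations, leaving 50, with the metric already in the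
span.

No further relations. On the hypersurface x₁ = 0 the initial values make every basis field an
explicit polynomial in a suitable frame, and coefficients can be compared (`fam_kernel` and the
`FrameRel` lemmas). -/

/-- The algebra of smooth functions on `ℝ⁴`. -/
def smoothAlg : Subalgebra ℝ (Point → ℝ) where
  carrier := {f | ContDiff ℝ ∞ f}
  mul_mem' := fun {_ _} (hf : ContDiff ℝ ∞ _) (hg : ContDiff ℝ ∞ _) => ContDiff.mul hf hg
  add_mem' := fun {_ _} (hf : ContDiff ℝ ∞ _) (hg : ContDiff ℝ ∞ _) => ContDiff.add hf hg
  algebraMap_mem' := fun r => (contDiff_const : ContDiff ℝ ∞ fun _ : Point => r)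

/-- Smooth functions on `ℝ⁴`. -/
def Sm : Type := smoothAlg

instance : CommRing Sm := inferInstanceAs (CommRing smoothAlg)

instance : Algebra ℝ Sm := inferInstanceAs (Algebra ℝ smoothAlg)

instance : CoeOut Sm (Point → ℝ) := ⟨fun f => f.1⟩

theorem Sm.contDiff (f : Sm) : ContDiff ℝ ∞ (f : Point → ℝ) := f.2

theorem Sm.differentiableAt (f : Sm) (x : Point) : DifferentiableAt ℝ (f : Point → ℝ) x :=
  (f.contDiff.differentiable (by simp)) x

/-- A smooth function as an element of `Sm`. -/
def Sm.mk (f : Point → ℝ) (hf : ContDiff ℝ ∞ f) : Sm := ⟨f, hf⟩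

/-- Evaluation of smooth functions at a point. -/
def ev (x : Point) : Sm →ₐ[ℝ] ℝ := (Pi.evalAlgHom ℝ (fun _ => ℝ) x).comp smoothAlg.val

theorem Sm.ext_ev {f g : Sm} (h : ∀ x, ev x f = ev x g) : f = g :=
  Subtype.ext (funext h)

theorem partialD_contDiff (a : Fin 4) (f : Sm) : ContDiff ℝ ∞ (partialD a (f : Point → ℝ)) :=
  (f.contDiff.fderiv_right (m := ∞) (by simp)).clm_apply contDiff_const

/-- The coordinate derivations of the ring of smooth functions. -/
def D (a : Fin 4) : Derivation ℝ Sm Sm :=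
  Derivation.mk'
    { toFun := fun f => Sm.mk (partialD a (f : Point → ℝ)) (partialD_contDiff a f)
      map_add' := fun f g => Sm.ext_ev fun x => by
        change fderiv ℝ ((f : Point → ℝ) + (g : Point → ℝ)) x _ = fderiv ℝ (f : Point → ℝ) x _
          + fderiv ℝ (g : Point → ℝ) x _
        rw [fderiv_add (f.differentiableAt x) (g.differentiableAt x)]
        rfl
      map_smul' := fun c f => Sm.ext_ev fun x => by
        change fderiv ℝ (c • (f : Point → ℝ)) x _ = c * fderiv ℝ (f : Point → ℝ) x _
        rw [fderiv_const_smul (f.differentiableAt x)]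
        rfl }
    (fun f g => Sm.ext_ev fun x => by
      change partialD a ((f : Point → ℝ) * (g : Point → ℝ)) x = f.1 x * partialD a g x + g.1 x * partialD a f x
      simp only [partialD]
      rw [fderiv_mul (f.differentiableAt x) (g.differentiableAt x)]
      rfl)

theorem ev_D (x : Point) (a : Fin 4) (f : Sm) : ev x (D a f) = partialD a (f : Point → ℝ) x := rfl

theorem D_comm (a b : Fin 4) (f : Sm) : D a (D b f) = D b (D a f) := by
  refine Sm.ext_ev fun x => ?_
  have h : ∀ c d : Fin 4, ev x (D c (D d f)) =
      fderiv ℝ (fderiv ℝ (f : Point → ℝ)) x (Pi.single c 1) (Pi.single d 1) := by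
    intro c d
    rw [ev_D]
    change fderiv ℝ (fun y => fderiv ℝ (f : Point → ℝ) y (Pi.single d 1)) x (Pi.single c 1) = _
    rw [fderiv_clm_apply
      ((f.contDiff.fderiv_right (m := ∞) (by simp)).differentiable (by simp) x)
      (differentiableAt_const _)]
    simp
  rw [h, h]
  exact ((f.contDiff.contDiffAt (x := x)).isSymmSndFDerivAt
    (by simpa using WithTop.coe_le_coe.2 (le_top (a := (2 : ℕ∞))))).eq _ _

/-- The coordinate functions. -/
def X (a : Fin 4) : Sm := Sm.mk (fun x => x a) (contDiff_apply ℝ ℝ a)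

@[simp] theorem ev_X (x : Point) (a : Fin 4) : ev x (X a) = x a := rfl

theorem D_X (a b : Fin 4) : D a (X b) = if a = b then 1 else 0 := by
  refine Sm.ext_ev fun x => ?_
  have h : fderiv ℝ (fun y : Point => y b) x = ContinuousLinearMap.proj b :=
    (ContinuousLinearMap.proj (R := ℝ) (φ := fun _ : Fin 4 => ℝ) b).fderiv
  have h2 : ev x (D a (X b)) = (Pi.single a (1 : ℝ) : Point) b := by
    rw [ev_D]
    change fderiv ℝ (fun y : Point => y b) x (Pi.single a 1) = _
    rw [h]
    rfl
  rw [h2]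
  by_cases hab : a = b
  · subst hab
    simp
  · simp [hab, Ne.symm hab]

@[simp] theorem D_X_same (a : Fin 4) : D a (X a) = 1 := by simp [D_X]

/-- Constant functions. -/
abbrev C (r : ℝ) : Sm := algebraMap ℝ Sm r

@[simp] theorem ev_C (x : Point) (r : ℝ) : ev x (C r) = r := rfl

@[simp] theorem D_C (a : Fin 4) (r : ℝ) : D a (C r) = 0 := (D a).map_algebraMap r

/-- The point with first coordinate `t` and all others zero. -/
def axis (t : ℝ) : Point := Pi.single 0 t

theorem hasDerivAt_line (f : Sm) (x : Point) (a : Fin 4) (t : ℝ) :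
    HasDerivAt (fun s => ev (x + s • Pi.single a 1) f)
      (ev (x + t • Pi.single a 1) (D a f)) t := by
  have h1 : HasFDerivAt (f : Point → ℝ) (fderiv ℝ (f : Point → ℝ) (x + t • Pi.single a 1))
      (x + t • Pi.single a 1) := (f.differentiableAt _).hasFDerivAt
  have h2 : HasDerivAt (fun s : ℝ => x + s • (Pi.single a 1 : Point)) (Pi.single a 1) t := by
    simpa using ((hasDerivAt_id t).smul_const (Pi.single a 1 : Point)).const_add x
  exact h1.comp_hasDerivAt t h2

theorem ev_line_eq {f : Sm} {a : Fin 4} (h : D a f = 0) (x : Point) (t : ℝ) :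
    ev (x + t • Pi.single a 1) f = ev x f := by
  have h1 : ∀ s, HasDerivAt (fun s => ev (x + s • Pi.single a 1) f) 0 s := fun s => by
    simpa [h] using hasDerivAt_line f x a s
  have := is_const_of_deriv_eq_zero (fun s => (h1 s).differentiableAt)
    (fun s => (h1 s).deriv) t 0
  simpa using this

/-- A smooth function of the first coordinate only. -/
def Fiberwise (f : Sm) : Prop := D 1 f = 0 ∧ D 2 f = 0 ∧ D 3 f = 0

theorem Fiberwise.ev_eq {f : Sm} (h : Fiberwise f) (x : Point) :
    ev x f = ev (axis (x 0)) f := by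
  have hx : x = axis (x 0) + x 1 • Pi.single 1 1 + x 2 • Pi.single 2 1 + x 3 • Pi.single 3 1 := by
    ext i
    fin_cases i <;> simp [axis]
  conv_lhs => rw [hx]
  rw [ev_line_eq h.2.2, ev_line_eq h.2.1, ev_line_eq h.1]

theorem Fiberwise.hasDerivAt {f : Sm} (t : ℝ) :
    HasDerivAt (fun s => ev (axis s) f) (ev (axis t) (D 0 f)) t := by
  have h : ∀ s, (0 : Point) + s • Pi.single 0 1 = axis s := fun s => by
    ext i
    fin_cases i <;> simp [axis]
  simpa only [h] using hasDerivAt_line f 0 0 t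

theorem eq_C_of_D_eq_zero {f : Sm} (h : Fiberwise f) (h0 : D 0 f = 0) : f = C (ev 0 f) := by
  refine Sm.ext_ev fun x => ?_
  rw [h.ev_eq, ev_C]
  have : axis (x 0) = 0 + (x 0) • Pi.single 0 1 := by
    ext i
    fin_cases i <;> simp [axis]
  rw [this, ev_line_eq h0]

/-- Uniqueness for linear systems of ordinary differential equations in the first coordinate. -/
theorem linearODE_unique {ι : Type*} [Fintype ι] [DecidableEq ι] (M : Matrix ι ι ℝ) (f : ι → Sm)
    (hf : ∀ i, Fiberwise (f i)) (hD : ∀ i, D 0 (f i) = ∑ j, C (M i j) * f j)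
    (h0 : ∀ i, ev 0 (f i) = 0) (i : ι) : f i = 0 := by
  set L : (ι → ℝ) →L[ℝ] (ι → ℝ) := LinearMap.toContinuousLinearMap (Matrix.toLin' M)
  have key : (fun s => fun i => ev (axis s) (f i)) = fun _ => (0 : ι → ℝ) := by
    refine ODE_solution_unique_univ (v := fun _ x => L x) (s := fun _ => Set.univ) (t₀ := 0)
      (K := ‖L‖₊) (fun t => L.lipschitz.lipschitzOnWith) (fun t => ⟨?_, trivial⟩)
      (fun t => ⟨by simpa using hasDerivAt_const t (0 : ι → ℝ), trivial⟩) ?_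
    · rw [hasDerivAt_pi]
      intro j
      have h := Fiberwise.hasDerivAt (f := f j) t
      rw [hD] at h
      simpa [L, Matrix.toLin'_apply, Matrix.mulVec, dotProduct] using h
    · ext j
      have : axis 0 = 0 := by simp [axis]
      simpa [this] using h0 j
  refine Sm.ext_ev fun x => ?_
  rw [(hf i).ev_eq]
  simpa using congrFun (congrFun key (x 0)) i

/-- Existence for linear systems of ordinary differential equations in the first coordinate. -/
theorem linearODE_exists {n : ℕ} (M : Matrix (Fin n) (Fin n) ℝ) (s : Fin n → ℝ) :
    ∃ f : Fin n → Sm, (∀ i, Fiberwise (f i)) ∧ (∀ i, D 0 (f i) = ∑ j, C (M i j) * f j) ∧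
      ∀ x : Point, x 0 = 0 → ∀ i, ev x (f i) = s i := by
  let _ : NormedRing (Matrix (Fin n) (Fin n) ℝ) := Matrix.linftyOpNormedRing
  let _ : NormedAlgebra ℝ (Matrix (Fin n) (Fin n) ℝ) := Matrix.linftyOpNormedAlgebra
  have hexp : ∀ t : ℝ, HasDerivAt (fun u : ℝ => NormedSpace.exp (u • M))
      (M * NormedSpace.exp (t • M)) t := fun t => hasDerivAt_exp_smul_const' (𝕂 := ℝ) M t
  have hcd : ContDiff ℝ ∞ (fun u : ℝ => NormedSpace.exp (u • M)) := by
    have h1 : ContDiff ℝ ∞ (NormedSpace.exp : Matrix (Fin n) (Fin n) ℝ → _) :=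
      contDiff_iff_contDiffAt.2 fun x => (NormedSpace.exp_analytic (𝕂 := ℝ) x).contDiffAt
    exact h1.comp (contDiff_id.smul contDiff_const)
  set A : Fin n → Matrix (Fin n) (Fin n) ℝ →L[ℝ] ℝ := fun i =>
    LinearMap.toContinuousLinearMap
      ((LinearMap.proj i).comp ((Matrix.mulVecBilin ℝ ℝ).flip s)) with hA
  have hAv : ∀ i N, A i N = (N.mulVec s) i := fun i N => rfl
  set F : Fin n → ℝ → ℝ := fun i t => A i (NormedSpace.exp (t • M)) with hF
  have hFd : ∀ i t, HasDerivAt (F i) (A i (M * NormedSpace.exp (t • M))) t := fun i t =>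
    (A i).hasFDerivAt.comp_hasDerivAt t (hexp t)
  have hFc : ∀ i, ContDiff ℝ ∞ (fun x : Point => F i (x 0)) := fun i =>
    ((A i).contDiff.comp hcd).comp (contDiff_apply ℝ ℝ (0 : Fin 4))
  have hpd : ∀ i a x, partialD a (fun x : Point => F i (x 0)) x =
      (Pi.single a 1 : Point) 0 * A i (M * NormedSpace.exp ((x 0) • M)) := by
    intro i a x
    have h1 : HasFDerivAt (fun x : Point => x 0)
        (ContinuousLinearMap.proj (R := ℝ) (φ := fun _ : Fin 4 => ℝ) 0) x :=
      (ContinuousLinearMap.proj (R := ℝ) (φ := fun _ : Fin 4 => ℝ) 0).hasFDerivAt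
    have h2 := (hFd i (x 0)).comp_hasFDerivAt x h1
    unfold partialD
    rw [show (fun x : Point => F i (x 0)) = F i ∘ fun x : Point => x 0 from rfl, h2.fderiv]
    simp [mul_comm]
  refine ⟨fun i => Sm.mk (fun x => F i (x 0)) (hFc i), fun i => ⟨?_, ?_, ?_⟩, fun i => ?_, fun x hx i => ?_⟩
  · exact Sm.ext_ev fun x => ((ev_D x 1 _).trans (hpd i 1 x)).trans (by simp)
  · exact Sm.ext_ev fun x => ((ev_D x 2 _).trans (hpd i 2 x)).trans (by simp)
  · exact Sm.ext_ev fun x => ((ev_D x 3 _).trans (hpd i 3 x)).trans (by simp)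
  · refine Sm.ext_ev fun x => ?_
    refine ((ev_D x 0 _).trans (hpd i 0 x)).trans ?_
    rw [hAv, ← Matrix.mulVec_mulVec]
    simp only [Pi.single_eq_same, one_mul, map_sum, map_mul, ev_C]
    rfl
  · change A i (NormedSpace.exp ((x 0) • M)) = s i
    rw [hx, hAv]
    simp

/-! ### The metric and its connection over the ring of smooth functions -/

/-- Covector fields with smooth components. -/
abbrev SmCov : Type := Fin 4 → Sm

/-- 2-tensor fields with smooth components. -/
abbrev SmTensor : Type := Matrix (Fin 4) (Fin 4) Sm

/-- The underlying covector field. -/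
def toCov (K : SmCov) : CovectorField := fun x a => ev x (K a)

/-- The underlying tensor field. -/
def toTensor : SmTensor →ₗ[ℝ] TensorField where
  toFun T := fun x => T.map (ev x)
  map_add' S T := by
    ext x a b
    simp
  map_smul' c T := by
    ext x a b
    simp

theorem toTensor_apply (T : SmTensor) (x : Point) (a b : Fin 4) :
    toTensor T x a b = ev x (T a b) := rfl

theorem toTensor_injective : Function.Injective toTensor := by
  intro S T h
  exact Matrix.ext fun a b => Sm.ext_ev fun x => congrFun (congrFun (congrFun h x) a) b

@[simp] theorem ev_ofNat (x : Point) (n : ℕ) [n.AtLeastTwo] :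
    ev x (ofNat(n) : Sm) = OfNat.ofNat n := map_natCast (ev x) n

/-- The metric as a matrix of smooth functions. -/
def G (ε a₁ a₂ γ : ℝ) : SmTensor :=
  !![C (γ ^ 2 + a₁) * X 1 ^ 2 + C (γ ^ 2 + a₂) * X 2 ^ 2 - 2 * C ε * X 3, -(C γ * X 2), C γ * X 1, 1;
     -(C γ * X 2), 1, 0, 0;
     C γ * X 1, 0, 1, 0;
     1, 0, 0, 0]

/-- The inverse metric. -/
def Ginv (ε a₁ a₂ γ : ℝ) : SmTensor :=
  !![0, 0, 0, 1;
     0, 1, 0, C γ * X 2;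
     0, 0, 1, -(C γ * X 1);
     1, C γ * X 2, -(C γ * X 1), 2 * C ε * X 3 - C a₁ * X 1 ^ 2 - C a₂ * X 2 ^ 2]

/-- The Christoffel symbols `Γ^c_{ab}`. -/
def Gam (ε a₁ a₂ γ : ℝ) : Fin 4 → SmTensor :=
  ![!![C ε, 0, 0, 0; 0, 0, 0, 0; 0, 0, 0, 0; 0, 0, 0, 0],
    !![C γ * C ε * X 2 - C (γ ^ 2 + a₁) * X 1, 0, -C γ, 0; 0, 0, 0, 0; -C γ, 0, 0, 0; 0, 0, 0, 0],
    !![-(C γ * C ε * X 1) - C (γ ^ 2 + a₂) * X 2, C γ, 0, 0; C γ, 0, 0, 0; 0, 0, 0, 0; 0, 0, 0, 0],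
    !![C γ * (C a₂ - C a₁) * X 1 * X 2 - C ε * (C a₁ * X 1 ^ 2 + C a₂ * X 2 ^ 2 - 2 * C ε * X 3),
        C a₁ * X 1, C a₂ * X 2, -C ε;
       C a₁ * X 1, 0, 0, 0; C a₂ * X 2, 0, 0, 0; -C ε, 0, 0, 0]]

variable (ε a₁ a₂ γ : ℝ)

theorem toTensor_G : toTensor (G ε a₁ a₂ γ) = metric ε a₁ a₂ γ := by
  ext x a b
  rw [toTensor_apply]
  fin_cases a <;> fin_cases b <;> simp [G, metric]

theorem metric_inv (x : Point) :
    (metric ε a₁ a₂ γ x)⁻¹ = toTensor (Ginv ε a₁ a₂ γ) x := by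
  refine Matrix.inv_eq_right_inv ?_
  ext a b
  fin_cases a <;> fin_cases b <;>
    simp [Ginv, metric, toTensor_apply, Matrix.mul_apply, Fin.sum_univ_four]
  ring

theorem D_G (d a b : Fin 4) (x : Point) :
    partialD d (fun y => metric ε a₁ a₂ γ y a b) x = ev x (D d (G ε a₁ a₂ γ a b)) := by
  rw [ev_D, ← toTensor_G]
  rfl

/-- The partial derivatives of the metric. -/
def dG : Fin 4 → SmTensor :=
  ![0, !![2 * C (γ ^ 2 + a₁) * X 1, 0, C γ, 0; 0, 0, 0, 0; C γ, 0, 0, 0; 0, 0, 0, 0],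
    !![2 * C (γ ^ 2 + a₂) * X 2, -C γ, 0, 0; -C γ, 0, 0, 0; 0, 0, 0, 0; 0, 0, 0, 0],
    !![-(2 * C ε), 0, 0, 0; 0, 0, 0, 0; 0, 0, 0, 0; 0, 0, 0, 0]]

theorem D_ofNat (d : Fin 4) (n : ℕ) [n.AtLeastTwo] : D d (ofNat(n) : Sm) = 0 :=
  (D d).map_natCast n

set_option maxHeartbeats 1000000 in
theorem D_G_eq (d a b : Fin 4) : D d (G ε a₁ a₂ γ a b) = dG ε a₁ a₂ γ d a b := by
  fin_cases d <;> fin_cases a <;> fin_cases b <;>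
    simp [G, dG, D_X, D_ofNat, Derivation.leibniz, Derivation.leibniz_pow, smul_eq_mul] <;> ring

set_option maxHeartbeats 1000000 in
theorem christoffel_metric (c a b : Fin 4) (x : Point) :
    christoffel (metric ε a₁ a₂ γ) c a b x = ev x (Gam ε a₁ a₂ γ c a b) := by
  unfold christoffel
  simp only [D_G, D_G_eq, metric_inv, toTensor_apply, Fin.sum_univ_four]
  fin_cases c <;> fin_cases a <;> fin_cases b <;> simp [Ginv, dG, Gam] <;> ring

/-- The symmetrized covariant derivative of a smooth covector field. -/
def symD : SmCov →ₗ[ℝ] SmTensor where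
  toFun K := Matrix.of fun a b =>
    C (1 / 2) * (D a (K b) + D b (K a)) - ∑ c, Gam ε a₁ a₂ γ c a b * K c
  map_add' K K' := by
    refine Matrix.ext fun a b => ?_
    simp only [Matrix.of_apply, Matrix.add_apply, Pi.add_apply, map_add, Fin.sum_univ_four]
    ring
  map_smul' r K := by
    refine Matrix.ext fun a b => ?_
    simp only [Matrix.of_apply, Matrix.smul_apply, Pi.smul_apply, Derivation.map_smul,
      Fin.sum_univ_four, RingHom.id_apply]
    simp only [Algebra.smul_def]
    ring

theorem Gam_symm (c a b : Fin 4) : Gam ε a₁ a₂ γ c a b = Gam ε a₁ a₂ γ c b a := by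
  fin_cases c <;> fin_cases a <;> fin_cases b <;> rfl

theorem symCovD_toCov (K : SmCov) :
    symCovD (metric ε a₁ a₂ γ) (toCov K) = toTensor (symD ε a₁ a₂ γ K) := by
  ext x a b
  rw [toTensor_apply]
  have h : ∀ a b, partialD a (fun y => toCov K y b) x = ev x (D a (K b)) := fun _ _ => rfl
  simp only [symCovD, covD, Matrix.of_apply, h, christoffel_metric, symD, LinearMap.coe_mk,
    AddHom.coe_mk, map_sub, map_mul, map_add, map_sum, ev_C]
  simp only [Gam_symm ε a₁ a₂ γ _ b a, toCov]
  ring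

/-- The trace-free part of a smooth tensor field. -/
def trFree : SmTensor →ₗ[ℝ] SmTensor where
  toFun T := T - (C (1 / 4) * ∑ c, ∑ d, Ginv ε a₁ a₂ γ c d * T c d) • G ε a₁ a₂ γ
  map_add' S T := by
    refine Matrix.ext fun a b => ?_
    simp only [Matrix.sub_apply, Matrix.add_apply, Matrix.smul_apply, smul_eq_mul,
      Fin.sum_univ_four]
    ring
  map_smul' r T := by
    refine Matrix.ext fun a b => ?_
    simp only [Matrix.sub_apply, Matrix.smul_apply, smul_eq_mul,
      Fin.sum_univ_four, RingHom.id_apply]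
    simp only [Algebra.smul_def r (_ : Sm)]
    ring

theorem traceFree_toTensor (T : SmTensor) :
    traceFree (metric ε a₁ a₂ γ) (toTensor T) = toTensor (trFree ε a₁ a₂ γ T) := by
  ext x a b
  rw [toTensor_apply]
  simp only [traceFree, metric_inv]
  simp only [← toTensor_G, trFree, LinearMap.coe_mk, AddHom.coe_mk,
    Matrix.sub_apply, Matrix.smul_apply, smul_eq_mul, toTensor_apply, map_sub, map_mul, map_sum,
    ev_C]

theorem trFree_smul_G (f : Sm) : trFree ε a₁ a₂ γ (f • G ε a₁ a₂ γ) = 0 := by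
  have h : ∑ c, ∑ d, Ginv ε a₁ a₂ γ c d * (f • G ε a₁ a₂ γ) c d = C 4 * f := by
    simp [Fin.sum_univ_four, Ginv, G]
    rw [show C 4 = 4 from map_ofNat _ 4]
    ring
  have h2 : C (1 / 4) * (C 4 * f) = f := by
    rw [← mul_assoc, ← map_mul]
    norm_num
  simp only [trFree, LinearMap.coe_mk, AddHom.coe_mk, h, h2, sub_self]

/-- The multiplier is a quarter of the trace, and `f • G` has trace `4 f`. This is where the
conformal factor `f` enters. -/
theorem trFree_eq_zero_iff (T : SmTensor) :
    trFree ε a₁ a₂ γ T = 0 ↔ ∃ f : Sm, T = f • G ε a₁ a₂ γ := by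
  refine ⟨fun h => ⟨_, sub_eq_zero.1 h⟩, ?_⟩
  rintro ⟨f, rfl⟩
  exact trFree_smul_G ε a₁ a₂ γ f

/-- The symmetric product of smooth covector fields. -/
def sp : SmCov →ₗ[ℝ] SmCov →ₗ[ℝ] SmTensor :=
  LinearMap.mk₂ ℝ (fun K K' => Matrix.of fun a b => C (1 / 2) * (K a * K' b + K b * K' a))
    (fun _ _ _ => by refine Matrix.ext fun a b => ?_; simp only [Matrix.of_apply, Matrix.add_apply, Pi.add_apply]; ring) (fun _ _ _ => by refine Matrix.ext fun a b => ?_; simp only [Matrix.of_apply, Matrix.smul_apply, Pi.smul_apply, Algebra.smul_def]; ring)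
    (fun _ _ _ => by refine Matrix.ext fun a b => ?_; simp only [Matrix.of_apply, Matrix.add_apply, Pi.add_apply]; ring) (fun _ _ _ => by refine Matrix.ext fun a b => ?_; simp only [Matrix.of_apply, Matrix.smul_apply, Pi.smul_apply, Algebra.smul_def]; ring)

theorem sp_apply (K K' : SmCov) (a b : Fin 4) :
    sp K K' a b = C (1 / 2) * (K a * K' b + K b * K' a) := rfl

theorem sp_comm (K K' : SmCov) : sp K K' = sp K' K := by
  refine Matrix.ext fun a b => ?_
  rw [sp_apply, sp_apply]
  ring

theorem symProd_toCov (K K' : SmCov) : symProd (toCov K) (toCov K') = toTensor (sp K K') := by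
  ext x a b
  rw [toTensor_apply, sp_apply]
  simp [symProd, toCov]

/-! ### Killing and conformal Killing vectors over the ring of smooth functions. -/

/-- Smooth Killing vectors. -/
def Kil : Submodule ℝ SmCov := LinearMap.ker (symD ε a₁ a₂ γ)

/-- Smooth conformal Killing vectors. -/
def CK : Submodule ℝ SmCov := LinearMap.ker (trFree ε a₁ a₂ γ ∘ₗ symD ε a₁ a₂ γ)

theorem mem_Kil {K : SmCov} : K ∈ Kil ε a₁ a₂ γ ↔ symD ε a₁ a₂ γ K = 0 := Iff.rfl

theorem mem_CK {K : SmCov} :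
    K ∈ CK ε a₁ a₂ γ ↔ ∃ f : Sm, symD ε a₁ a₂ γ K = f • G ε a₁ a₂ γ :=
  trFree_eq_zero_iff ε a₁ a₂ γ _

theorem exists_toCov {k : CovectorField} (hk : ContDiff ℝ ∞ k) : ∃ K : SmCov, k = toCov K :=
  ⟨fun a => ⟨fun x => k x a, contDiff_pi.1 hk a⟩, rfl⟩

theorem contDiff_toCov (K : SmCov) : ContDiff ℝ ∞ (toCov K) :=
  contDiff_pi.2 fun a => (K a).contDiff

theorem isKilling_iff (k : CovectorField) :
    IsKilling (metric ε a₁ a₂ γ) k ↔ ∃ K ∈ Kil ε a₁ a₂ γ, k = toCov K := by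
  constructor
  · rintro ⟨h1, h2⟩
    obtain ⟨K, rfl⟩ := exists_toCov h1
    rw [symCovD_toCov] at h2
    exact ⟨K, toTensor_injective (by rw [h2, map_zero]), rfl⟩
  · rintro ⟨K, hK, rfl⟩
    refine ⟨contDiff_toCov K, ?_⟩
    rw [symCovD_toCov, (mem_Kil ε a₁ a₂ γ).1 hK, map_zero]

theorem isConformalKilling_iff (k : CovectorField) :
    IsConformalKilling (metric ε a₁ a₂ γ) k ↔ ∃ K ∈ CK ε a₁ a₂ γ, k = toCov K := by
  constructor
  · rintro ⟨h1, h2⟩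
    obtain ⟨K, rfl⟩ := exists_toCov h1
    rw [symCovD_toCov, traceFree_toTensor] at h2
    exact ⟨K, toTensor_injective (by rw [map_zero]; exact h2), rfl⟩
  · rintro ⟨K, hK, rfl⟩
    refine ⟨contDiff_toCov K, ?_⟩
    rw [symCovD_toCov, traceFree_toTensor]
    exact (congrArg toTensor (LinearMap.mem_ker.1 hK)).trans (map_zero _)

/-- Reducible Killing tensors over the ring of smooth functions. -/
def redKil : Submodule ℝ SmTensor :=
  Submodule.span ℝ (insert (G ε a₁ a₂ γ)
    {T | ∃ K ∈ Kil ε a₁ a₂ γ, ∃ K' ∈ Kil ε a₁ a₂ γ, T = sp K K'})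

/-- Reducible conformal Killing tensors over the ring of smooth functions. -/
def redCK : Submodule ℝ SmTensor :=
  Submodule.span ℝ
    {T | ∃ K ∈ CK ε a₁ a₂ γ, ∃ K' ∈ CK ε a₁ a₂ γ, T = trFree ε a₁ a₂ γ (sp K K')}

/-- The linear map `toTensor` is injective and carries generators onto generators, so it preserves
the dimension of the span. -/
theorem finrank_reducibleKillingTensors :
    Module.finrank ℝ (reducibleKillingTensors (metric ε a₁ a₂ γ)) =
      Module.finrank ℝ (redKil ε a₁ a₂ γ) := by
  have h : reducibleKillingTensors (metric ε a₁ a₂ γ) = (redKil ε a₁ a₂ γ).map toTensor := by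
    rw [redKil, Submodule.map_span, Set.image_insert_eq, toTensor_G, reducibleKillingTensors]
    congr 2
    ext T
    constructor
    · rintro ⟨k, k', hk, hk', rfl⟩
      obtain ⟨K, hK, rfl⟩ := (isKilling_iff ε a₁ a₂ γ k).1 hk
      obtain ⟨K', hK', rfl⟩ := (isKilling_iff ε a₁ a₂ γ k').1 hk'
      exact ⟨_, ⟨K, hK, K', hK', rfl⟩, (symProd_toCov K K').symm⟩
    · rintro ⟨_, ⟨K, hK, K', hK', rfl⟩, rfl⟩
      exact ⟨_, _, (isKilling_iff ε a₁ a₂ γ _).2 ⟨K, hK, rfl⟩,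
        (isKilling_iff ε a₁ a₂ γ _).2 ⟨K', hK', rfl⟩, (symProd_toCov K K').symm⟩
  rw [h]
  exact (LinearEquiv.finrank_eq (Submodule.equivMapOfInjective _ toTensor_injective _)).symm

theorem finrank_reducibleConformalKillingTensors :
    Module.finrank ℝ (reducibleConformalKillingTensors (metric ε a₁ a₂ γ)) =
      Module.finrank ℝ (redCK ε a₁ a₂ γ) := by
  have h : reducibleConformalKillingTensors (metric ε a₁ a₂ γ) =
      (redCK ε a₁ a₂ γ).map toTensor := by
    rw [redCK, Submodule.map_span, reducibleConformalKillingTensors]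
    congr 1
    ext T
    constructor
    · rintro ⟨k, k', hk, hk', rfl⟩
      obtain ⟨K, hK, rfl⟩ := (isConformalKilling_iff ε a₁ a₂ γ k).1 hk
      obtain ⟨K', hK', rfl⟩ := (isConformalKilling_iff ε a₁ a₂ γ k').1 hk'
      refine ⟨_, ⟨K, hK, K', hK', rfl⟩, ?_⟩
      rw [symProd_toCov, traceFree_toTensor]
    · rintro ⟨_, ⟨K, hK, K', hK', rfl⟩, rfl⟩
      refine ⟨_, _, (isConformalKilling_iff ε a₁ a₂ γ _).2 ⟨K, hK, rfl⟩,
        (isConformalKilling_iff ε a₁ a₂ γ _).2 ⟨K', hK', rfl⟩, ?_⟩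
      rw [symProd_toCov, traceFree_toTensor]
  rw [h]
  exact (LinearEquiv.finrank_eq (Submodule.equivMapOfInjective _ toTensor_injective _)).symm

/-! ### Integration of the conformal Killing equation -/

/-- The conformal Killing equation in components. -/
structure CKEqs (ε a₁ a₂ γ : ℝ) (k₀ k₁ k₂ k₃ f : Sm) : Prop where
  e00 : D 0 k₀ = C ε * k₀ + (C γ * C ε * X 2 - (C γ ^ 2 + C a₁) * X 1) * k₁
    - (C γ * C ε * X 1 + (C γ ^ 2 + C a₂) * X 2) * k₂
    + (C γ * (C a₂ - C a₁) * X 1 * X 2 - C ε * (C a₁ * X 1 ^ 2 + C a₂ * X 2 ^ 2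
      - 2 * C ε * X 3)) * k₃
    + f * ((C γ ^ 2 + C a₁) * X 1 ^ 2 + (C γ ^ 2 + C a₂) * X 2 ^ 2 - 2 * C ε * X 3)
  e01 : D 1 k₀ = 2 * (C γ * k₂ + C a₁ * X 1 * k₃) - 2 * f * (C γ * X 2) - D 0 k₁
  e02 : D 2 k₀ = 2 * (-(C γ * k₁) + C a₂ * X 2 * k₃) + 2 * f * (C γ * X 1) - D 0 k₂
  e03 : D 3 k₀ = 2 * f - D 0 k₃ - 2 * C ε * k₃
  e11 : D 1 k₁ = f
  e22 : D 2 k₂ = f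
  e12 : D 2 k₁ = -D 1 k₂
  e13 : D 3 k₁ = -D 1 k₃
  e23 : D 3 k₂ = -D 2 k₃
  e33 : D 3 k₃ = 0

theorem two_mul_C_half (f : Sm) : 2 * (C (1 / 2) * f) = f := by
  refine Sm.ext_ev fun x => ?_
  simp

-- By symmetry ten of the sixteen entries suffice. From here on the geometry is used only through
-- these ten equations.
set_option maxHeartbeats 1000000 in
theorem symD_eq_smul_iff {ε a₁ a₂ γ : ℝ} {K : SmCov} {f : Sm} :
    symD ε a₁ a₂ γ K = f • G ε a₁ a₂ γ ↔ CKEqs ε a₁ a₂ γ (K 0) (K 1) (K 2) (K 3) f := by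
  have key : ∀ a b, (symD ε a₁ a₂ γ K a b = (f • G ε a₁ a₂ γ) a b ↔
      D a (K b) + D b (K a) =
        2 * (∑ c, Gam ε a₁ a₂ γ c a b * K c + f * G ε a₁ a₂ γ a b)) := by
    intro a b
    have h : symD ε a₁ a₂ γ K a b =
      C (1 / 2) * (D a (K b) + D b (K a)) - ∑ c, Gam ε a₁ a₂ γ c a b * K c := rfl
    rw [h, Matrix.smul_apply, smul_eq_mul]
    constructor
    · intro h
      linear_combination 2 * h - two_mul_C_half (D a (K b) + D b (K a))
    · intro h
      rw [h, show C (1 / 2) * (2 * (∑ c, Gam ε a₁ a₂ γ c a b * K c + f * G ε a₁ a₂ γ a b)) = _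
        from (mul_left_comm _ _ _).trans (two_mul_C_half _)]
      ring
  have cancel : ∀ {f g : Sm}, 2 * f = 2 * g → f = g := by
    intro f g h
    refine Sm.ext_ev fun x => ?_
    have := congrArg (ev x) h
    simpa using this
  constructor
  · intro h
    have h' : ∀ a b, _ := fun a b => (key a b).1 (congrFun (congrFun h a) b)
    have h00 := h' 0 0
    have h01 := h' 0 1
    have h02 := h' 0 2
    have h03 := h' 0 3
    have h11 := h' 1 1
    have h12 := h' 1 2
    have h13 := h' 1 3
    have h22 := h' 2 2
    have h23 := h' 2 3
    have h33 := h' 3 3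
    simp [Gam, G, Fin.sum_univ_four] at h00 h01 h02 h03 h11 h12 h13 h22 h23 h33
    constructor
    · refine cancel ?_
      linear_combination h00
    · linear_combination h01
    · linear_combination h02
    · linear_combination h03
    · refine cancel ?_
      linear_combination h11
    · refine cancel ?_
      linear_combination h22
    · linear_combination h12
    · linear_combination h13
    · linear_combination h23
    · refine cancel ?_
      linear_combination h33
  · intro h
    refine Matrix.ext fun a b => (key a b).2 ?_
    obtain ⟨e00, e01, e02, e03, e11, e22, e12, e13, e23, e33⟩ := h
    fin_cases a <;> fin_cases b <;> simp [Gam, G, Fin.sum_univ_four]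
    · linear_combination 2 * e00
    · linear_combination e01
    · linear_combination e02
    · linear_combination e03
    · linear_combination e01
    · linear_combination 2 * e11
    · linear_combination e12
    · linear_combination e13
    · linear_combination e02
    · linear_combination e12
    · linear_combination 2 * e22
    · linear_combination e23
    · linear_combination e03
    · linear_combination e13
    · linear_combination e23
    · linear_combination 2 * e33

@[simp] theorem D10 (f : Sm) : D 1 (D 0 f) = D 0 (D 1 f) := D_comm _ _ _
@[simp] theorem D20 (f : Sm) : D 2 (D 0 f) = D 0 (D 2 f) := D_comm _ _ _
@[simp] theorem D30 (f : Sm) : D 3 (D 0 f) = D 0 (D 3 f) := D_comm _ _ _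
@[simp] theorem D21 (f : Sm) : D 2 (D 1 f) = D 1 (D 2 f) := D_comm _ _ _
@[simp] theorem D31 (f : Sm) : D 3 (D 1 f) = D 1 (D 3 f) := D_comm _ _ _
@[simp] theorem D32 (f : Sm) : D 3 (D 2 f) = D 2 (D 3 f) := D_comm _ _ _

@[simp] theorem D_mul (a : Fin 4) (f g : Sm) : D a (f * g) = f * D a g + g * D a f :=
  (D a).leibniz f g

@[simp] theorem D_two (a : Fin 4) : D a (2 : Sm) = 0 := D_ofNat a 2

@[simp] theorem D01X : D 0 (X 1) = 0 := by simp [D_X]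
@[simp] theorem D02X : D 0 (X 2) = 0 := by simp [D_X]
@[simp] theorem D03X : D 0 (X 3) = 0 := by simp [D_X]
@[simp] theorem D12X : D 1 (X 2) = 0 := by simp [D_X]
@[simp] theorem D13X : D 1 (X 3) = 0 := by simp [D_X]
@[simp] theorem D21X : D 2 (X 1) = 0 := by simp [D_X]
@[simp] theorem D23X : D 2 (X 3) = 0 := by simp [D_X]
@[simp] theorem D31X : D 3 (X 1) = 0 := by simp [D_X]
@[simp] theorem D32X : D 3 (X 2) = 0 := by simp [D_X]

theorem two_cancel {f g : Sm} (h : 2 * f = 2 * g) : f = g := by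
  refine Sm.ext_ev fun x => ?_
  have := congrArg (ev x) h
  simpa using this

theorem C_cancel {r : ℝ} {f : Sm} (hr : r ≠ 0) (h : C r * f = 0) : f = 0 := by
  refine Sm.ext_ev fun x => ?_
  have := congrArg (ev x) h
  simpa [hr] using this

theorem C_cancel_sub {r s : ℝ} {f : Sm} (h : r ≠ s) (hf : C r * f - C s * f = 0) : f = 0 := by
  refine C_cancel (sub_ne_zero.2 h) ?_
  have : C (r - s) = C r - C s := map_sub _ r s
  rw [this, sub_mul, hf]

@[simp] theorem C_ofNat (n : ℕ) [n.AtLeastTwo] : C (ofNat(n) : ℝ) = (ofNat(n) : Sm) :=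
  map_ofNat _ n

namespace CKEqs

variable {ε a₁ a₂ γ : ℝ} {k₀ k₁ k₂ k₃ f : Sm}


theorem d3f (h : CKEqs ε a₁ a₂ γ k₀ k₁ k₂ k₃ f) : D 3 f = -D 1 (D 1 k₃) := by
  simp [← h.e11, h.e13]

theorem d12 (h : CKEqs ε a₁ a₂ γ k₀ k₁ k₂ k₃ f) : D 1 (D 2 k₃) = 0 := by
  have h1 := congrArg (D 3) h.e12
  simp [h.e13, h.e23] at h1
  refine two_cancel ?_
  linear_combination -h1

theorem d11 (h : CKEqs ε a₁ a₂ γ k₀ k₁ k₂ k₃ f) : D 2 (D 2 k₃) = D 1 (D 1 k₃) := by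
  have h1 := congrArg (D 3) h.e22
  simp [h.e23, h.d3f] at h1
  exact h1

/-- Call this second derivative λ. Together with `d12`, `d11` and `e33`, this makes k₃ equal to
λ(x₂² + x₃²)/2 plus an affine function of x₂, x₃, with coefficients depending on x₁ only. -/
theorem fiberwise_lam (h : CKEqs ε a₁ a₂ γ k₀ k₁ k₂ k₃ f) : Fiberwise (D 1 (D 1 k₃)) := by
  refine ⟨?_, ?_, ?_⟩
  · rw [← h.d11, D_comm 1 2, h.d12, map_zero]
  · simp [h.d12]
  · simp [h.e33]

theorem d1f (h : CKEqs ε a₁ a₂ γ k₀ k₁ k₂ k₃ f) :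
    D 1 f = D 0 (D 1 k₃) + C ε * D 1 k₃ - C γ * D 2 k₃ + C γ * X 2 * D 1 (D 1 k₃) := by
  have h1 := congrArg (D 3) h.e01
  simp [h.e13, h.e23, h.d3f, h.e33, h.e03] at h1
  refine two_cancel ?_
  linear_combination h1

theorem d2f (h : CKEqs ε a₁ a₂ γ k₀ k₁ k₂ k₃ f) :
    D 2 f = D 0 (D 2 k₃) + C ε * D 2 k₃ + C γ * D 1 k₃ - C γ * X 1 * D 1 (D 1 k₃) := by
  have h1 := congrArg (D 3) h.e02
  simp [h.e13, h.e23, h.d3f, h.e33, h.e03] at h1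
  refine two_cancel ?_
  linear_combination h1

theorem d1r (h : CKEqs ε a₁ a₂ γ k₀ k₁ k₂ k₃ f) : D 1 (D 1 k₂) = -D 2 f := by
  rw [← h.e11, D21, h.e12]
  simp

theorem d2r (h : CKEqs ε a₁ a₂ γ k₀ k₁ k₂ k₃ f) : D 1 (D 2 k₂) = D 1 f := by
  rw [h.e22]

/-- In the x₂x₃-plane (k₁, k₂) is a conformal field, so `f` and the rotation `D 1 k₂` satisfy the
Cauchy–Riemann equations `d1r` and `d2r`. -/
theorem harmonic (h : CKEqs ε a₁ a₂ γ k₀ k₁ k₂ k₃ f) : D 1 (D 1 f) + D 2 (D 2 f) = 0 := by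
  have h1 := congrArg (D 2) h.d1r
  simp [h.e22] at h1
  rw [h1]
  ring

theorem d0_lam (h : CKEqs ε a₁ a₂ γ k₀ k₁ k₂ k₃ f) :
    D 0 (D 1 (D 1 k₃)) = -(C ε * D 1 (D 1 k₃)) := by
  have h1 := h.harmonic
  obtain ⟨l1, l2, l3⟩ := h.fiberwise_lam
  rw [h.d1f, h.d2f] at h1
  simp [h.d12, h.d11, l1] at h1
  refine two_cancel ?_
  linear_combination h1

/-- The two mixed derivatives of k₀ computed from `e01` and `e02` must agree. Here a₁ and a₂ enter
separately, which is one source of rigidity when they differ. -/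
theorem d0r (h : CKEqs ε a₁ a₂ γ k₀ k₁ k₂ k₃ f) :
    D 0 (D 1 k₂) = C a₂ * X 2 * D 1 k₃ - C a₁ * X 1 * D 2 k₃
      + C γ * (X 1 * D 1 f + X 2 * D 2 f) := by
  have h1 := congrArg (D 2) h.e01
  have h2 := congrArg (D 1) h.e02
  simp [h.e22, h.e12, h.e11] at h1 h2
  refine two_cancel ?_
  linear_combination h2 - h1

theorem lam_eq_zero_of_ne (h : CKEqs ε a₁ a₂ γ k₀ k₁ k₂ k₃ f) (ha : a₁ ≠ a₂) :
    D 1 (D 1 k₃) = 0 := by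
  obtain ⟨l1, l2, l3⟩ := h.fiberwise_lam
  have h1 := congrArg (D 1) (congrArg (D 2) h.d0r)
  rw [h.d1f, h.d2f] at h1
  simp [h.d1f, h.d12, h.d11, h.e22, l1, h.d0_lam] at h1
  refine C_cancel_sub ha ?_
  linear_combination h1

theorem lam_eq_zero (h : CKEqs ε a₁ a₂ γ k₀ k₁ k₂ k₃ f) (h0 : ev 0 (D 1 (D 1 k₃)) = 0) :
    D 1 (D 1 k₃) = 0 :=
  linearODE_unique !![-ε] ![D 1 (D 1 k₃)] (fun i => by fin_cases i; exact h.fiberwise_lam)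
    (fun i => by fin_cases i; simp [h.d0_lam]) (fun i => by fin_cases i; exact h0) 0

theorem fiberwise_d1 (h : CKEqs ε a₁ a₂ γ k₀ k₁ k₂ k₃ f) (hl : D 1 (D 1 k₃) = 0) :
    Fiberwise (D 1 k₃) :=
  ⟨hl, by simp [h.d12], by simp [h.e33]⟩

theorem fiberwise_d2 (h : CKEqs ε a₁ a₂ γ k₀ k₁ k₂ k₃ f) (hl : D 1 (D 1 k₃) = 0) :
    Fiberwise (D 2 k₃) :=
  ⟨h.d12, by rw [h.d11, hl], by simp [h.e33]⟩

theorem fiberwise_d0 {g : Sm} (hg : Fiberwise g) : Fiberwise (D 0 g) := by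
  obtain ⟨h1, h2, h3⟩ := hg
  exact ⟨by simp [h1], by simp [h2], by simp [h3]⟩

theorem two_d0f (h : CKEqs ε a₁ a₂ γ k₀ k₁ k₂ k₃ f) (hl : D 1 (D 1 k₃) = 0) :
    2 * D 0 f = D 0 (D 0 k₃) + C ε * D 0 k₃
      - (C γ * C ε * X 2 - (C γ ^ 2 + C a₁) * X 1) * D 1 k₃
      + (C γ * C ε * X 1 + (C γ ^ 2 + C a₂) * X 2) * D 2 k₃ := by
  have h1 := congrArg (D 3) h.e00
  simp [h.e03, h.e13, h.e23, h.e33, h.d3f, hl] at h1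
  linear_combination h1

theorem d0d0_d1 (h : CKEqs ε a₁ a₂ γ k₀ k₁ k₂ k₃ f) (hl : D 1 (D 1 k₃) = 0) :
    D 0 (D 0 (D 1 k₃)) = -(C ε * D 0 (D 1 k₃)) + 2 * C γ * D 0 (D 2 k₃)
      + (C γ ^ 2 + C a₁) * D 1 k₃ + C γ * C ε * D 2 k₃ := by
  have h1 := congrArg (D 1) (h.two_d0f hl)
  simp [h.d1f, hl, h.d12] at h1
  linear_combination h1

theorem d0d0_d2 (h : CKEqs ε a₁ a₂ γ k₀ k₁ k₂ k₃ f) (hl : D 1 (D 1 k₃) = 0) :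
    D 0 (D 0 (D 2 k₃)) = -(C ε * D 0 (D 2 k₃)) - 2 * C γ * D 0 (D 1 k₃)
      + (C γ ^ 2 + C a₂) * D 2 k₃ - C γ * C ε * D 1 k₃ := by
  have h1 := congrArg (D 2) (h.two_d0f hl)
  simp [h.d2f, hl, h.d12, h.d11] at h1
  linear_combination h1

/-- Differentiating `d0r` in x₂ and using `d0d0_d1` give two formulas for the second x₁-derivative
of `D 1 k₃`. They differ by (a₁ − a₂) `D 1 k₃`. -/
theorem d1_eq_zero_of_ne (h : CKEqs ε a₁ a₂ γ k₀ k₁ k₂ k₃ f) (hl : D 1 (D 1 k₃) = 0)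
    (ha : a₁ ≠ a₂) : D 1 k₃ = 0 := by
  have h1 := congrArg (D 2) h.d0r
  simp [h.e22, h.d1f, h.d2f, hl, h.d12, h.d11] at h1
  have h2 := h.d0d0_d1 hl
  refine C_cancel_sub ha ?_
  linear_combination h1 - h2

theorem d2_eq_zero_of_ne (h : CKEqs ε a₁ a₂ γ k₀ k₁ k₂ k₃ f) (hl : D 1 (D 1 k₃) = 0)
    (ha : a₁ ≠ a₂) : D 2 k₃ = 0 := by
  have h1 := congrArg (D 1) h.d0r
  simp [h.d1r, h.d1f, h.d2f, hl, h.d12] at h1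
  have h2 := h.d0d0_d2 hl
  refine C_cancel_sub ha ?_
  linear_combination h1 + h2

theorem grad_eq_zero (h : CKEqs ε a₁ a₂ γ k₀ k₁ k₂ k₃ f) (hl : D 1 (D 1 k₃) = 0)
    (h1 : ev 0 (D 1 k₃) = 0) (h2 : ev 0 (D 2 k₃) = 0) (h3 : ev 0 (D 0 (D 1 k₃)) = 0)
    (h4 : ev 0 (D 0 (D 2 k₃)) = 0) : D 1 k₃ = 0 ∧ D 2 k₃ = 0 := by
  have f1 := h.fiberwise_d1 hl
  have f2 := h.fiberwise_d2 hl
  have key := linearODE_unique !![0, 0, 1, 0; 0, 0, 0, 1;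
      γ ^ 2 + a₁, γ * ε, -ε, 2 * γ; -(γ * ε), γ ^ 2 + a₂, -(2 * γ), -ε]
    ![D 1 k₃, D 2 k₃, D 0 (D 1 k₃), D 0 (D 2 k₃)]
    (fun i => by
      fin_cases i
      exacts [f1, f2, fiberwise_d0 f1, fiberwise_d0 f2])
    (fun i => by
      fin_cases i <;> simp [Fin.sum_univ_four, h.d0d0_d1 hl, h.d0d0_d2 hl] <;> ring)
    (fun i => by
      fin_cases i
      exacts [h1, h2, h3, h4])
  exact ⟨key 0, key 1⟩


theorem fiberwise_f (h : CKEqs ε a₁ a₂ γ k₀ k₁ k₂ k₃ f) (hd1 : D 1 k₃ = 0) (hd2 : D 2 k₃ = 0) :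
    Fiberwise f :=
  ⟨by simp [h.d1f, hd1, hd2], by simp [h.d2f, hd1, hd2], by simp [h.d3f, hd1]⟩

theorem d1k2_eq_C (h : CKEqs ε a₁ a₂ γ k₀ k₁ k₂ k₃ f) (hd1 : D 1 k₃ = 0) (hd2 : D 2 k₃ = 0) :
    D 1 k₂ = C (ev 0 (D 1 k₂)) := by
  obtain ⟨f1, f2, f3⟩ := h.fiberwise_f hd1 hd2
  refine eq_C_of_D_eq_zero ⟨?_, ?_, ?_⟩ ?_
  · rw [h.d1r, f2, neg_zero]
  · rw [D21, h.d2r, f1]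
  · simp [h.e23, hd2]
  · simp [h.d0r, hd1, hd2, f1, f2]

/-- The second x₂-derivative isolates the x₂² coefficient of `e00`. The x₃ version has a₂ in place
of a₁, so the two together force (a₁ − a₂) `D 0 k₃` = 0. -/
theorem d0d0f_1 (h : CKEqs ε a₁ a₂ γ k₀ k₁ k₂ k₃ f) (hd1 : D 1 k₃ = 0) (hd2 : D 2 k₃ = 0) :
    D 0 (D 0 f) = C ε * D 0 f + 2 * C a₁ * D 0 k₃ := by
  obtain ⟨f1, f2, f3⟩ := h.fiberwise_f hd1 hd2
  have h1 := congrArg (D 1) (congrArg (D 1) h.e00)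
  have hr := h.d1k2_eq_C hd1 hd2
  set r := ev 0 (D 1 k₂)
  simp [h.e01, hd1, hr, h.e11, f1] at h1
  linear_combination -h1

theorem d0d0f_2 (h : CKEqs ε a₁ a₂ γ k₀ k₁ k₂ k₃ f) (hd1 : D 1 k₃ = 0) (hd2 : D 2 k₃ = 0) :
    D 0 (D 0 f) = C ε * D 0 f + 2 * C a₂ * D 0 k₃ := by
  obtain ⟨f1, f2, f3⟩ := h.fiberwise_f hd1 hd2
  have h1 := congrArg (D 2) (congrArg (D 2) h.e00)
  have hr := h.d1k2_eq_C hd1 hd2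
  set r := ev 0 (D 1 k₂)
  simp [h.e02, hd2, hr, h.e12, h.e22, f2] at h1
  linear_combination -h1

theorem two_d0f_of_grad (h : CKEqs ε a₁ a₂ γ k₀ k₁ k₂ k₃ f) (hd1 : D 1 k₃ = 0)
    (hd2 : D 2 k₃ = 0) : 2 * D 0 f = D 0 (D 0 k₃) + C ε * D 0 k₃ := by
  have := h.two_d0f (by simp [hd1])
  simpa [hd1, hd2] using this

/-- When the profile is anisotropic, `k₃` is constant. -/
theorem d0k3_eq_zero_of_ne (h : CKEqs ε a₁ a₂ γ k₀ k₁ k₂ k₃ f) (hd1 : D 1 k₃ = 0)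
    (hd2 : D 2 k₃ = 0) (ha : a₁ ≠ a₂) : D 0 k₃ = 0 := by
  refine C_cancel_sub ha (two_cancel ?_)
  linear_combination h.d0d0f_2 hd1 hd2 - h.d0d0f_1 hd1 hd2

/-- This is the x₂x₃ coefficient of `e00`. An anisotropic profile admits no independent rotation,
only the rotational part already contained in the translation `tra`. -/
theorem d1k2_of_ne (h : CKEqs ε a₁ a₂ γ k₀ k₁ k₂ k₃ f) (hd1 : D 1 k₃ = 0)
    (hd2 : D 2 k₃ = 0) (ha : a₁ ≠ a₂) : D 1 k₂ = C γ * k₃ := by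
  obtain ⟨f1, f2, f3⟩ := h.fiberwise_f hd1 hd2
  have h1 := congrArg (D 1) (congrArg (D 2) h.e00)
  have hr := h.d1k2_eq_C hd1 hd2
  set r := ev 0 (D 1 k₂)
  simp [h.e02, hd1, hd2, hr, h.e12, h.e22, h.e11, f1, f2] at h1
  rw [hr]
  refine sub_eq_zero.1 (C_cancel_sub ha ?_)
  linear_combination -h1

theorem d0k3_eq_zero {a : ℝ} (h : CKEqs ε a a γ k₀ k₁ k₂ k₃ f) (hd1 : D 1 k₃ = 0)
    (hd2 : D 2 k₃ = 0) (h1 : ev 0 (D 0 k₃) = 0) (h2 : ev 0 (D 0 (D 0 k₃)) = 0) :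
    D 0 k₃ = 0 := by
  have fk : Fiberwise k₃ := ⟨hd1, hd2, h.e33⟩
  have h3 := congrArg (D 0) (h.two_d0f_of_grad hd1 hd2)
  simp at h3
  -- Eliminate f between f'' = εf' + 2a k₃' and 2f' = k₃'' + εk₃'.
  have h4 : D 0 (D 0 (D 0 k₃)) = (4 * C a + C ε ^ 2) * D 0 k₃ := by
    linear_combination 2 * h.d0d0f_1 hd1 hd2 + C ε * h.two_d0f_of_grad hd1 hd2 - h3
  exact linearODE_unique !![0, 1; 4 * a + ε ^ 2, 0] ![D 0 k₃, D 0 (D 0 k₃)]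
    (fun i => by
      fin_cases i
      exacts [fiberwise_d0 fk, fiberwise_d0 (fiberwise_d0 fk)])
    (fun i => by fin_cases i <;> simp [h4])
    (fun i => by
      fin_cases i
      exacts [h1, h2]) 0

theorem f_eq_C (h : CKEqs ε a₁ a₂ γ k₀ k₁ k₂ k₃ f) (hd1 : D 1 k₃ = 0) (hd2 : D 2 k₃ = 0)
    (hd0 : D 0 k₃ = 0) : f = C (ev 0 f) := by
  refine eq_C_of_D_eq_zero (h.fiberwise_f hd1 hd2) (two_cancel ?_)
  simp [h.two_d0f_of_grad hd1 hd2, hd0]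

/-- Once k₃, f and the rotation vanish, k₁ and k₂ depend on x₁ only, and the x₂- and x₃-derivatives
of `e00` are a second-order linear system for them. When they vanish too, k₀ obeys k₀' = εk₀. -/
theorem eq_zero_of_isometric_translation (h : CKEqs ε a₁ a₂ γ k₀ k₁ k₂ k₃ f) (h3 : k₃ = 0)
    (hf : f = 0) (hr : D 1 k₂ = 0) (h1 : ev 0 k₁ = 0) (h2 : ev 0 k₂ = 0)
    (h01 : ev 0 (D 0 k₁) = 0) (h02 : ev 0 (D 0 k₂) = 0) (h0 : ev 0 k₀ = 0) :
    k₀ = 0 ∧ k₁ = 0 ∧ k₂ = 0 := by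
  subst h3 hf
  have fk1 : Fiberwise k₁ := ⟨h.e11, by rw [h.e12, hr, neg_zero], by simp [h.e13]⟩
  have fk2 : Fiberwise k₂ := ⟨hr, h.e22, by simp [h.e23]⟩
  have g1 := congrArg (D 1) h.e00
  have g2 := congrArg (D 2) h.e00
  simp [h.e01, h.e02, fk1.1, fk1.2.1, fk2.1, fk2.2.1] at g1 g2
  have t1 : D 0 (D 0 k₁) = (C γ ^ 2 + C a₁) * k₁ - C γ * C ε * k₂ + C ε * D 0 k₁
      + 2 * C γ * D 0 k₂ := by linear_combination -g1
  have t2 : D 0 (D 0 k₂) = C γ * C ε * k₁ + (C γ ^ 2 + C a₂) * k₂ - 2 * C γ * D 0 k₁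
      + C ε * D 0 k₂ := by linear_combination -g2
  have key := linearODE_unique !![0, 0, 1, 0; 0, 0, 0, 1;
      γ ^ 2 + a₁, -(γ * ε), ε, 2 * γ; γ * ε, γ ^ 2 + a₂, -(2 * γ), ε]
    ![k₁, k₂, D 0 k₁, D 0 k₂]
    (fun i => by
      fin_cases i
      exacts [fk1, fk2, fiberwise_d0 fk1, fiberwise_d0 fk2])
    (fun i => by fin_cases i <;> simp [Fin.sum_univ_four, t1, t2] <;> ring)
    (fun i => by
      fin_cases i
      exacts [h1, h2, h01, h02])
  have e1 : k₁ = 0 := key 0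
  have e2 : k₂ = 0 := key 1
  subst e1 e2
  have fk0 : Fiberwise k₀ := ⟨by simp [h.e01], by simp [h.e02], by simp [h.e03]⟩
  refine ⟨linearODE_unique !![ε] ![k₀] (fun i => by fin_cases i; exact fk0)
    (fun i => by fin_cases i; simp [h.e00]) (fun i => by fin_cases i; exact h0) 0, rfl, rfl⟩

end CKEqs

/-! ### Initial data of conformal Killing vectors -/

/-- The map σ bounds the dimension by `n` and the family attains it. Uniqueness from initial data
and explicit solutions thus suffice; no general solution formula is needed. -/
theorem eq_span_of_injective_on {E : Type*} [AddCommGroup E] [Module ℝ E] {V : Submodule ℝ E}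
    {n : ℕ} (σ : E →ₗ[ℝ] Fin n → ℝ) (hσ : ∀ K ∈ V, σ K = 0 → K = 0) {k : Fin n → E}
    (hk : ∀ i, k i ∈ V) (hli : LinearIndependent ℝ k) : V = Submodule.span ℝ (Set.range k) := by
  have hinj : Function.Injective (σ.domRestrict V) := by
    rw [← LinearMap.ker_eq_bot, LinearMap.ker_eq_bot']
    exact fun K hK => Subtype.ext (hσ K K.2 hK)
  have : FiniteDimensional ℝ V := FiniteDimensional.of_injective _ hinj
  have h1 : Module.finrank ℝ V ≤ n := by
    simpa using LinearMap.finrank_le_finrank_of_injective hinj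
  symm
  refine Submodule.eq_of_le_of_finrank_le (Submodule.span_le.2 ?_) ?_
  · rintro _ ⟨i, rfl⟩
    exact hk i
  · rw [finrank_span_eq_card hli]
    simpa using h1

/-- The value at the origin of a component. -/
def jet₀ (a : Fin 4) : SmCov →ₗ[ℝ] ℝ := (ev 0).toLinearMap ∘ₗ LinearMap.proj a

/-- The value at the origin of a first derivative of a component. -/
def jet₁ (d a : Fin 4) : SmCov →ₗ[ℝ] ℝ :=
  (ev 0).toLinearMap ∘ₗ (D d).toLinearMap ∘ₗ LinearMap.proj a

/-- The value at the origin of a second derivative of a component. -/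
def jet₂ (d e a : Fin 4) : SmCov →ₗ[ℝ] ℝ :=
  (ev 0).toLinearMap ∘ₗ (D d).toLinearMap ∘ₗ (D e).toLinearMap ∘ₗ LinearMap.proj a


theorem CKEqs.eq_zero {ε a₁ a₂ γ : ℝ} {K : SmCov} {f : Sm}
    (h : CKEqs ε a₁ a₂ γ (K 0) (K 1) (K 2) (K 3) f) (h3 : K 3 = 0)
    (hf : f = 0) (hr : D 1 (K 2) = 0) (h1 : ev 0 (K 1) = 0) (h2 : ev 0 (K 2) = 0)
    (h01 : ev 0 (D 0 (K 1)) = 0) (h02 : ev 0 (D 0 (K 2)) = 0) (h0 : ev 0 (K 0) = 0) : K = 0 := by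
  obtain ⟨e0, e1, e2⟩ := h.eq_zero_of_isometric_translation h3 hf hr h1 h2 h01 h02 h0
  ext i : 1
  fin_cases i
  exacts [e0, e1, e2, h3]

theorem eq_zero_of_C {f : Sm} (h : f = C (ev 0 f)) (h0 : ev 0 f = 0) : f = 0 := by
  rw [h, h0]
  exact map_zero _

/-- The initial data of a conformal Killing vector in the conformally flat case. -/
def flatJet : SmCov →ₗ[ℝ] Fin 15 → ℝ :=
  LinearMap.pi ![jet₂ 1 1 3, jet₁ 1 3, jet₁ 2 3, jet₂ 0 1 3, jet₂ 0 2 3, jet₁ 0 3, jet₂ 0 0 3,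
    jet₀ 3, jet₁ 1 1, jet₁ 1 2, jet₀ 1, jet₀ 2, jet₁ 0 1, jet₁ 0 2, jet₀ 0]

/-- The jet coordinates are used in the order of integration: λ, the gradient of k₃, then k₃, the
conformal factor, the rotation, and finally the translational part. -/
theorem flatJet_injective {ε a γ : ℝ} (K : SmCov) (hK : K ∈ CK ε a a γ) (h0 : flatJet K = 0) :
    K = 0 := by
  obtain ⟨f, hf⟩ := (mem_CK ε a a γ).1 hK
  have h := symD_eq_smul_iff.1 hf
  have hl := h.lam_eq_zero (congrFun h0 0)
  obtain ⟨hd1, hd2⟩ := h.grad_eq_zero hl (congrFun h0 1) (congrFun h0 2) (congrFun h0 3)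
    (congrFun h0 4)
  have hd0 := h.d0k3_eq_zero hd1 hd2 (congrFun h0 5) (congrFun h0 6)
  have h3 := eq_zero_of_C (eq_C_of_D_eq_zero ⟨hd1, hd2, h.e33⟩ hd0) (congrFun h0 7)
  have hf0 := eq_zero_of_C (h.f_eq_C hd1 hd2 hd0) (by rw [← h.e11]; exact congrFun h0 8)
  exact h.eq_zero h3 hf0 (eq_zero_of_C (h.d1k2_eq_C hd1 hd2) (congrFun h0 9))
    (congrFun h0 10) (congrFun h0 11) (congrFun h0 12) (congrFun h0 13) (congrFun h0 14)

/-- The initial data of a conformal Killing vector in the anisotropic case. -/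
def anisoJet : SmCov →ₗ[ℝ] Fin 7 → ℝ :=
  LinearMap.pi ![jet₀ 1, jet₀ 2, jet₁ 0 1, jet₁ 0 2, jet₀ 0, jet₀ 3, jet₁ 1 1]

theorem anisoJet_injective {ε a₁ a₂ γ : ℝ} (ha : a₁ ≠ a₂) (K : SmCov) (hK : K ∈ CK ε a₁ a₂ γ)
    (h0 : anisoJet K = 0) : K = 0 := by
  obtain ⟨f, hf⟩ := (mem_CK ε a₁ a₂ γ).1 hK
  have h := symD_eq_smul_iff.1 hf
  have hl := h.lam_eq_zero_of_ne ha
  have hd1 := h.d1_eq_zero_of_ne hl ha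
  have hd2 := h.d2_eq_zero_of_ne hl ha
  have hd0 := h.d0k3_eq_zero_of_ne hd1 hd2 ha
  have h3 := eq_zero_of_C (eq_C_of_D_eq_zero ⟨hd1, hd2, h.e33⟩ hd0) (congrFun h0 5)
  have hf0 := eq_zero_of_C (h.f_eq_C hd1 hd2 hd0) (by rw [← h.e11]; exact congrFun h0 6)
  exact h.eq_zero h3 hf0 (by rw [h.d1k2_of_ne hd1 hd2 ha, h3, mul_zero])
    (congrFun h0 0) (congrFun h0 1) (congrFun h0 2) (congrFun h0 3) (congrFun h0 4)

theorem ckEqs_of_mem_Kil {ε a₁ a₂ γ : ℝ} {K : SmCov} (hK : K ∈ Kil ε a₁ a₂ γ) :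
    CKEqs ε a₁ a₂ γ (K 0) (K 1) (K 2) (K 3) 0 :=
  symD_eq_smul_iff.1 (by rw [zero_smul]; exact hK)

theorem Kil_le_CK (ε a₁ a₂ γ : ℝ) : Kil ε a₁ a₂ γ ≤ CK ε a₁ a₂ γ := fun _ hK =>
  (mem_CK ε a₁ a₂ γ).2 ⟨0, by rw [zero_smul]; exact hK⟩

/-- The initial data of a Killing vector in the anisotropic case. -/
def anisoKilJet : SmCov →ₗ[ℝ] Fin 6 → ℝ :=
  LinearMap.pi ![jet₀ 1, jet₀ 2, jet₁ 0 1, jet₁ 0 2, jet₀ 0, jet₀ 3]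

theorem anisoKilJet_injective {ε a₁ a₂ γ : ℝ} (ha : a₁ ≠ a₂) (K : SmCov)
    (hK : K ∈ Kil ε a₁ a₂ γ) (h0 : anisoKilJet K = 0) : K = 0 := by
  refine anisoJet_injective ha K (Kil_le_CK _ _ _ _ hK) ?_
  have h := ckEqs_of_mem_Kil hK
  ext i
  fin_cases i
  · exact congrFun h0 0
  · exact congrFun h0 1
  · exact congrFun h0 2
  · exact congrFun h0 3
  · exact congrFun h0 4
  · exact congrFun h0 5
  · exact (congrArg (ev 0) h.e11).trans (map_zero _)

/-- The initial data of a Killing vector in the isotropic, non-flat case. -/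
def isoKilJet : SmCov →ₗ[ℝ] Fin 7 → ℝ :=
  LinearMap.pi ![jet₀ 1, jet₀ 2, jet₁ 0 1, jet₁ 0 2, jet₀ 0, jet₀ 3, jet₁ 1 2]

theorem CKEqs.lam_of_isometric {ε a₁ a₂ γ : ℝ} {k₀ k₁ k₂ k₃ : Sm}
    (h : CKEqs ε a₁ a₂ γ k₀ k₁ k₂ k₃ 0) : D 1 (D 1 k₃) = 0 := by
  have := h.d3f
  simp at this
  exact this

theorem CKEqs.d0_grad_of_isometric {ε a₁ a₂ γ : ℝ} {k₀ k₁ k₂ k₃ : Sm}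
    (h : CKEqs ε a₁ a₂ γ k₀ k₁ k₂ k₃ 0) :
    D 0 (D 1 k₃) = C γ * D 2 k₃ - C ε * D 1 k₃ ∧
      D 0 (D 2 k₃) = -(C γ * D 1 k₃) - C ε * D 2 k₃ := by
  have h1 := h.d1f
  have h2 := h.d2f
  rw [h.lam_of_isometric, map_zero] at h1 h2
  constructor
  · linear_combination -h1
  · linear_combination -h2

/-- With f = 0 the gradient of k₃ obeys first-order equations in x₁. Substituting them into the
second-order ones leaves `a` times the gradient. Likewise f'' = εf' + 2a k₃' leaves 2a k₃' = 0, so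
k₃ is constant. -/
theorem isoKilJet_injective {ε a γ : ℝ} (ha : a ≠ 0) (K : SmCov)
    (hK : K ∈ Kil ε a a γ) (h0 : isoKilJet K = 0) : K = 0 := by
  have h := ckEqs_of_mem_Kil hK
  have hl := h.lam_of_isometric
  obtain ⟨g1, g2⟩ := h.d0_grad_of_isometric
  have q1 := h.d0d0_d1 hl
  have q2 := h.d0d0_d2 hl
  have hd1 : D 1 (K 3) = 0 := by
    simp [g1, g2] at q1
    refine C_cancel ha ?_
    linear_combination -q1
  have hd2 : D 2 (K 3) = 0 := by
    simp [g1, g2] at q2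
    refine C_cancel ha ?_
    linear_combination -q2
  have hd0 : D 0 (K 3) = 0 := by
    have := h.d0d0f_1 hd1 hd2
    simp at this
    refine C_cancel ha (two_cancel ?_)
    linear_combination -this
  have h3 := eq_zero_of_C (eq_C_of_D_eq_zero ⟨hd1, hd2, h.e33⟩ hd0) (congrFun h0 5)
  exact h.eq_zero h3 rfl (eq_zero_of_C (h.d1k2_eq_C hd1 hd2) (congrFun h0 6))
    (congrFun h0 0) (congrFun h0 1) (congrFun h0 2) (congrFun h0 3) (congrFun h0 4)

/-- The initial data of a Killing vector in the flat case. -/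
def flatKilJet : SmCov →ₗ[ℝ] Fin 10 → ℝ :=
  LinearMap.pi ![jet₀ 1, jet₀ 2, jet₁ 0 1, jet₁ 0 2, jet₀ 0, jet₀ 3, jet₁ 1 2,
    jet₁ 1 3, jet₁ 2 3, jet₁ 0 3]

theorem flatKilJet_injective {ε γ : ℝ} (K : SmCov)
    (hK : K ∈ Kil ε 0 0 γ) (h0 : flatKilJet K = 0) : K = 0 := by
  have h := ckEqs_of_mem_Kil hK
  have hl := h.lam_of_isometric
  obtain ⟨g1, g2⟩ := h.d0_grad_of_isometric
  have z1 : ev 0 (D 1 (K 3)) = 0 := congrFun h0 7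
  have z2 : ev 0 (D 2 (K 3)) = 0 := congrFun h0 8
  have z0 : ev 0 (D 0 (K 3)) = 0 := congrFun h0 9
  obtain ⟨hd1, hd2⟩ := h.grad_eq_zero hl z1 z2 (by simp [g1, z1, z2]) (by simp [g2, z1, z2])
  refine flatJet_injective K (Kil_le_CK _ _ _ _ hK) ?_
  ext i
  fin_cases i
  · exact (congrArg (ev 0) hl).trans (map_zero _)
  · exact z1
  · exact z2
  · exact (congrArg (fun g => ev 0 (D 0 g)) hd1).trans (by simp)
  · exact (congrArg (fun g => ev 0 (D 0 g)) hd2).trans (by simp)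
  · exact z0
  -- The value k₃''(0) is not among the prescribed data; it follows from 2f' = k₃'' + εk₃' with f =
  -- 0.
  · have := congrArg (ev 0) (h.two_d0f_of_grad hd1 hd2)
    simp [z0] at this
    exact this.symm
  · exact congrFun h0 5
  · exact (congrArg (ev 0) h.e11).trans (map_zero _)
  · exact congrFun h0 6
  · exact congrFun h0 0
  · exact congrFun h0 1
  · exact congrFun h0 2
  · exact congrFun h0 3
  · exact congrFun h0 4

/-! ### Spans of products -/

/-- The symmetric products of the members of a family. -/
def prods {ι : Type*} (k : ι → SmCov) (p : ι × ι) : SmTensor := sp (k p.1) (k p.2)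

theorem span_products {ι : Type*} {V : Submodule ℝ SmCov} {k : ι → SmCov} {J : Set ι}
    (hV : V = Submodule.span ℝ (k '' J)) :
    Submodule.span ℝ {T | ∃ K ∈ V, ∃ K' ∈ V, T = sp K K'} =
      Submodule.span ℝ (prods k '' (J ×ˢ J)) := by
  have h : {T | ∃ K ∈ V, ∃ K' ∈ V, T = sp K K'} =
      Set.image2 (fun K K' => sp K K') (V : Set SmCov) V := by
    ext T
    simp only [Set.mem_ofPred_eq, Set.mem_image2, SetLike.mem_coe, eq_comm]
  rw [h, ← Submodule.map₂_span_span, Submodule.span_eq, hV, Submodule.map₂_span_span]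
  congr 1
  ext T
  simp only [Set.mem_image2, Set.mem_image, prods, Prod.exists, Set.mem_prod]
  constructor
  · rintro ⟨_, ⟨i, hi, rfl⟩, _, ⟨j, hj, rfl⟩, rfl⟩
    exact ⟨i, j, ⟨hi, hj⟩, rfl⟩
  · rintro ⟨i, j, ⟨hi, hj⟩, rfl⟩
    exact ⟨_, ⟨i, hi, rfl⟩, _, ⟨j, hj, rfl⟩, rfl⟩

theorem redKil_eq {ι : Type*} {ε a₁ a₂ γ : ℝ} {k : ι → SmCov} {J : Set ι}
    (hV : Kil ε a₁ a₂ γ = Submodule.span ℝ (k '' J)) :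
    redKil ε a₁ a₂ γ =
      Submodule.span ℝ {G ε a₁ a₂ γ} ⊔ Submodule.span ℝ (prods k '' (J ×ˢ J)) := by
  rw [redKil, Submodule.span_insert, span_products hV]

theorem redCK_eq {ι : Type*} {ε a₁ a₂ γ : ℝ} {k : ι → SmCov} {J : Set ι}
    (hV : CK ε a₁ a₂ γ = Submodule.span ℝ (k '' J)) :
    redCK ε a₁ a₂ γ =
      (Submodule.span ℝ (prods k '' (J ×ˢ J))).map (trFree ε a₁ a₂ γ) := by
  rw [← span_products hV, Submodule.map_span, redCK]
  congr 1
  ext T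
  constructor
  · rintro ⟨K, hK, K', hK', rfl⟩
    exact ⟨_, ⟨K, hK, K', hK', rfl⟩, rfl⟩
  · rintro ⟨_, ⟨K, hK, K', hK', rfl⟩, rfl⟩
    exact ⟨K, hK, K', hK', rfl⟩

/-- A family indexed by pairs is supported on a finite set. -/
def SupportedOn {ι : Type*} (S : Finset (ι × ι)) (g : ι → ι → ℝ) : Prop :=
  ∀ i j, (i, j) ∉ S → g i j = 0

/-- Coefficients live on all pairs, with a support condition, so that a relation is a full double
sum and can be symmetrized and reindexed freely. -/
theorem finrank_span_pairs {ι E : Type*} [Fintype ι] [DecidableEq ι] [AddCommGroup E] [Module ℝ E]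
    (w : ι × ι → E) (S : Finset (ι × ι))
    (hli : ∀ g : ι → ι → ℝ, SupportedOn S g → ∑ i, ∑ j, g i j • w (i, j) = 0 →
      ∀ i j, g i j = 0) :
    Module.finrank ℝ (Submodule.span ℝ (w '' S)) = S.card := by
  have h : LinearIndepOn ℝ w (S : Set (ι × ι)) := by
    rw [linearIndepOn_finset_iff]
    intro g hg p hp
    have := hli (fun i j => if (i, j) ∈ S then g (i, j) else 0) (fun i j hij => if_neg hij) ?_
      p.1 p.2
    · simpa [hp] using this
    · rw [← Fintype.sum_prod_type' (f := fun i j => (if (i, j) ∈ S then g (i, j) else 0) • w (i, j)),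
        ← hg]
      simp only [Prod.mk.eta, ite_smul, zero_smul, Finset.sum_ite_mem, Finset.univ_inter]
  rw [Set.image_eq_range]
  exact (finrank_span_eq_card h).trans (by simp)

/-- The value of a covector field on a tangent vector. -/
def pair (x : Point) (K : SmCov) (p : Fin 4 → ℝ) : ℝ := ∑ a, p a * ev x (K a)

/-- The metric as a bilinear form on tangent vectors. -/
def gForm (ε a₁ a₂ γ : ℝ) (x p q : Fin 4 → ℝ) : ℝ :=
  ∑ a, ∑ b, p a * q b * ev x (G ε a₁ a₂ γ a b)

/-- Contracting a tensor relation with two tangent vectors gives scalar identities. They see only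
the symmetrization of `g`; the supports consisting of pairs i ≤ j let `g` be recovered from it. -/
theorem pairing_sum_prods {ι : Type*} [Fintype ι] {ε a₁ a₂ γ : ℝ} {k : ι → SmCov} {g : ι → ι → ℝ}
    {f : Sm} (h : ∑ i, ∑ j, g i j • prods k (i, j) = f • G ε a₁ a₂ γ) (x p q : Fin 4 → ℝ) :
    ∑ i, ∑ j, (g i j + g j i) * (pair x (k i) p * pair x (k j) q) =
      2 * ev x f * gForm ε a₁ a₂ γ x p q := by
  have h0 : ∑ i, ∑ j, (g i j + g j i) * (pair x (k i) p * pair x (k j) q) =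
      ∑ i, ∑ j, g i j * (pair x (k i) p * pair x (k j) q + pair x (k i) q * pair x (k j) p) := by
    simp only [add_mul, mul_add, Finset.sum_add_distrib]
    congr 1
    rw [Finset.sum_comm]
    exact Finset.sum_congr rfl fun i _ => Finset.sum_congr rfl fun j _ => by ring
  rw [h0]
  have h1 : ∀ a b, ∑ i, ∑ j, g i j * (ev x (k i a) * ev x (k j b) + ev x (k i b) * ev x (k j a)) =
      2 * ev x f * ev x (G ε a₁ a₂ γ a b) := by
    intro a b
    have h2 := congrArg (ev x) (congrFun (congrFun h a) b)
    simp only [Matrix.sum_apply, Matrix.smul_apply, prods, sp_apply, map_sum, map_smul, map_mul,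
      map_add, ev_C, smul_eq_mul] at h2
    rw [mul_assoc, ← h2, Finset.mul_sum]
    refine Finset.sum_congr rfl fun i _ => ?_
    rw [Finset.mul_sum]
    refine Finset.sum_congr rfl fun j _ => ?_
    ring
  have h3 : ∀ i j, g i j * (pair x (k i) p * pair x (k j) q + pair x (k i) q * pair x (k j) p) =
      ∑ a, ∑ b, p a * q b *
        (g i j * (ev x (k i a) * ev x (k j b) + ev x (k i b) * ev x (k j a))) := by
    intro i j
    simp only [pair, Fin.sum_univ_four]
    ring
  simp only [h3]
  rw [gForm, Finset.mul_sum]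
  simp only [Finset.mul_sum]
  rw [Finset.sum_congr rfl fun i _ => Finset.sum_comm, Finset.sum_comm]
  refine Finset.sum_congr rfl fun a _ => ?_
  rw [Finset.sum_congr rfl fun i _ => Finset.sum_comm, Finset.sum_comm]
  refine Finset.sum_congr rfl fun b _ => ?_
  simp only [← Finset.mul_sum]
  rw [h1]
  ring

/-! ### Quadratic first integrals of linear systems -/

/-- Let Φ be the fundamental matrix. Both Φ c Φᵀ and e c solve Y' = M Y + Y Mᵀ, the second because
of `hc`, and both equal c at the origin. ODE uniqueness on the index set of pairs concludes. -/
theorem quadratic_invariant {n : ℕ} (M c : Matrix (Fin n) (Fin n) ℝ) (ε : ℝ)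
    (hc : M * c + c * M.transpose = ε • c) (s : Fin n → Fin n → Sm) (e : Sm)
    (hs : ∀ i p, Fiberwise (s i p)) (hD : ∀ i p, D 0 (s i p) = ∑ r, C (M p r) * s i r)
    (h0 : ∀ i p, ev 0 (s i p) = if i = p then 1 else 0)
    (he : Fiberwise e) (heD : D 0 e = C ε * e) (he0 : ev 0 e = 1) (p q : Fin n) :
    ∑ i, ∑ j, C (c i j) * (s i p * s j q) = C (c p q) * e := by
  rw [← sub_eq_zero]
  have hfib : ∀ d : Fin 4, D d e = 0 → (∀ i p, D d (s i p) = 0) → ∀ p q,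
      D d (∑ i, ∑ j, C (c i j) * (s i p * s j q) - C (c p q) * e) = 0 := by
    intro d h1 h2 p q
    simp [h1, h2]
  refine linearODE_unique (ι := Fin n × Fin n)
    (fun pq rs => M pq.1 rs.1 * (if pq.2 = rs.2 then 1 else 0)
      + (if pq.1 = rs.1 then 1 else 0) * M pq.2 rs.2)
    (fun pq => ∑ i, ∑ j, C (c i j) * (s i pq.1 * s j pq.2) - C (c pq.1 pq.2) * e)
    (fun pq => ⟨hfib 1 he.1 (fun i p => (hs i p).1) _ _, hfib 2 he.2.1 (fun i p => (hs i p).2.1) _ _,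
      hfib 3 he.2.2 (fun i p => (hs i p).2.2) _ _⟩) (fun pq => ?_) (fun pq => ?_) (p, q)
  · obtain ⟨p, q⟩ := pq
    have hcc : C ε * C (c p q) =
        ∑ r, C (M p r) * C (c r q) + ∑ r, C (M q r) * C (c p r) := by
      have := congrArg C (congrFun (congrFun hc p) q)
      simp only [Matrix.add_apply, Matrix.mul_apply, Matrix.transpose_apply, Matrix.smul_apply,
        smul_eq_mul, map_add, map_sum, map_mul] at this
      rw [← this]
      simp only [mul_comm]
    have hF : D 0 (∑ i, ∑ j, C (c i j) * (s i p * s j q)) =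
        ∑ r, C (M p r) * (∑ i, ∑ j, C (c i j) * (s i r * s j q))
          + ∑ r, C (M q r) * (∑ i, ∑ j, C (c i j) * (s i p * s j r)) := by
      have hij : ∀ i j, D 0 (C (c i j) * (s i p * s j q)) =
          ∑ r, C (M p r) * (C (c i j) * (s i r * s j q))
            + ∑ r, C (M q r) * (C (c i j) * (s i p * s j r)) := by
        intro i j
        rw [D_mul, D_mul, D_C, hD, hD, mul_zero, add_zero, mul_add, add_comm, Finset.mul_sum,
          Finset.mul_sum, Finset.mul_sum, Finset.mul_sum]
        congr 1 <;> exact Finset.sum_congr rfl fun r _ => by ring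
      simp only [map_sum, hij, Finset.sum_add_distrib, Finset.mul_sum]
      congr 1 <;>
        rw [Finset.sum_congr rfl fun i _ => Finset.sum_comm, Finset.sum_comm]
    have hrhs : ∀ Φ : Fin n → Fin n → Sm, ∑ rs : Fin n × Fin n,
        C (M p rs.1 * (if q = rs.2 then 1 else 0) + (if p = rs.1 then 1 else 0) * M q rs.2)
          * Φ rs.1 rs.2 = ∑ r, C (M p r) * Φ r q + ∑ r, C (M q r) * Φ p r := by
      intro Φ
      rw [Fintype.sum_prod_type]
      have hC : ∀ P : Prop, ∀ _ : Decidable P, ∀ r : ℝ,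
          C (if P then r else 0) = if P then C r else 0 := by
        intro P _ r
        split_ifs <;> simp
      simp only [mul_ite, mul_one, mul_zero, ite_mul, one_mul, zero_mul, map_add, hC, add_mul,
        Finset.sum_add_distrib, Finset.sum_ite_eq, Finset.mem_univ, if_true]
      congr 1
      rw [Finset.sum_comm]
      simp
    refine Eq.trans ?_ (hrhs fun r t => ∑ i, ∑ j, C (c i j) * (s i r * s j t) - C (c r t) * e).symm
    rw [map_sub, hF, D_mul, D_C, heD]
    simp only [mul_sub, Finset.sum_sub_distrib]
    have h1 : ∀ x : Fin n → Fin n → ℝ, ∀ y : Fin n → ℝ, ∑ r, C (y r) * (C (x r r) * e) =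
        (∑ r, C (y r) * C (x r r)) * e := fun x y => by
      rw [Finset.sum_mul]
      exact Finset.sum_congr rfl fun r _ => by ring
    rw [h1 (fun r _ => c r q), h1 (fun r _ => c p r)]
    linear_combination -e * hcc
  · obtain ⟨p, q⟩ := pq
    simp [h0, he0]

/-! ### The Heisenberg algebra, the translation, the homothety and the rotation -/

/-- The matrix of the linear system satisfied by the Heisenberg Killing vectors. -/
def heisM (ε a₁ a₂ γ : ℝ) : Matrix (Fin 4) (Fin 4) ℝ :=
  !![0, γ, -1, 0; -γ, 0, 0, -1; -a₁, 0, ε, γ; 0, -a₂, -γ, ε]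

/-- A fundamental system of solutions for the Heisenberg Killing vectors. -/
structure HeisData (ε a₁ a₂ γ : ℝ) (s : Fin 4 → Fin 4 → Sm) (e : Sm) : Prop where
  fib : ∀ i p, Fiberwise (s i p)
  ode : ∀ i p, D 0 (s i p) = ∑ r, C (heisM ε a₁ a₂ γ p r) * s i r
  init : ∀ x : Point, x 0 = 0 → ∀ i p, ev x (s i p) = if i = p then 1 else 0
  efib : Fiberwise e
  eode : D 0 e = C ε * e
  einit : ∀ x : Point, x 0 = 0 → ev x e = 1

theorem exists_exp (r : ℝ) : ∃ e : Sm, Fiberwise e ∧ D 0 e = C r * e ∧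
    ∀ x : Point, x 0 = 0 → ev x e = 1 := by
  obtain ⟨e, h1, h2, h3⟩ := linearODE_exists !![r] ![1]
  exact ⟨e 0, h1 0, by simpa using h2 0, fun x hx => h3 x hx 0⟩

theorem exists_heisData (ε a₁ a₂ γ : ℝ) : ∃ s e, HeisData ε a₁ a₂ γ s e := by
  choose s h1 h2 h3 using fun i : Fin 4 =>
    linearODE_exists (heisM ε a₁ a₂ γ) (fun p => if i = p then 1 else 0)
  obtain ⟨e, h4, h5, h6⟩ := exists_exp ε
  exact ⟨s, e, h1, h2, fun x hx i => h3 i x hx, h4, h5, h6⟩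

/-- The covector fields attached to the components of a solution. -/
def heisB (γ : ℝ) : Fin 4 → SmCov :=
  ![![-(C γ * X 2), 1, 0, 0], ![C γ * X 1, 0, 1, 0], ![X 1, 0, 0, 0], ![X 2, 0, 0, 0]]

/-- The covector field of a solution of the Heisenberg system. -/
def heis (γ : ℝ) (σ : Fin 4 → Sm) : SmCov := fun a => ∑ p, σ p * heisB γ p a

theorem heis_mem_Kil {ε a₁ a₂ γ : ℝ} {σ : Fin 4 → Sm} (hf : ∀ p, Fiberwise (σ p))
    (hD : ∀ p, D 0 (σ p) = ∑ r, C (heisM ε a₁ a₂ γ p r) * σ r) : heis γ σ ∈ Kil ε a₁ a₂ γ := by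
  rw [mem_Kil, ← zero_smul Sm (G ε a₁ a₂ γ), symD_eq_smul_iff]
  have h0 := hD 0
  have h1 := hD 1
  have h2 := hD 2
  have h3 := hD 3
  simp [heisM, Fin.sum_univ_four] at h0 h1 h2 h3
  obtain ⟨f01, f02, f03⟩ := hf 0
  obtain ⟨f11, f12, f13⟩ := hf 1
  obtain ⟨f21, f22, f23⟩ := hf 2
  obtain ⟨f31, f32, f33⟩ := hf 3
  constructor <;> simp [heis, heisB, Fin.sum_univ_four, h0, h1, h2, h3, f01, f02, f03, f11, f12,
    f13, f21, f22, f23, f31, f32, f33] <;> ring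

/-- The central Killing vector. -/
def cen (e : Sm) : SmCov := ![e, 0, 0, 0]

theorem cen_mem_Kil {ε a₁ a₂ γ : ℝ} {e : Sm} (hf : Fiberwise e) (hD : D 0 e = C ε * e) :
    cen e ∈ Kil ε a₁ a₂ γ := by
  rw [mem_Kil, ← zero_smul Sm (G ε a₁ a₂ γ), symD_eq_smul_iff]
  constructor <;> simp [cen, hD, hf.1, hf.2.1, hf.2.2]

/-- The translation `∂₁`. -/
def tra (ε a₁ a₂ γ : ℝ) : SmCov := fun a => G ε a₁ a₂ γ 0 a

theorem tra_mem_Kil {ε a₁ a₂ γ : ℝ} : tra ε a₁ a₂ γ ∈ Kil ε a₁ a₂ γ := by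
  rw [mem_Kil, ← zero_smul Sm (G ε a₁ a₂ γ), symD_eq_smul_iff]
  constructor <;> simp [tra, G] <;> ring

/-- The homothety. -/
def hom : SmCov := ![2 * X 3, X 1, X 2, 0]

theorem hom_mem_CK {ε a₁ a₂ γ : ℝ} : hom ∈ CK ε a₁ a₂ γ := by
  rw [mem_CK]
  refine ⟨1, symD_eq_smul_iff.2 ?_⟩
  constructor <;> simp [hom]
  ring

/-- The rotation. -/
def rot (γ : ℝ) : SmCov := ![C γ * (X 1 ^ 2 + X 2 ^ 2), -X 2, X 1, 0]

theorem rot_mem_Kil {ε a γ : ℝ} : rot γ ∈ Kil ε a a γ := by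
  rw [mem_Kil, ← zero_smul Sm (G ε a a γ), symD_eq_smul_iff]
  constructor <;> simp [rot] <;> ring

/-- The fields `heis` are linear in the solution, so an invariant form replaces products of
solutions by constants times `e`. What is left is algebra in the fixed fields `heisB`. -/
theorem sum_smul_sp_heis {ε a₁ a₂ γ : ℝ} {s : Fin 4 → Fin 4 → Sm} {e : Sm}
    (h : HeisData ε a₁ a₂ γ s e) {c : Matrix (Fin 4) (Fin 4) ℝ}
    (hc : heisM ε a₁ a₂ γ * c + c * (heisM ε a₁ a₂ γ).transpose = ε • c) :
    ∑ i, ∑ j, c i j • sp (heis γ (s i)) (heis γ (s j)) =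
      e • ∑ p, ∑ q, c p q • sp (heisB γ p) (heisB γ q) := by
  have inv := quadratic_invariant _ c ε hc s e h.fib h.ode (h.init 0 rfl) h.efib h.eode
    (h.einit 0 rfl)
  have key : ∀ a b, ∑ i, ∑ j, C (c i j) * (heis γ (s i) a * heis γ (s j) b) =
      e * ∑ p, ∑ q, C (c p q) * (heisB γ p a * heisB γ q b) := by
    intro a b
    have h1 : ∀ i j, C (c i j) * (heis γ (s i) a * heis γ (s j) b) =
        ∑ p, ∑ q, heisB γ p a * heisB γ q b * (C (c i j) * (s i p * s j q)) := by
      intro i j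
      simp only [heis, Finset.sum_mul_sum]
      simp only [Finset.mul_sum]
      exact Finset.sum_congr rfl fun p _ => Finset.sum_congr rfl fun q _ => by ring
    simp only [h1]
    rw [Finset.sum_congr rfl fun i _ => Finset.sum_comm, Finset.sum_comm, Finset.mul_sum]
    refine Finset.sum_congr rfl fun p _ => ?_
    rw [Finset.sum_congr rfl fun i _ => Finset.sum_comm, Finset.sum_comm, Finset.mul_sum]
    refine Finset.sum_congr rfl fun q _ => ?_
    simp only [← Finset.mul_sum]
    rw [inv]
    ring
  have hsp : ∀ (k : Fin 4 → SmCov) a b, (∑ i, ∑ j, c i j • sp (k i) (k j)) a b =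
      C (1 / 2) * (∑ i, ∑ j, C (c i j) * (k i a * k j b) +
        ∑ i, ∑ j, C (c i j) * (k i b * k j a)) := by
    intro k a b
    simp only [Matrix.sum_apply, Matrix.smul_apply, sp_apply, ← Finset.sum_add_distrib,
      Finset.mul_sum]
    simp only [Algebra.smul_def]
    exact Finset.sum_congr rfl fun p _ => Finset.sum_congr rfl fun q _ => by ring
  refine Matrix.ext fun a b => ?_
  rw [Matrix.smul_apply, hsp, hsp, key, key, smul_eq_mul]
  ring

/-! ### The Casimir and angular relations among products. -/

/-- The Casimir-type quadratic form of the Heisenberg system. -/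
def casimir (ε a₁ a₂ γ : ℝ) : Matrix (Fin 4) (Fin 4) ℝ :=
  !![1, 0, -(ε / 2), γ; 0, 1, -γ, -(ε / 2); -(ε / 2), -γ, -a₁, 0; γ, -(ε / 2), 0, -a₂]

theorem casimir_invariant (ε a₁ a₂ γ : ℝ) :
    heisM ε a₁ a₂ γ * casimir ε a₁ a₂ γ + casimir ε a₁ a₂ γ * (heisM ε a₁ a₂ γ).transpose =
      ε • casimir ε a₁ a₂ γ := by
  ext i j
  simp only [Matrix.add_apply, Matrix.mul_apply, Matrix.transpose_apply, Matrix.smul_apply,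
    Fin.sum_univ_four]
  fin_cases i <;> fin_cases j <;> simp [heisM, casimir] <;> ring

/-- The symplectic quadratic form of the isotropic Heisenberg system. -/
def angular : Matrix (Fin 4) (Fin 4) ℝ :=
  !![0, 0, 0, 1; 0, 0, -1, 0; 0, -1, 0, 0; 1, 0, 0, 0]

theorem angular_invariant (ε a γ : ℝ) :
    heisM ε a a γ * angular + angular * (heisM ε a a γ).transpose = ε • angular := by
  ext i j
  simp only [Matrix.add_apply, Matrix.mul_apply, Matrix.transpose_apply, Matrix.smul_apply,
    Fin.sum_univ_four]
  fin_cases i <;> fin_cases j <;> simp [heisM, angular]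

/-- Modulo the metric this makes `cen` times `tra` redundant. The homothety enters with coefficient
ε, so only for ε = 0 is this a relation between Killing vectors and the metric. -/
theorem casimir_relation {ε a₁ a₂ γ : ℝ} {s : Fin 4 → Fin 4 → Sm} {e : Sm}
    (h : HeisData ε a₁ a₂ γ s e) :
    ∑ i, ∑ j, casimir ε a₁ a₂ γ i j • sp (heis γ (s i)) (heis γ (s j))
      + (2 : ℝ) • sp (cen e) (tra ε a₁ a₂ γ) + ε • sp (cen e) hom = e • G ε a₁ a₂ γ := by
  rw [sum_smul_sp_heis h (casimir_invariant ε a₁ a₂ γ)]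
  simp [casimir, Fin.sum_univ_four]
  refine Matrix.ext fun a b => Sm.ext_ev fun x => ?_
  simp only [Matrix.add_apply, Matrix.smul_apply, Matrix.neg_apply, sp_apply, map_add, map_mul,
    map_neg, map_smul, ev_C, smul_eq_mul]
  fin_cases a <;> fin_cases b <;> simp [heisB, cen, tra, hom, G] <;> ring

/-- For a₁ = a₂ the symplectic form is also invariant, which makes `cen` times `rot` redundant. -/
theorem angular_relation {ε a γ : ℝ} {s : Fin 4 → Fin 4 → Sm} {e : Sm}
    (h : HeisData ε a a γ s e) :
    ∑ i, ∑ j, angular i j • sp (heis γ (s i)) (heis γ (s j)) + (2 : ℝ) • sp (cen e) (rot γ) = 0 := by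
  rw [sum_smul_sp_heis h (angular_invariant ε a γ)]
  simp [angular, Fin.sum_univ_four]
  refine Matrix.ext fun a b => Sm.ext_ev fun x => ?_
  simp only [Matrix.add_apply, Matrix.smul_apply, Matrix.neg_apply, sp_apply, map_add, map_mul,
    map_neg, map_smul, ev_C, smul_eq_mul]
  fin_cases a <;> fin_cases b <;> simp [heisB, cen, rot] <;> ring

/-! ### Independence on the hypersurface `x₁ = 0` -/

/-- The point of the hypersurface `x₁ = 0` with given remaining coordinates. -/
def slice (y z v : ℝ) : Point := ![0, y, z, v]

@[simp] theorem slice_zero (y z v : ℝ) : slice y z v 0 = 0 := rfl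
@[simp] theorem slice_one (y z v : ℝ) : slice y z v 1 = y := rfl
@[simp] theorem slice_two (y z v : ℝ) : slice y z v 2 = z := rfl
@[simp] theorem slice_three (y z v : ℝ) : slice y z v 3 = v := rfl

/-- A vector transversal to the hypersurface, orthogonal to `∂₂` and `∂₃`. -/
def tvec (γ y z t : ℝ) : Fin 4 → ℝ := ![1, γ * z, -(γ * y), t]

/-- The coordinate vectors. -/
def bvec (a : Fin 4) : Fin 4 → ℝ := Pi.single a 1

theorem pair_bvec (x : Point) (K : SmCov) (a : Fin 4) : pair x K (bvec a) = ev x (K a) := by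
  simp [pair, bvec, Pi.single_apply]

theorem pair_tvec (x : Point) (K : SmCov) (γ y z t : ℝ) :
    pair x K (tvec γ y z t) =
      ev x (K 0) + γ * z * ev x (K 1) - γ * y * ev x (K 2) + t * ev x (K 3) := by
  simp [pair, tvec, Fin.sum_univ_four]
  ring

section gForm

variable (ε a₁ a₂ γ y z v : ℝ)

theorem gForm_bvec (x : Point) (a b : Fin 4) :
    gForm ε a₁ a₂ γ x (bvec a) (bvec b) = ev x (G ε a₁ a₂ γ a b) := by
  simp [gForm, bvec, Pi.single_apply]

theorem gForm_tvec_bvec (x : Point) (t : ℝ) (b : Fin 4) :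
    gForm ε a₁ a₂ γ x (tvec γ y z t) (bvec b) = ev x (G ε a₁ a₂ γ 0 b)
      + γ * z * ev x (G ε a₁ a₂ γ 1 b) - γ * y * ev x (G ε a₁ a₂ γ 2 b)
      + t * ev x (G ε a₁ a₂ γ 3 b) := by
  simp [gForm, bvec, tvec, Pi.single_apply, Fin.sum_univ_four]
  ring

theorem gForm_tvec_tvec (t : ℝ) :
    gForm ε a₁ a₂ γ (slice y z v) (tvec γ y z t) (tvec γ y z t) =
      a₁ * y ^ 2 + a₂ * z ^ 2 - 2 * ε * v + 2 * t := by
  simp [gForm, tvec, Fin.sum_univ_four, G]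
  ring

end gForm

/-- The eight covector fields. -/
def fam (ε a₁ a₂ γ : ℝ) (s : Fin 4 → Fin 4 → Sm) (e : Sm) : Fin 8 → SmCov :=
  ![heis γ (s 0), heis γ (s 1), heis γ (s 2), heis γ (s 3), cen e, tra ε a₁ a₂ γ, hom, rot γ]

section

variable {ε a₁ a₂ γ : ℝ} {s : Fin 4 → Fin 4 → Sm} {e : Sm}

theorem fam_d3 (y z v : ℝ) (i : Fin 8) :
    pair (slice y z v) (fam ε a₁ a₂ γ s e i) (bvec 3) = ![0, 0, 0, 0, 0, 1, 0, 0] i := by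
  rw [pair_bvec]
  fin_cases i <;> simp [fam, heis, heisB, cen, tra, hom, rot, G, Fin.sum_univ_four]

theorem fam_d1 (h : HeisData ε a₁ a₂ γ s e) (y z v : ℝ) (i : Fin 8) :
    pair (slice y z v) (fam ε a₁ a₂ γ s e i) (bvec 1) =
      ![1, 0, 0, 0, 0, -(γ * z), y, -z] i := by
  rw [pair_bvec]
  fin_cases i <;>
    simp [fam, heis, heisB, cen, tra, hom, rot, G, Fin.sum_univ_four, h.init (slice y z v) rfl]

theorem fam_d2 (h : HeisData ε a₁ a₂ γ s e) (y z v : ℝ) (i : Fin 8) :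
    pair (slice y z v) (fam ε a₁ a₂ γ s e i) (bvec 2) =
      ![0, 1, 0, 0, 0, γ * y, z, y] i := by
  rw [pair_bvec]
  fin_cases i <;>
    simp [fam, heis, heisB, cen, tra, hom, rot, G, Fin.sum_univ_four, h.init (slice y z v) rfl]

/-- The last entry of the transversal vector is chosen so that the translation pairs to zero with
it, which removes a₁, a₂ and ε from all eight values. -/
theorem fam_tvec (h : HeisData ε a₁ a₂ γ s e) (y z v : ℝ) (i : Fin 8) :
    pair (slice y z v) (fam ε a₁ a₂ γ s e i)
        (tvec γ y z (2 * ε * v - a₁ * y ^ 2 - a₂ * z ^ 2)) =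
      ![0, 0, y, z, 1, 0, 2 * v, 0] i := by
  rw [pair_tvec]
  fin_cases i <;>
    simp [fam, heis, heisB, cen, tra, hom, rot, G, Fin.sum_univ_four, h.init (slice y z v) rfl,
      h.einit (slice y z v) rfl] <;> ring

theorem fam_linearIndependent (h : HeisData ε a₁ a₂ γ s e) :
    LinearIndependent ℝ (fam ε a₁ a₂ γ s e) := by
  rw [Fintype.linearIndependent_iff]
  intro g hg
  have key : ∀ x p, ∑ i, g i * pair x (fam ε a₁ a₂ γ s e i) p = 0 := by
    intro x p
    have h1 : ∀ a, ∑ i, g i * ev x (fam ε a₁ a₂ γ s e i a) = 0 := fun a => by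
      simpa using congrArg (ev x) (congrFun hg a)
    simp only [pair, Finset.mul_sum]
    rw [Finset.sum_comm]
    refine Finset.sum_eq_zero fun a _ => ?_
    rw [← mul_zero (p a), ← h1 a, Finset.mul_sum]
    exact Finset.sum_congr rfl fun i _ => by ring
  have k3 := fun y z v => key (slice y z v) (bvec 3)
  have k1 := fun y z v => key (slice y z v) (bvec 1)
  have k2 := fun y z v => key (slice y z v) (bvec 2)
  have k0 := fun y z v => key (slice y z v) (tvec γ y z (2 * ε * v - a₁ * y ^ 2 - a₂ * z ^ 2))
  simp only [fam_d3, fam_d1 h, fam_d2 h, fam_tvec h] at k3 k1 k2 k0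
  simp [Fin.sum_univ_eight] at k3 k1 k2 k0
  have a1 := k1 0 0
  have a2 := k1 1 0
  have a3 := k1 0 1
  have b1 := k2 0 0
  have c1 := k0 0 0 0
  have c2 := k0 1 0 0
  have c3 := k0 0 1 0
  simp [k3] at a1 a2 a3 b1 c1 c2 c3
  intro i
  fin_cases i <;> simp <;> linarith

/-- A relation modulo the metric is determined by its coefficient at (4, 5), so the Casimir relation
is the only possible one. The pair (4, 7) is left out because on x₁ = 0 it is a combination of
Heisenberg products for all parameters. The coefficients of the polynomial identities are extracted
by evaluating at points with coordinates 0 and ±1. -/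
theorem fam_kernel (h : HeisData ε a₁ a₂ γ s e) {g : Fin 8 → Fin 8 → ℝ} {f : Sm}
    (hg : SupportedOn ({p | p.1 ≤ p.2 ∧ p ≠ (4, 7)} : Finset (Fin 8 × Fin 8)) g)
    (hf : ∑ i, ∑ j, g i j • prods (fam ε a₁ a₂ γ s e) (i, j) = f • G ε a₁ a₂ γ) :
    g 4 5 = 2 * ev 0 f ∧ 2 * g 4 6 = ε * g 4 5 ∧ (g 4 5 = 0 → ∀ i j, g i j = 0) := by
  have key := pairing_sum_prods hf
  obtain ⟨M, hM⟩ : ∃ M : Fin 8 → Fin 8 → ℝ, ∀ i j, g i j + g j i = M i j := ⟨_, fun _ _ => rfl⟩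
  have hsymm : ∀ i j, M i j = M j i := fun i j => by rw [← hM, ← hM, add_comm]
  simp only [hM] at key
  have k33 := fun y z v => key (slice y z v) (bvec 3) (bvec 3)
  have k31 := fun y z v => key (slice y z v) (bvec 3) (bvec 1)
  have k32 := fun y z v => key (slice y z v) (bvec 3) (bvec 2)
  have k11 := fun y z v => key (slice y z v) (bvec 1) (bvec 1)
  have k12 := fun y z v => key (slice y z v) (bvec 1) (bvec 2)
  have k22 := fun y z v => key (slice y z v) (bvec 2) (bvec 2)
  have k03 := fun y z v => key (slice y z v) (tvec γ y z (2 * ε * v - a₁ * y ^ 2 - a₂ * z ^ 2)) (bvec 3)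
  have k01 := fun y z v => key (slice y z v) (tvec γ y z (2 * ε * v - a₁ * y ^ 2 - a₂ * z ^ 2)) (bvec 1)
  have k02 := fun y z v => key (slice y z v) (tvec γ y z (2 * ε * v - a₁ * y ^ 2 - a₂ * z ^ 2)) (bvec 2)
  have k00 := fun y z v => key (slice y z v) (tvec γ y z (2 * ε * v - a₁ * y ^ 2 - a₂ * z ^ 2))
    (tvec γ y z (2 * ε * v - a₁ * y ^ 2 - a₂ * z ^ 2))
  simp only [gForm_bvec, gForm_tvec_bvec, gForm_tvec_tvec, fam_d3, fam_d1 h, fam_d2 h,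
    fam_tvec h] at k33 k31 k32 k11 k12 k22 k03 k01 k02 k00
  clear key
  simp [Fin.sum_univ_eight, G] at k33 k31 k32 k11 k12 k22 k03 k01 k02 k00
  simp only [hsymm 2 0, hsymm 2 1, hsymm 3 0, hsymm 3 1, hsymm 3 2, hsymm 4 0, hsymm 4 1,
    hsymm 4 2, hsymm 4 3, hsymm 5 0, hsymm 5 1, hsymm 6 0,
    hsymm 6 1, hsymm 6 2, hsymm 6 3, hsymm 6 4, hsymm 6 5, hsymm 7 0, hsymm 7 1, hsymm 7 5, hsymm 7 6]
    at k33 k31 k32 k11 k12 k22 k03 k01 k02 k00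
  have hlow : ∀ i j, j < i → g i j = 0 := fun i j hij => hg i j (by simp [hij.not_ge])
  have z47 : M 4 7 = 0 := by
    rw [← hM, hg 4 7 (by simp), hlow 7 4 (by decide), add_zero]
  simp only [k33, zero_mul, neg_zero, add_zero] at k31 k32
  have z05 : M 0 5 = 0 := by linarith [k31 0 0]
  have z15 : M 1 5 = 0 := by linarith [k32 0 0]
  have z56 : M 5 6 = 0 := by linarith [k31 0 0, k31 1 0]
  have z57 : M 5 7 = 0 := by linarith [k31 0 0, k31 0 1]
  -- The transversal vector and ∂₄ have scalar product 1, so `k03` expresses 2f through the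
  -- coefficients. This eliminates the unknown function from the diagonal identities.
  simp only [← k03] at k11 k22 k00
  simp only [k33, z05, z15, z56, z57, z47, zero_mul, neg_zero, add_zero]
    at k11 k12 k22 k03 k01 k02 k00
  have z06 : M 0 6 = 0 := by linarith [k01 0 0 0, k01 0 0 1]
  have z16 : M 1 6 = 0 := by linarith [k02 0 0 0, k02 0 0 1]
  have z25 : M 2 5 = 0 := by linarith [k11 1 0 0, k11 (-1) 0 0]
  have z35 : M 3 5 = 0 := by linarith [k22 0 1 0, k22 0 (-1) 0]
  have z07 : M 0 7 = 0 := by linarith [k11 0 1 0, k11 0 (-1) 0]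
  have z17 : M 1 7 = 0 := by linarith [k22 1 0 0, k22 (-1) 0 0]
  have z00 : M 0 0 = M 4 5 := by linarith [k11 0 0 0]
  have z11 : M 1 1 = M 4 5 := by linarith [k22 0 0 0]
  have z01 : M 0 1 = 0 := by linarith [k12 0 0]
  have z66 : M 6 6 = 0 := by linarith [k11 1 0 0]
  have z77 : M 7 7 = 0 := by linarith [k11 0 1 0]
  have z67 : M 6 7 = 0 := by linarith [k11 1 1 0]
  simp only [z06, z16, z25, z35, z66, z67, zero_mul, neg_zero, add_zero,
    zero_add] at k01 k02 k03 k00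
  have z04 : M 0 4 = 0 := by linarith [k01 0 0 0]
  have z14 : M 1 4 = 0 := by linarith [k02 0 0 0]
  have z26 : M 2 6 = 0 := by linarith [k01 1 0 0, k01 (-1) 0 0]
  have z27 : M 2 7 = 0 := by linarith [k02 1 0 0, k02 (-1) 0 0]
  have z37 : M 3 7 = 0 := by linarith [k01 0 1 0, k01 0 (-1) 0]
  have z36 : M 3 6 = 0 := by linarith [k02 0 1 0, k02 0 (-1) 0]
  have z02 : M 0 2 = -M 4 6 := by linarith [k01 1 0 0]
  have z03 : M 0 3 = γ * M 4 5 := by linarith [k01 0 1 0]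
  have z12 : M 1 2 = -(γ * M 4 5) := by linarith [k02 1 0 0]
  have z13 : M 1 3 = -M 4 6 := by linarith [k02 0 1 0]
  simp only [z26, z36, zero_mul, add_zero, zero_add] at k00
  have z44 : M 4 4 = 0 := by linarith [k00 0 0 0]
  have z46 : 2 * M 4 6 = ε * M 4 5 := by linarith [k00 0 0 1]
  have z24 : M 2 4 = 0 := by linarith [k00 1 0 0, k00 (-1) 0 0]
  have z34 : M 3 4 = 0 := by linarith [k00 0 1 0, k00 0 (-1) 0]
  have z22 : M 2 2 = -(a₁ * M 4 5) := by linarith [k00 1 0 0]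
  have z33 : M 3 3 = -(a₂ * M 4 5) := by linarith [k00 0 1 0]
  have z23 : M 2 3 = 0 := by linarith [k00 1 1 0]
  have e45 : M 4 5 = g 4 5 := by rw [← hM, hlow 5 4 (by decide), add_zero]
  have e46 : M 4 6 = g 4 6 := by rw [← hM, hlow 6 4 (by decide), add_zero]
  have hs0 : slice 0 0 0 = 0 := by
    ext i
    fin_cases i <;> rfl
  refine ⟨by rw [← e45, ← hs0]; exact k03 0 0 0, by rw [← e45, ← e46]; exact z46, fun h45 => ?_⟩
  rw [← e45] at h45
  have z46' : M 4 6 = 0 := by rw [h45] at z46; linarith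
  rw [h45] at z00 z11 z03 z12 z22 z33
  rw [z46'] at z02 z13
  simp only [mul_zero, neg_zero] at z02 z13 z03 z12 z22 z33
  have hle : ∀ i j, i ≤ j → M i j = 0 := by
    intro i j hij
    fin_cases i <;> fin_cases j <;> first | assumption | exact absurd hij (by decide)
  intro i j
  rcases lt_trichotomy i j with hij | rfl | hij
  · rw [← hle i j hij.le, ← hM, hlow j i hij, add_zero]
  · linarith [hle i i le_rfl, hM i i]
  · exact hlow i j hij

end

/-! ### Dimensions in the cases that are not conformally flat or not flat -/

theorem span_image_pairs {ι E : Type*} [LinearOrder ι] [AddCommGroup E] [Module ℝ E]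
    {w : ι × ι → E} (hw : ∀ i j, w (i, j) = w (j, i)) {J : Set ι} {S : Finset (ι × ι)}
    (hS : (S : Set (ι × ι)) ⊆ J ×ˢ J)
    (h : ∀ i ∈ J, ∀ j ∈ J, i ≤ j → (i, j) ∉ S → w (i, j) ∈ Submodule.span ℝ (w '' S)) :
    Submodule.span ℝ (w '' (J ×ˢ J)) = Submodule.span ℝ (w '' S) := by
  have h' : ∀ i ∈ J, ∀ j ∈ J, i ≤ j → w (i, j) ∈ Submodule.span ℝ (w '' S) := by
    intro i hi j hj hij
    by_cases hs : (i, j) ∈ S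
    · exact Submodule.subset_span ⟨_, hs, rfl⟩
    · exact h i hi j hj hij hs
  refine le_antisymm (Submodule.span_le.2 ?_) (Submodule.span_mono (Set.image_mono hS))
  rintro _ ⟨⟨i, j⟩, ⟨hi, hj⟩, rfl⟩
  rcases le_total i j with hij | hij
  · exact h' i hi j hj hij
  · rw [hw]
    exact h' j hj i hi hij

theorem prods_comm {ι : Type*} (k : ι → SmCov) (i j : ι) : prods k (i, j) = prods k (j, i) :=
  sp_comm _ _

theorem finrank_sup_span_singleton {E : Type*} [AddCommGroup E] [Module ℝ E] {W : Submodule ℝ E}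
    [FiniteDimensional ℝ W] {x : E} (hx : x ∉ W) :
    Module.finrank ℝ ↥(Submodule.span ℝ {x} ⊔ W) = Module.finrank ℝ W + 1 := by
  have hx0 : x ≠ 0 := fun h => hx (h ▸ W.zero_mem)
  have h1 : Submodule.span ℝ {x} ⊓ W = ⊥ :=
    (Submodule.disjoint_span_singleton' hx0).2 hx |>.symm.eq_bot
  have h2 := Submodule.finrank_sup_add_finrank_inf_eq (Submodule.span ℝ {x}) W
  rw [h1, finrank_bot, finrank_span_singleton hx0] at h2
  omega

theorem SupportedOn.mono {ι : Type*} {S T : Finset (ι × ι)} {g : ι → ι → ℝ}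
    (h : SupportedOn S g) (hST : S ⊆ T) : SupportedOn T g := fun i j hij =>
  h i j fun hs => hij (hST hs)

theorem mem_span_pairs {ι E : Type*} [Fintype ι] [DecidableEq ι] [AddCommGroup E] [Module ℝ E]
    {w : ι × ι → E} {S : Finset (ι × ι)} {T : E} (h : T ∈ Submodule.span ℝ (w '' S)) :
    ∃ g : ι → ι → ℝ, SupportedOn S g ∧ ∑ i, ∑ j, g i j • w (i, j) = T := by
  obtain ⟨l, hl, rfl⟩ := (Finsupp.mem_span_image_iff_linearCombination ℝ).1 h
  refine ⟨fun i j => l (i, j), fun i j hij => ?_, ?_⟩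
  · by_contra h0
    exact hij (hl (Finsupp.mem_support_iff.2 h0))
  · rw [← Fintype.sum_prod_type' (f := fun i j => l (i, j) • w (i, j)),
      Finsupp.linearCombination_apply, Finsupp.sum_fintype l (fun i a => a • w i) (fun i => zero_smul ℝ (w i))]

section

variable {ε a₁ a₂ γ : ℝ} {s : Fin 4 → Fin 4 → Sm} {e : Sm}

theorem fam_mem_Kil (h : HeisData ε a₁ a₂ γ s e) {i : Fin 8} (hi : i ≤ 5) :
    fam ε a₁ a₂ γ s e i ∈ Kil ε a₁ a₂ γ := by
  have hs := fun i => heis_mem_Kil (h.fib i) (h.ode i)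
  fin_cases i
  · exact hs 0
  · exact hs 1
  · exact hs 2
  · exact hs 3
  · exact cen_mem_Kil h.efib h.eode
  · exact tra_mem_Kil
  · exact absurd hi (by decide)
  · exact absurd hi (by decide)

theorem span_eq_image {V : Submodule ℝ SmCov} {n : ℕ} (σ : SmCov →ₗ[ℝ] Fin n → ℝ)
    (hσ : ∀ K ∈ V, σ K = 0 → K = 0) {ι : Type*} {k : ι → SmCov} (hli : LinearIndependent ℝ k)
    {m : Fin n → ι} (hm : Function.Injective m) (hk : ∀ i, k (m i) ∈ V) :
    V = Submodule.span ℝ (k '' Set.range m) := by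
  rw [← Set.range_comp]
  exact eq_span_of_injective_on σ hσ (k := k ∘ m) hk (hli.comp m hm)

theorem casimir_prods (h : HeisData ε a₁ a₂ γ s e) :
    ∑ i : Fin 4, ∑ j : Fin 4, casimir ε a₁ a₂ γ i j •
        prods (fam ε a₁ a₂ γ s e) (Fin.castAdd 4 i, Fin.castAdd 4 j)
      + (2 : ℝ) • prods (fam ε a₁ a₂ γ s e) (4, 5) + ε • prods (fam ε a₁ a₂ γ s e) (4, 6) =
      e • G ε a₁ a₂ γ := by
  rw [← casimir_relation h]
  have hf : ∀ i : Fin 4, fam ε a₁ a₂ γ s e (Fin.castAdd 4 i) = heis γ (s i) := by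
    intro i
    fin_cases i <;> rfl
  simp only [prods, hf]
  rfl

theorem angular_prods {a : ℝ} (h : HeisData ε a a γ s e) :
    ∑ i : Fin 4, ∑ j : Fin 4, angular i j •
        prods (fam ε a a γ s e) (Fin.castAdd 4 i, Fin.castAdd 4 j)
      + (2 : ℝ) • prods (fam ε a a γ s e) (4, 7) = 0 := by
  rw [← angular_relation h]
  have hf : ∀ i : Fin 4, fam ε a a γ s e (Fin.castAdd 4 i) = heis γ (s i) := by
    intro i
    fin_cases i <;> rfl
  simp only [prods, hf]
  rfl

theorem mem_of_two_smul {E : Type*} [AddCommGroup E] [Module ℝ E] {W : Submodule ℝ E} {x : E}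
    (h : (2 : ℝ) • x ∈ W) : x ∈ W := by
  simpa [smul_smul] using W.smul_mem (2⁻¹ : ℝ) h

/-- The pairs spanning the reducible conformal Killing tensors in the anisotropic case. -/
def anisoPairs : Finset (Fin 8 × Fin 8) := {p | p.1 ≤ p.2 ∧ p.2 ≤ 6 ∧ p ≠ (4, 5)}

/-- The pairs of Killing vectors in the anisotropic case. -/
def anisoKilPairs : Finset (Fin 8 × Fin 8) := {p | p.1 ≤ p.2 ∧ p.2 ≤ 5}

/-- The pairs spanning the products of Killing vectors in the isotropic case. -/
def isoKilPairs : Finset (Fin 8 × Fin 8) := {p | p.1 ≤ p.2 ∧ p.1 ≠ 6 ∧ p.2 ≠ 6 ∧ p ≠ (4, 7)}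

theorem swapped_mem_span {E : Type*} [AddCommGroup E] [Module ℝ E] {w : Fin 8 × Fin 8 → E}
    (hw : ∀ i j, w (i, j) = w (j, i)) {S : Finset (Fin 8 × Fin 8)}
    (hS : ∀ i j : Fin 4, i ≤ j → (Fin.castAdd 4 i, Fin.castAdd 4 j) ∈ S) (i j : Fin 4) :
    w (Fin.castAdd 4 i, Fin.castAdd 4 j) ∈ Submodule.span ℝ (w '' S) := by
  rcases le_total i j with hij | hij
  · exact Submodule.subset_span ⟨_, hS i j hij, rfl⟩
  · rw [hw]
    exact Submodule.subset_span ⟨_, hS j i hij, rfl⟩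

/-- Seven fields give 28 products. The trace-free part kills `e • G`, so the Casimir relation
removes (4, 5), and `fam_kernel` shows that the other 27 are independent. -/
theorem finrank_redCK_of_ne (ha : a₁ ≠ a₂) : Module.finrank ℝ (redCK ε a₁ a₂ γ) = 27 := by
  obtain ⟨s, e, h⟩ := exists_heisData ε a₁ a₂ γ
  have hV := span_eq_image (V := CK ε a₁ a₂ γ) anisoJet (anisoJet_injective ha)
    (fam_linearIndependent h) (m := Fin.castSucc) (Fin.castSucc_injective 7) (fun i => by
      by_cases hi : i ≤ 5
      · exact Kil_le_CK _ _ _ _ (fam_mem_Kil h (Fin.castSucc_le_castSucc_iff.2 hi))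
      · obtain rfl : i = 6 := by omega
        exact hom_mem_CK)
  set w : Fin 8 × Fin 8 → SmTensor := fun p => trFree ε a₁ a₂ γ (prods (fam ε a₁ a₂ γ s e) p)
    with hwdef
  have hw : ∀ i j, w (i, j) = w (j, i) := fun i j => by
    simp only [hwdef, prods_comm _ i j]
  rw [redCK_eq hV, Submodule.map_span, Set.image_image, span_image_pairs (S := anisoPairs) hw]
  · rw [finrank_span_pairs]
    · decide
    · intro g hg hsum
      have h0 : trFree ε a₁ a₂ γ (∑ i, ∑ j, g i j • prods (fam ε a₁ a₂ γ s e) (i, j)) = 0 := by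
        simpa [hwdef] using hsum
      obtain ⟨f, hf⟩ := (trFree_eq_zero_iff ε a₁ a₂ γ _).1 h0
      exact (fam_kernel h (hg.mono (by decide)) hf).2.2 (hg 4 5 (by decide))
  · rintro ⟨i, j⟩ hp
    revert i j
    decide
  · rintro i hi j hj hij hS
    obtain ⟨rfl, rfl⟩ : i = 4 ∧ j = 5 := by
      revert i j
      decide
    have hrel := congrArg (trFree ε a₁ a₂ γ) (casimir_prods h)
    simp only [trFree_smul_G, map_add, map_sum, map_smul] at hrel
    have hrel' : (2 : ℝ) • w (4, 5) = -(∑ i : Fin 4, ∑ j : Fin 4, casimir ε a₁ a₂ γ i j •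
        w (Fin.castAdd 4 i, Fin.castAdd 4 j)) - ε • w (4, 6) := by
      simp only [hwdef]
      rw [← sub_eq_zero, ← hrel]
      abel
    refine mem_of_two_smul ?_
    rw [hrel']
    refine Submodule.sub_mem _ (Submodule.neg_mem _ (Submodule.sum_mem _ fun i _ =>
      Submodule.sum_mem _ fun j _ => Submodule.smul_mem _ _ ?_)) (Submodule.smul_mem _ _ ?_)
    · exact swapped_mem_span hw (by decide) i j
    · exact Submodule.subset_span ⟨(4, 6), by decide, rfl⟩

theorem G_mem_span (h : HeisData 0 a₁ a₂ γ s e) {S : Finset (Fin 8 × Fin 8)}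
    (hS : ∀ i j : Fin 4, i ≤ j → (Fin.castAdd 4 i, Fin.castAdd 4 j) ∈ S) (hS' : (4, 5) ∈ S) :
    G 0 a₁ a₂ γ ∈ Submodule.span ℝ (prods (fam 0 a₁ a₂ γ s e) '' S) := by
  have he : e = 1 := by
    rw [eq_C_of_D_eq_zero h.efib (by rw [h.eode]; simp), h.einit 0 rfl]
    exact map_one _
  have hrel := casimir_prods h
  have he' : e • G 0 a₁ a₂ γ = G 0 a₁ a₂ γ := by rw [he, one_smul]
  rw [zero_smul, add_zero, he'] at hrel
  rw [← hrel]
  refine Submodule.add_mem _ (Submodule.sum_mem _ fun i _ =>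
      Submodule.sum_mem _ fun j _ => Submodule.smul_mem _ _ ?_) (Submodule.smul_mem _ _ ?_)
  · exact swapped_mem_span (prods_comm _) hS i j
  · exact Submodule.subset_span ⟨(4, 5), hS', rfl⟩

/-- With f = 1 the kernel lemma forces the coefficient 2 at (4, 5), hence ε at (4, 6). That pair
involves the homothety and is not available. -/
theorem G_not_mem_span (h : HeisData ε a₁ a₂ γ s e) (hε : ε ≠ 0) {S : Finset (Fin 8 × Fin 8)}
    (hS : S ⊆ ({p | p.1 ≤ p.2 ∧ p ≠ (4, 7)} : Finset (Fin 8 × Fin 8))) (hS' : (4, 6) ∉ S) :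
    G ε a₁ a₂ γ ∉ Submodule.span ℝ (prods (fam ε a₁ a₂ γ s e) '' S) := by
  intro hG
  obtain ⟨g, hg, hsum⟩ := mem_span_pairs hG
  obtain ⟨h1, h2, -⟩ := fam_kernel h (hg.mono hS) (f := 1) (by rw [hsum, one_smul])
  rw [hg 4 6 hS', h1] at h2
  simp [hε] at h2

theorem finrank_span_prods (h : HeisData ε a₁ a₂ γ s e) {S : Finset (Fin 8 × Fin 8)}
    (hS : S ⊆ ({p | p.1 ≤ p.2 ∧ p ≠ (4, 7)} : Finset (Fin 8 × Fin 8))) :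
    Module.finrank ℝ (Submodule.span ℝ (prods (fam ε a₁ a₂ γ s e) '' S)) = S.card := by
  refine finrank_span_pairs _ _ fun g hg hsum => ?_
  have := fam_kernel h (hg.mono hS) (f := 0) (by rw [hsum, zero_smul])
  exact this.2.2 (by rw [this.1, map_zero, mul_zero])

theorem finrank_redKil_of_span {J : Set (Fin 8)} (h : HeisData ε a₁ a₂ γ s e)
    {S : Finset (Fin 8 × Fin 8)} (hV : Kil ε a₁ a₂ γ = Submodule.span ℝ (fam ε a₁ a₂ γ s e '' J))
    (hJ : Submodule.span ℝ (prods (fam ε a₁ a₂ γ s e) '' (J ×ˢ J)) =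
      Submodule.span ℝ (prods (fam ε a₁ a₂ γ s e) '' S))
    (hS : S ⊆ ({p | p.1 ≤ p.2 ∧ p ≠ (4, 7)} : Finset (Fin 8 × Fin 8))) (hS4 : (4, 6) ∉ S)
    (hSH : ∀ i j : Fin 4, i ≤ j → (Fin.castAdd 4 i, Fin.castAdd 4 j) ∈ S) (hS5 : (4, 5) ∈ S) :
    Module.finrank ℝ (redKil ε a₁ a₂ γ) = if ε = 0 then S.card else S.card + 1 := by
  rw [redKil_eq hV, hJ]
  split_ifs with hε
  · subst hε
    rw [sup_eq_right.2, finrank_span_prods h hS]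
    rw [Submodule.span_singleton_le_iff_mem]
    exact G_mem_span h hSH hS5
  · have : FiniteDimensional ℝ (Submodule.span ℝ (prods (fam ε a₁ a₂ γ s e) '' S)) :=
      FiniteDimensional.span_of_finite ℝ (S.finite_toSet.image _)
    rw [finrank_sup_span_singleton (G_not_mem_span h hε hS hS4), finrank_span_prods h hS]

theorem finrank_redKil_of_ne (ha : a₁ ≠ a₂) :
    Module.finrank ℝ (redKil ε a₁ a₂ γ) = if ε = 0 then 21 else 22 := by
  obtain ⟨s, e, h⟩ := exists_heisData ε a₁ a₂ γ
  have hV := span_eq_image (V := Kil ε a₁ a₂ γ) anisoKilJet (anisoKilJet_injective ha)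
    (fam_linearIndependent h) (m := Fin.castAdd 2) (Fin.castAdd_injective 6 2)
    (fun i => fam_mem_Kil h (by revert i; decide))
  have hcard : anisoKilPairs.card = 21 := by decide
  rw [finrank_redKil_of_span h hV (S := anisoKilPairs) ?_ (by decide) (by decide) (by decide)
    (by decide), hcard]
  refine span_image_pairs (prods_comm _) ?_ ?_
  · rintro ⟨i, j⟩ hp
    revert i j
    decide
  · rintro i hi j hj hij hS
    exfalso
    revert i j
    decide

/-- The rotation is the seventh Killing vector. Of the 28 products, the angular relation removes (4,
7). -/
theorem finrank_redKil_of_eq {a : ℝ} (ha : a ≠ 0) :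
    Module.finrank ℝ (redKil ε a a γ) = if ε = 0 then 27 else 28 := by
  obtain ⟨s, e, h⟩ := exists_heisData ε a a γ
  have hV := span_eq_image (V := Kil ε a a γ) isoKilJet (isoKilJet_injective ha)
    (fam_linearIndependent h) (m := ![0, 1, 2, 3, 4, 5, 7]) (by decide)
    (fun i => by
      by_cases hi : i ≤ 5
      · exact fam_mem_Kil h (by revert i; decide)
      · obtain rfl : i = 6 := by omega
        exact rot_mem_Kil)
  have hcard : isoKilPairs.card = 27 := by decide
  rw [finrank_redKil_of_span h hV (S := isoKilPairs) ?_ (by decide) (by decide) (by decide)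
    (by decide), hcard]
  refine span_image_pairs (prods_comm _) ?_ ?_
  · rintro ⟨i, j⟩ hp
    revert i j
    decide
  · rintro i hi j hj hij hS
    obtain ⟨rfl, rfl⟩ : i = 4 ∧ j = 7 := by
      revert i j
      decide
    refine mem_of_two_smul ?_
    rw [eq_neg_of_add_eq_zero_right (angular_prods h)]
    exact Submodule.neg_mem _ (Submodule.sum_mem _ fun i _ =>
      Submodule.sum_mem _ fun j _ => Submodule.smul_mem _ _
        (swapped_mem_span (prods_comm _) (by decide) i j))

end

/-! ### The conformal embedding of the isotropic plane wave into the light cone of `ℝ^{2,4}` -/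

/-- Solutions of the linear systems defining the embedding. -/
structure ConeData (ε a γ : ℝ) where
  (q p r t n c s : Sm)
  q_fib : Fiberwise q
  p_fib : Fiberwise p
  r_fib : Fiberwise r
  t_fib : Fiberwise t
  n_fib : Fiberwise n
  c_fib : Fiberwise c
  s_fib : Fiberwise s
  D0q : D 0 q = p
  D0p : D 0 p = C a * q + C ε * p
  D0r : D 0 r = t
  D0t : D 0 t = C a * r + C ε * t
  D0n : D 0 n = -(C ε * n)
  D0c : D 0 c = -(C γ * s)
  D0s : D 0 s = C γ * c
  init : ∀ x : Point, x 0 = 0 → ev x q = 1 ∧ ev x p = 0 ∧ ev x r = 0 ∧ ev x t = 1 ∧ ev x n = 1 ∧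
    ev x c = 1 ∧ ev x s = 0

theorem nonempty_coneData (ε a γ : ℝ) : Nonempty (ConeData ε a γ) := by
  obtain ⟨f, f1, f2, f3⟩ := linearODE_exists !![0, 1; a, ε] ![1, 0]
  obtain ⟨g, g1, g2, g3⟩ := linearODE_exists !![0, 1; a, ε] ![0, 1]
  obtain ⟨n, n1, n2, n3⟩ := exists_exp (-ε)
  obtain ⟨h, h1, h2, h3⟩ := linearODE_exists !![0, -γ; γ, 0] ![1, 0]
  refine ⟨⟨f 0, f 1, g 0, g 1, n, h 0, h 1, f1 0, f1 1, g1 0, g1 1, n1, h1 0, h1 1,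
    by simpa using f2 0, by simpa using f2 1, by simpa using g2 0, by simpa using g2 1,
    n2.trans (Sm.ext_ev fun x => by simp), (h2 0).trans (Sm.ext_ev fun x => by simp), by simpa using h2 1, fun x hx => ?_⟩⟩
  exact ⟨f3 x hx 0, f3 x hx 1, g3 x hx 0, g3 x hx 1, n3 x hx, h3 x hx 0, h3 x hx 1⟩

namespace ConeData

variable {ε a γ : ℝ} (d : ConeData ε a γ)

attribute [simp] D0q D0p D0r D0t D0n D0c D0s

@[simp] theorem D1q : D 1 d.q = 0 := d.q_fib.1
@[simp] theorem D2q : D 2 d.q = 0 := d.q_fib.2.1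
@[simp] theorem D3q : D 3 d.q = 0 := d.q_fib.2.2
@[simp] theorem D1p : D 1 d.p = 0 := d.p_fib.1
@[simp] theorem D2p : D 2 d.p = 0 := d.p_fib.2.1
@[simp] theorem D3p : D 3 d.p = 0 := d.p_fib.2.2
@[simp] theorem D1r : D 1 d.r = 0 := d.r_fib.1
@[simp] theorem D2r : D 2 d.r = 0 := d.r_fib.2.1
@[simp] theorem D3r : D 3 d.r = 0 := d.r_fib.2.2
@[simp] theorem D1t : D 1 d.t = 0 := d.t_fib.1
@[simp] theorem D2t : D 2 d.t = 0 := d.t_fib.2.1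
@[simp] theorem D3t : D 3 d.t = 0 := d.t_fib.2.2
@[simp] theorem D1n : D 1 d.n = 0 := d.n_fib.1
@[simp] theorem D2n : D 2 d.n = 0 := d.n_fib.2.1
@[simp] theorem D3n : D 3 d.n = 0 := d.n_fib.2.2
@[simp] theorem D1c : D 1 d.c = 0 := d.c_fib.1
@[simp] theorem D2c : D 2 d.c = 0 := d.c_fib.2.1
@[simp] theorem D3c : D 3 d.c = 0 := d.c_fib.2.2
@[simp] theorem D1s : D 1 d.s = 0 := d.s_fib.1
@[simp] theorem D2s : D 2 d.s = 0 := d.s_fib.2.1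
@[simp] theorem D3s : D 3 d.s = 0 := d.s_fib.2.2

/-- The Wronskian W of the two solutions satisfies W' = εW, and `n` is its integrating factor. -/
theorem wronskian : d.n * (d.q * d.t - d.p * d.r) = 1 := by
  rw [eq_C_of_D_eq_zero (f := d.n * (d.q * d.t - d.p * d.r))]
  · obtain ⟨h1, h2, h3, h4, h5, -⟩ := d.init 0 rfl
    simp [h1, h2, h3, h4, h5]
  · refine ⟨?_, ?_, ?_⟩ <;> simp
  · simp
    ring

theorem rotation : d.c ^ 2 + d.s ^ 2 = 1 := by
  rw [eq_C_of_D_eq_zero (f := d.c ^ 2 + d.s ^ 2)]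
  · obtain ⟨-, -, -, -, -, h6, h7⟩ := d.init 0 rfl
    simp [h6, h7]
  · refine ⟨?_, ?_, ?_⟩ <;> simp
  · simp
    ring

/-- The components of the embedding. -/
def emb : Fin 6 → Sm :=
  ![d.q, -(C 2⁻¹ * (d.t * d.n * (X 1 ^ 2 + X 2 ^ 2))) - d.n * d.r * X 3, d.r,
    C 2⁻¹ * (d.p * d.n * (X 1 ^ 2 + X 2 ^ 2)) + d.n * d.q * X 3,
    d.c * X 1 - d.s * X 2, d.s * X 1 + d.c * X 2]

/-- The trace parts of the Hessians of the components of the embedding. -/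
def tr : Fin 6 → Sm := ![0, -(d.t * d.n), 0, d.p * d.n, 0, 0]

/-- The partial derivatives of the embedding. -/
def dEmb : Fin 4 → Fin 6 → Sm :=
  ![![d.p, -(C 2⁻¹ * (C a * d.r * d.n * (X 1 ^ 2 + X 2 ^ 2)))
        - d.n * (d.t - C ε * d.r) * X 3, d.t,
      C 2⁻¹ * (C a * d.q * d.n * (X 1 ^ 2 + X 2 ^ 2)) + d.n * (d.p - C ε * d.q) * X 3,
      -(C γ * (d.s * X 1 + d.c * X 2)), C γ * (d.c * X 1 - d.s * X 2)],
    ![0, -(d.t * d.n * X 1), 0, d.p * d.n * X 1, d.c, d.s],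
    ![0, -(d.t * d.n * X 2), 0, d.p * d.n * X 2, -d.s, d.c],
    ![0, -(d.n * d.r), 0, d.n * d.q, 0, 0]]

theorem two_half : (2 : Sm) * C 2⁻¹ = 1 := by
  refine Sm.ext_ev fun x => ?_
  simp

set_option maxHeartbeats 1000000 in
theorem D_emb (i : Fin 4) (A : Fin 6) : D i (d.emb A) = d.dEmb i A := by
  have h := two_half
  fin_cases i <;> fin_cases A <;> simp [emb, dEmb] <;> first
    | ring1
    | linear_combination (d.t * d.n * X 1) * h
    | linear_combination (d.p * d.n * X 1) * h
    | linear_combination (d.t * d.n * X 2) * h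
    | linear_combination (d.p * d.n * X 2) * h

-- All six components solve the same equation Hess E = aE dx₁² modulo the metric. The coefficient of
-- dx₁² is proportional to E, so it cancels in antisymmetrized combinations, as `symD_kf` exploits.
set_option maxHeartbeats 2000000 in
theorem hessian_emb (i j : Fin 4) (A : Fin 6) :
    D i (D j (d.emb A)) - ∑ k, Gam ε a a γ k i j * D k (d.emb A) =
      (if i = 0 ∧ j = 0 then C a * d.emb A else 0) + d.tr A * G ε a a γ i j := by
  have h := two_half
  simp only [D_emb]
  fin_cases i <;> fin_cases j <;> fin_cases A <;>
    simp [emb, dEmb, tr, Gam, G, Fin.sum_univ_four] <;> first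
    | ring1
    | linear_combination ((C a * C ε * d.r * d.n * (X 1 ^ 2 + X 2 ^ 2))) * h
    | linear_combination (-(C a * C ε * d.q * d.n * (X 1 ^ 2 + X 2 ^ 2))) * h
    | linear_combination (-(C a * d.r * d.n * X 1)) * h
    | linear_combination (-(C a * d.r * d.n * X 2)) * h
    | linear_combination (C a * d.q * d.n * X 1) * h
    | linear_combination (C a * d.q * d.n * X 2) * h

end ConeData

namespace ConeData

variable {ε a γ : ℝ} (d : ConeData ε a γ)

/-- The involution describing the quadratic form of signature `(2, 4)`. -/
def dual : Fin 6 → Fin 6 := ![1, 0, 3, 2, 4, 5]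

-- The ambient quadratic form pulls back to the plane wave metric itself. With `sum_emb_mul` this is
-- an isometric embedding into the light cone.
set_option maxHeartbeats 1000000 in
theorem sum_dEmb_mul (i j : Fin 4) :
    ∑ A, D i (d.emb A) * D j (d.emb (dual A)) = G ε a a γ i j := by
  have h := two_half
  have w := d.wronskian
  have o := d.rotation
  simp only [D_emb]
  fin_cases i <;> fin_cases j <;> simp [dEmb, dual, G, Fin.sum_univ_six]
  · linear_combination (C γ ^ 2 * (X 1 ^ 2 + X 2 ^ 2)) * o +
      (C a * (X 1 ^ 2 + X 2 ^ 2) - 2 * C ε * X 3) * w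
      + (C a * d.n * (d.q * d.t - d.p * d.r) * (X 1 ^ 2 + X 2 ^ 2)) * h
  all_goals first
    | ring1
    | linear_combination (-(C γ * X 2)) * o
    | linear_combination (C γ * X 1) * o
    | linear_combination w
    | linear_combination o

theorem sum_emb_mul : ∑ A, d.emb A * d.emb (dual A) = 0 := by
  have h := two_half
  have w := d.wronskian
  have o := d.rotation
  simp [emb, dual, Fin.sum_univ_six]
  linear_combination (X 1 ^ 2 + X 2 ^ 2) * (o - w) - (d.n * (d.q * d.t - d.p * d.r) * (X 1 ^ 2 + X 2 ^ 2)) * h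

theorem sum_emb_mul_dEmb (i : Fin 4) : ∑ A, d.emb A * D i (d.emb (dual A)) = 0 := by
  have h := congrArg (D i) d.sum_emb_mul
  simp only [map_sum, D_mul, map_zero, Finset.sum_add_distrib] at h
  refine two_cancel ?_
  simp [Fin.sum_univ_six, dual] at h ⊢
  linear_combination h

/-- The conformal Killing covectors given by the rotations of the ambient space. -/
def kf (A B : Fin 6) : SmCov := fun i => d.emb A * D i (d.emb B) - d.emb B * D i (d.emb A)

theorem symD_kf (A B : Fin 6) :
    symD ε a a γ (d.kf A B) = (d.emb A * d.tr B - d.emb B * d.tr A) • G ε a a γ := by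
  refine Matrix.ext fun i j => ?_
  have hA := d.hessian_emb i j A
  have hB := d.hessian_emb i j B
  have h : symD ε a a γ (d.kf A B) i j = d.emb A * (D i (D j (d.emb B))
      - ∑ k, Gam ε a a γ k i j * D k (d.emb B)) -
      d.emb B * (D i (D j (d.emb A)) - ∑ k, Gam ε a a γ k i j * D k (d.emb A)) := by
    simp only [symD, LinearMap.coe_mk, AddHom.coe_mk, Matrix.of_apply, kf, map_sub, D_mul,
      D_comm j i, Fin.sum_univ_four]
    linear_combination two_mul_C_half (d.emb A * D i (D j (d.emb B)) -
      d.emb B * D i (D j (d.emb A)))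
  rw [h, hA, hB, Matrix.smul_apply, smul_eq_mul]
  split_ifs <;> ring

theorem kf_mem_CK (A B : Fin 6) : d.kf A B ∈ CK ε a a γ :=
  (mem_CK ε a a γ).2 ⟨_, d.symD_kf A B⟩

theorem G_symm {ε a₁ a₂ γ : ℝ} (i j : Fin 4) : G ε a₁ a₂ γ i j = G ε a₁ a₂ γ j i := by
  fin_cases i <;> fin_cases j <;> rfl

theorem sp_eq (K K' : SmCov) (i j : Fin 4) :
    2 * sp K K' i j = K i * K' j + K j * K' i := by
  rw [sp_apply, two_mul_C_half]

/-- The fields are the 2 × 2 minors of the pair (E, dE), so this is the polarized Plücker identity.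
It uses no property of the embedding. -/
theorem plucker (A B A' B' : Fin 6) :
    sp (d.kf A B) (d.kf A' B') + sp (d.kf A A') (d.kf B' B) + sp (d.kf A B') (d.kf B A') = 0 := by
  refine Matrix.ext fun i j => ?_
  simp only [Matrix.add_apply, sp_apply, kf, Matrix.zero_apply]
  ring

/-- Expanding leaves E_A E_B times the pulled-back form, because E is null and hence orthogonal to
its derivatives. The trace-free part of the left side therefore vanishes. -/
theorem trace_relation (A B : Fin 6) :
    ∑ E, sp (d.kf A E) (d.kf B (dual E)) = (d.emb A * d.emb B) • G ε a a γ := by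
  have key : ∀ i j, ∑ E, d.kf A E i * d.kf B (dual E) j = d.emb A * d.emb B * G ε a a γ i j := by
    intro i j
    have h1 := d.sum_dEmb_mul i j
    have h2 := d.sum_emb_mul_dEmb i
    have h3 := d.sum_emb_mul_dEmb j
    have h4 := d.sum_emb_mul
    simp only [kf, Fin.sum_univ_six, dual] at h1 h2 h3 h4 ⊢
    simp at h1 h2 h3 h4 ⊢
    linear_combination d.emb A * d.emb B * h1 - d.emb A * D j (d.emb B) * h2
      - d.emb B * D i (d.emb A) * h3 + D i (d.emb A) * D j (d.emb B) * h4
  refine Matrix.ext fun i j => two_cancel ?_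
  simp only [Matrix.sum_apply, Matrix.smul_apply, smul_eq_mul, Finset.mul_sum, sp_eq,
    Finset.sum_add_distrib]
  rw [key, key, G_symm j i]
  ring

end ConeData

/-! ### Coefficients of polynomial identities in three variables -/

theorem sum_map_ite_of_nodup {α : Type*} [DecidableEq α] (L : List (α × ℝ))
    (hn : (L.map Prod.fst).Nodup) {m : α × ℝ} (hm : m ∈ L) :
    (L.map fun n => if n.1 = m.1 then n.2 else 0).sum = m.2 := by
  induction L with
  | nil => simp at hm
  | cons n L ih =>
    simp only [List.map_cons, List.nodup_cons, List.sum_cons] at hn ⊢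
    rcases List.mem_cons.1 hm with rfl | h
    · rw [if_pos rfl, add_eq_left]
      refine List.sum_eq_zero fun x hx => ?_
      obtain ⟨n, hnL, rfl⟩ := List.mem_map.1 hx
      exact if_neg fun h => hn.1 (List.mem_map.2 ⟨n, hnL, h⟩)
    · rw [ih hn.2 h, if_neg fun he => hn.1 (List.mem_map.2 ⟨m, h, he.symm⟩), zero_add]

/-- The exponent of a monomial in three variables. -/
def expo (m : ℕ × ℕ × ℕ) : Fin 3 →₀ ℕ := Finsupp.equivFunOnFinite.symm ![m.1, m.2.1, m.2.2]

theorem expo_injective : Function.Injective expo := by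
  rintro ⟨a, b, c⟩ ⟨a', b', c'⟩ h
  have h' := Finsupp.equivFunOnFinite.symm.injective h
  have h0 := congrFun h' 0
  have h1 := congrFun h' 1
  have h2 := congrFun h' 2
  simp at h0 h1 h2
  simp [h0, h1, h2]

theorem coeff_eq_zero (L : List ((ℕ × ℕ × ℕ) × ℝ)) (hn : (L.map Prod.fst).Nodup)
    (h : ∀ y z v : ℝ, (L.map fun m => m.2 * (y ^ m.1.1 * z ^ m.1.2.1 * v ^ m.1.2.2)).sum = 0) :
    ∀ m ∈ L, m.2 = 0 := by
  intro m hm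
  have hp : (L.map fun n => MvPolynomial.monomial (expo n.1) n.2).sum = 0 := by
    refine MvPolynomial.funext fun x => ?_
    rw [map_list_sum, List.map_map, map_zero, ← h (x 0) (x 1) (x 2)]
    congr 1
    refine List.map_congr_left fun n _ => ?_
    simp [MvPolynomial.eval_monomial, Finsupp.prod_fintype, Fin.prod_univ_three, expo]
  have hc := congrArg (MvPolynomial.lcoeff ℝ (expo m.1)) hp
  rw [map_list_sum, List.map_map, map_zero] at hc
  rw [← hc, ← sum_map_ite_of_nodup L hn hm]
  congr 1
  refine List.map_congr_left fun n _ => ?_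
  simp [MvPolynomial.lcoeff, MvPolynomial.coeff_monomial, expo_injective.eq_iff]

/-! ### The conformal Killing covectors on the hypersurface `x₁ = 0` -/

/-- The components of the fifteen conformal Killing covectors in a null frame. -/
def frame (y z v : ℝ) : Fin 4 → Fin 15 → ℝ :=
  ![![0, -v ^ 2, 0, 0, -v, 0, 0, y * v, z * v, 0, -v, -1, (y ^ 2 + z ^ 2) / 2, -y, -z],
    ![0, -(v * y), v, 0, -y, 1, 0, (y ^ 2 - z ^ 2) / 2, y * z, -z, 0, 0, 0, 0, 0],
    ![0, -(v * z), 0, v, -z, 0, 1, y * z, (z ^ 2 - y ^ 2) / 2, y, 0, 0, 0, 0, 0],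
    ![-1, (y ^ 2 + z ^ 2) / 2, -y, -z, 0, 0, 0, 0, 0, 0, 0, 0, 0, 0, 0]]

/-- The metric in the null frame. -/
def eta : Matrix (Fin 4) (Fin 4) ℝ := !![0, 0, 0, 1; 0, 1, 0, 0; 0, 0, 1, 0; 1, 0, 0, 0]

/-- The components of twice the symmetric products in the null frame. -/
def frameProd (y z v : ℝ) (a b : Fin 4) (p : Fin 15 × Fin 15) : ℝ :=
  frame y z v a p.1 * frame y z v b p.2 + frame y z v b p.1 * frame y z v a p.2

/-- A linear combination of symmetric products is pointwise proportional to the metric. -/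
def FrameRel (L : List (Fin 15 × Fin 15)) (g : Fin 15 → Fin 15 → ℝ) (F : ℝ → ℝ → ℝ → ℝ) : Prop :=
  ∀ y z v a b, (L.map fun p => g p.1 p.2 * frameProd y z v a b p).sum = F y z v * eta a b

theorem FrameRel.of_append {A B : List (Fin 15 × Fin 15)} {g : Fin 15 → Fin 15 → ℝ}
    {F : ℝ → ℝ → ℝ → ℝ} (h : FrameRel (A ++ B) g F) (hA : ∀ p ∈ A, g p.1 p.2 = 0) :
    FrameRel B g F := by
  intro y z v a b
  rw [← h, List.map_append, List.sum_append, right_eq_add]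
  refine List.sum_eq_zero fun x hx => ?_
  obtain ⟨p, hp, rfl⟩ := List.mem_map.1 hx
  rw [hA p hp, zero_mul]

/-- The independent pairs of weight two in the conformally flat case. -/
def pairs₂ : List (Fin 15 × Fin 15) :=
  [(0, 0), (0, 1), (0, 2), (0, 3), (1, 1), (1, 2), (1, 3), (2, 2), (2, 3)]

/-- The independent pairs of weight one. -/
def pairs₁ : List (Fin 15 × Fin 15) :=
  [(0, 4), (0, 5), (0, 6), (0, 7), (0, 8), (1, 4), (1, 5), (1, 6), (1, 7), (1, 8), (2, 5), (2, 6),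
    (2, 7), (2, 8), (2, 9), (3, 5), (3, 6), (3, 7), (3, 8), (3, 9)]

/-- The independent pairs of weight zero. -/
def pairs₀ : List (Fin 15 × Fin 15) :=
  [(0, 11), (0, 12), (0, 13), (0, 14), (1, 11), (1, 12), (1, 13), (1, 14), (2, 11), (2, 12),
    (2, 13), (2, 14), (3, 11), (3, 12), (3, 13), (3, 14), (4, 5), (4, 6), (4, 7), (4, 8), (5, 5),
    (5, 6), (5, 7), (5, 8), (7, 7), (7, 8)]

/-- The independent pairs of weight minus one. -/
def pairsNeg₁ : List (Fin 15 × Fin 15) :=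
  [(4, 11), (4, 12), (5, 11), (5, 12), (5, 13), (5, 14), (6, 11), (6, 12), (6, 13), (6, 14),
    (7, 11), (7, 12), (7, 13), (7, 14), (8, 11), (8, 12), (8, 13), (8, 14), (9, 13), (9, 14)]

/-- The independent pairs of weight minus two. -/
def pairsNeg₂ : List (Fin 15 × Fin 15) :=
  [(11, 11), (11, 12), (11, 13), (11, 14), (12, 12), (12, 13), (12, 14), (13, 13), (13, 14)]

section

variable {g : Fin 15 → Fin 15 → ℝ} {F : ℝ → ℝ → ℝ → ℝ}

/-- The weight of a pair counts occurrences of the ambient index 3 minus those of 2. Only members 0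
to 3 have a component along the last frame vector, so entry (3, 3), where `eta` vanishes, sees
weight two alone. The lower weights are then peeled off in order with `FrameRel.of_append`. -/
theorem FrameRel.pairs₂_eq_zero
    (h : FrameRel (pairs₂ ++ (pairs₁ ++ (pairs₀ ++ (pairsNeg₁ ++ pairsNeg₂)))) g F) :
    ∀ p ∈ pairs₂, g p.1 p.2 = 0 := by
  have e1 := coeff_eq_zero [((0, 0, 0), 2 * g 0 0), ((0, 1, 0), 2 * g 0 3), ((0, 2, 0), -g 0 1),
    ((0, 3, 0), -g 1 3), ((0, 4, 0), g 1 1 / 2), ((1, 0, 0), 2 * g 0 2), ((1, 1, 0), 2 * g 2 3),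
    ((1, 2, 0), -g 1 2), ((2, 0, 0), -g 0 1 + 2 * g 2 2), ((2, 1, 0), -g 1 3), ((2, 2, 0), g 1
    1), ((3, 0, 0), -g 1 2), ((4, 0, 0), g 1 1 / 2)] (by simp) fun y z v => by
    have h1 := h y z v 3 3
    simp [pairs₂, pairs₁, pairs₀, pairsNeg₁, pairsNeg₂, frameProd, frame, eta] at h1 ⊢
    linear_combination h1
  simp at e1
  simp [pairs₂]
  grind

theorem FrameRel.pairs₁_eq_zero
    (h : FrameRel (pairs₁ ++ (pairs₀ ++ (pairsNeg₁ ++ pairsNeg₂))) g F) :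
    ∀ p ∈ pairs₁, g p.1 p.2 = 0 := by
  have e1 := coeff_eq_zero [((0, 0, 0), -g 0 5), ((0, 1, 0), -g 3 5), ((0, 2, 0), g 0 7 / 2 + g
    1 5 / 2 + g 3 9), ((0, 3, 0), g 3 7 / 2), ((0, 4, 0), -g 1 7 / 4), ((1, 0, 0), g 0 4 - g 2
    5), ((1, 1, 0), -g 0 8 + g 2 9), ((1, 2, 0), -g 1 4 / 2 + g 2 7 / 2 - g 3 8), ((1, 3, 0), g
    1 8 / 2), ((2, 0, 0), -g 0 7 / 2 + g 1 5 / 2), ((2, 1, 0), -g 2 8 - g 3 7 / 2), ((3, 0, 0),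
    -g 1 4 / 2 - g 2 7 / 2), ((3, 1, 0), g 1 8 / 2), ((4, 0, 0), g 1 7 / 4)] (by simp) fun y z v
    => by
    have h1 := h y z v 3 1
    simp [pairs₁, pairs₀, pairsNeg₁, pairsNeg₂, frameProd, frame, eta] at h1 ⊢
    linear_combination h1
  have e2 := coeff_eq_zero [((0, 0, 0), -g 0 6), ((0, 1, 0), g 0 4 - g 3 6), ((0, 2, 0), -g 0 8
    / 2 + g 1 6 / 2), ((0, 3, 0), -g 1 4 / 2 - g 3 8 / 2), ((0, 4, 0), g 1 8 / 4), ((1, 0, 0),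
    -g 2 6), ((1, 1, 0), -g 0 7 - g 3 9), ((1, 2, 0), -g 2 8 / 2 - g 3 7), ((1, 3, 0), g 1 7 /
    2), ((2, 0, 0), g 0 8 / 2 + g 1 6 / 2 - g 2 9), ((2, 1, 0), -g 1 4 / 2 - g 2 7 + g 3 8 / 2),
    ((3, 0, 0), g 2 8 / 2), ((3, 1, 0), g 1 7 / 2), ((4, 0, 0), -g 1 8 / 4)] (by simp) fun y z v
    => by
    have h1 := h y z v 3 2
    simp [pairs₁, pairs₀, pairsNeg₁, pairsNeg₂, frameProd, frame, eta] at h1 ⊢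
    linear_combination h1
  -- `eta` has equal entries at (0, 3) and (1, 1), so their difference eliminates the unknown factor
  -- `F`.
  have e3 := coeff_eq_zero [((0, 0, 0), g 0 11 - 2 * g 5 5), ((0, 0, 1), g 0 4 - 2 * g 2 5),
    ((0, 1, 0), g 0 14 + g 3 11), ((0, 1, 1), -g 0 8 + 2 * g 2 9), ((0, 2, 0), -g 0 12 / 2 - g 1
    11 / 2 + g 3 14 + g 5 7), ((0, 2, 1), -g 1 4 / 2 + g 2 7 - g 3 8), ((0, 3, 0), -g 1 14 / 2 -
    g 3 12 / 2), ((0, 3, 1), g 1 8 / 2), ((0, 4, 0), g 1 12 / 4 - g 7 7 / 2), ((1, 0, 0), g 0 13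
    + g 2 11 + 2 * g 4 5), ((1, 0, 1), -g 0 7 + 2 * g 1 5), ((1, 1, 0), g 2 14 + g 3 13 - 2 * g
    5 8), ((1, 1, 1), -3 * g 2 8 - g 3 7), ((1, 2, 0), -g 1 13 / 2 - g 2 12 / 2 - g 4 7), ((1,
    2, 1), -g 1 7 / 2), ((1, 3, 0), g 7 8), ((2, 0, 0), -g 0 12 / 2 - g 1 11 / 2 + g 2 13 - g 5
    7), ((2, 0, 1), -5 * g 1 4 / 2 - 2 * g 2 7), ((2, 1, 0), -g 1 14 / 2 - g 3 12 / 2 + 2 * g 4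
    8), ((2, 1, 1), 5 * g 1 8 / 2), ((2, 2, 0), g 1 12 / 2 + g 7 7), ((3, 0, 0), -g 1 13 / 2 - g
    2 12 / 2 + g 4 7), ((3, 0, 1), 3 * g 1 7 / 2), ((3, 1, 0), -g 7 8), ((4, 0, 0), g 1 12 / 4 -
    g 7 7 / 2)] (by simp) fun y z v => by
    have h1 := h y z v 0 3
    have h2 := h y z v 1 1
    simp [pairs₁, pairs₀, pairsNeg₁, pairsNeg₂, frameProd, frame, eta] at h1 h2 ⊢
    linear_combination h1 - h2
  simp at e1 e2 e3
  simp [pairs₁]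
  grind

theorem FrameRel.pairs₀_eq_zero
    (h : FrameRel (pairs₀ ++ (pairsNeg₁ ++ pairsNeg₂)) g F) :
    ∀ p ∈ pairs₀, g p.1 p.2 = 0 := by
  have e1 := coeff_eq_zero [((0, 0, 0), g 5 6), ((0, 1, 0), -g 4 5), ((0, 2, 0), g 5 8 / 2),
    ((0, 3, 0), g 4 7 / 2), ((0, 4, 0), -g 7 8 / 4), ((1, 0, 0), -g 4 6), ((1, 1, 0), g 5 7),
    ((1, 2, 0), -3 * g 4 8 / 2), ((1, 3, 0), -g 7 7), ((2, 0, 0), -g 5 8 / 2), ((2, 1, 0), -3 *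
    g 4 7 / 2), ((2, 2, 0), 3 * g 7 8 / 2), ((3, 0, 0), g 4 8 / 2), ((3, 1, 0), g 7 7), ((4, 0,
    0), -g 7 8 / 4)] (by simp) fun y z v => by
    have h1 := h y z v 1 2
    simp [pairs₀, pairsNeg₁, pairsNeg₂, frameProd, frame, eta] at h1 ⊢
    linear_combination h1
  have e2 := coeff_eq_zero [((0, 0, 0), 2 * g 5 5), ((0, 1, 0), 2 * g 4 6), ((0, 2, 0), -g 5 7),
    ((0, 3, 0), g 4 8), ((0, 4, 0), g 7 7 / 2), ((1, 0, 0), -2 * g 4 5), ((1, 1, 0), 2 * g 5 8),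
    ((1, 2, 0), 3 * g 4 7), ((1, 3, 0), -2 * g 7 8), ((2, 0, 0), g 5 7), ((2, 1, 0), -3 * g 4
    8), ((2, 2, 0), -3 * g 7 7), ((3, 0, 0), -g 4 7), ((3, 1, 0), 2 * g 7 8), ((4, 0, 0), g 7 7
    / 2)] (by simp) fun y z v => by
    have h1 := h y z v 1 1
    have h2 := h y z v 2 2
    simp [pairs₀, pairsNeg₁, pairsNeg₂, frameProd, frame, eta] at h1 h2 ⊢
    linear_combination h1 - h2
  have e3 := coeff_eq_zero [((0, 0, 0), g 0 11 - 2 * g 5 5), ((0, 1, 0), g 0 14 + g 3 11), ((0,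
    2, 0), -g 0 12 / 2 - g 1 11 / 2 + g 3 14 + g 5 7), ((0, 3, 0), -g 1 14 / 2 - g 3 12 / 2),
    ((0, 4, 0), g 1 12 / 4 - g 7 7 / 2), ((1, 0, 0), g 0 13 + g 2 11 + 2 * g 4 5), ((1, 1, 0), g
    2 14 + g 3 13 - 2 * g 5 8), ((1, 2, 0), -g 1 13 / 2 - g 2 12 / 2 - g 4 7), ((1, 3, 0), g 7
    8), ((2, 0, 0), -g 0 12 / 2 - g 1 11 / 2 + g 2 13 - g 5 7), ((2, 1, 0), -g 1 14 / 2 - g 3 12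
    / 2 + 2 * g 4 8), ((2, 2, 0), g 1 12 / 2 + g 7 7), ((3, 0, 0), -g 1 13 / 2 - g 2 12 / 2 + g
    4 7), ((3, 1, 0), -g 7 8), ((4, 0, 0), g 1 12 / 4 - g 7 7 / 2)] (by simp) fun y z v => by
    have h1 := h y z v 0 3
    have h2 := h y z v 1 1
    simp [pairs₀, pairsNeg₁, pairsNeg₂, frameProd, frame, eta] at h1 h2 ⊢
    linear_combination h1 - h2
  have e4 := coeff_eq_zero [((0, 0, 0), -g 5 11), ((0, 0, 1), -g 2 11 - g 4 5), ((0, 1, 0), -g 5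
    14), ((0, 1, 1), -g 2 14 + g 5 8), ((0, 2, 0), g 5 12 / 2 + g 7 11 / 2 + g 9 14), ((0, 2,
    1), g 2 12 / 2 + g 4 7 / 2), ((0, 3, 0), g 7 14 / 2), ((0, 3, 1), -g 7 8 / 2), ((0, 4, 0),
    -g 7 12 / 4), ((1, 0, 0), g 4 11 - g 5 13), ((1, 0, 1), g 1 11 - g 2 13 + g 5 7), ((1, 1,
    0), -g 8 11 + g 9 13), ((1, 1, 1), g 1 14 - 2 * g 4 8), ((1, 2, 0), -g 4 12 / 2 + g 7 13 / 2
    - g 8 14), ((1, 2, 1), -g 1 12 / 2 - g 7 7), ((1, 3, 0), g 8 12 / 2), ((2, 0, 0), g 5 12 / 2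
    - g 7 11 / 2), ((2, 0, 1), g 1 13 + g 2 12 / 2 - 3 * g 4 7 / 2), ((2, 1, 0), -g 7 14 / 2 - g
    8 13), ((2, 1, 1), 3 * g 7 8 / 2), ((3, 0, 0), -g 4 12 / 2 - g 7 13 / 2), ((3, 0, 1), -g 1
    12 / 2 + g 7 7), ((3, 1, 0), g 8 12 / 2), ((4, 0, 0), g 7 12 / 4)] (by simp) fun y z v => by
    have h1 := h y z v 0 1
    simp [pairs₀, pairsNeg₁, pairsNeg₂, frameProd, frame, eta] at h1 ⊢
    linear_combination h1
  have e5 := coeff_eq_zero [((0, 0, 0), -g 6 11), ((0, 0, 1), -g 3 11 - g 4 6), ((0, 1, 0), g 4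
    11 - g 6 14), ((0, 1, 1), g 1 11 - g 3 14), ((0, 2, 0), g 6 12 / 2 - g 8 11 / 2), ((0, 2,
    1), g 1 14 + g 3 12 / 2 - 3 * g 4 8 / 2), ((0, 3, 0), -g 4 12 / 2 - g 8 14 / 2), ((0, 3, 1),
    -g 1 12 / 2), ((0, 4, 0), g 8 12 / 4), ((1, 0, 0), -g 6 13), ((1, 0, 1), -g 3 13), ((1, 1,
    0), -g 7 11 - g 9 14), ((1, 1, 1), g 1 13 - 2 * g 4 7), ((1, 2, 0), -g 7 14 - g 8 13 / 2),
    ((1, 2, 1), 3 * g 7 8 / 2), ((1, 3, 0), g 7 12 / 2), ((2, 0, 0), g 6 12 / 2 + g 8 11 / 2 - g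
    9 13), ((2, 0, 1), g 3 12 / 2 + g 4 8 / 2), ((2, 1, 0), -g 4 12 / 2 - g 7 13 + g 8 14 / 2),
    ((2, 1, 1), -g 1 12 / 2 + 2 * g 7 7), ((3, 0, 0), g 8 13 / 2), ((3, 0, 1), -g 7 8 / 2), ((3,
    1, 0), g 7 12 / 2), ((4, 0, 0), -g 8 12 / 4)] (by simp) fun y z v => by
    have h1 := h y z v 0 2
    simp [pairs₀, pairsNeg₁, pairsNeg₂, frameProd, frame, eta] at h1 ⊢
    linear_combination h1
  have e6 := coeff_eq_zero [((0, 0, 0), 2 * g 11 11), ((0, 0, 1), 2 * g 4 11), ((0, 0, 2), 2 * g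
    1 11), ((0, 1, 0), 2 * g 11 14), ((0, 1, 1), -2 * g 8 11), ((0, 1, 2), 2 * g 1 14 - 2 * g 4
    8), ((0, 2, 0), -g 11 12), ((0, 2, 1), -g 4 12 - 2 * g 8 14), ((0, 2, 2), -g 1 12), ((0, 3,
    0), -g 12 14), ((0, 3, 1), g 8 12), ((0, 4, 0), g 12 12 / 2), ((1, 0, 0), 2 * g 11 13), ((1,
    0, 1), -2 * g 7 11), ((1, 0, 2), 2 * g 1 13 - 2 * g 4 7), ((1, 1, 0), 2 * g 13 14), ((1, 1,
    1), -2 * g 7 14 - 2 * g 8 13), ((1, 1, 2), 2 * g 7 8), ((1, 2, 0), -g 12 13), ((1, 2, 1), g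
    7 12), ((2, 0, 0), -g 11 12 + 2 * g 13 13), ((2, 0, 1), -g 4 12 - 2 * g 7 13), ((2, 0, 2),
    -g 1 12 + 2 * g 7 7), ((2, 1, 0), -g 12 14), ((2, 1, 1), g 8 12), ((2, 2, 0), g 12 12), ((3,
    0, 0), -g 12 13), ((3, 0, 1), g 7 12), ((4, 0, 0), g 12 12 / 2)] (by simp) fun y z v => by
    have h1 := h y z v 0 0
    simp [pairs₀, pairsNeg₁, pairsNeg₂, frameProd, frame, eta] at h1 ⊢
    linear_combination h1
  simp at e1 e2 e3 e4 e5 e6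
  simp [pairs₀]
  grind

theorem FrameRel.pairsNeg₁_eq_zero
    (h : FrameRel (pairsNeg₁ ++ pairsNeg₂) g F) :
    ∀ p ∈ pairsNeg₁, g p.1 p.2 = 0 := by
  have e1 := coeff_eq_zero [((0, 0, 0), -g 5 11), ((0, 1, 0), -g 5 14), ((0, 2, 0), g 5 12 / 2 +
    g 7 11 / 2 + g 9 14), ((0, 3, 0), g 7 14 / 2), ((0, 4, 0), -g 7 12 / 4), ((1, 0, 0), g 4 11
    - g 5 13), ((1, 1, 0), -g 8 11 + g 9 13), ((1, 2, 0), -g 4 12 / 2 + g 7 13 / 2 - g 8 14),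
    ((1, 3, 0), g 8 12 / 2), ((2, 0, 0), g 5 12 / 2 - g 7 11 / 2), ((2, 1, 0), -g 7 14 / 2 - g 8
    13), ((3, 0, 0), -g 4 12 / 2 - g 7 13 / 2), ((3, 1, 0), g 8 12 / 2), ((4, 0, 0), g 7 12 /
    4)] (by simp) fun y z v => by
    have h1 := h y z v 0 1
    simp [pairsNeg₁, pairsNeg₂, frameProd, frame, eta] at h1 ⊢
    linear_combination h1
  have e2 := coeff_eq_zero [((0, 0, 0), -g 6 11), ((0, 1, 0), g 4 11 - g 6 14), ((0, 2, 0), g 6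
    12 / 2 - g 8 11 / 2), ((0, 3, 0), -g 4 12 / 2 - g 8 14 / 2), ((0, 4, 0), g 8 12 / 4), ((1,
    0, 0), -g 6 13), ((1, 1, 0), -g 7 11 - g 9 14), ((1, 2, 0), -g 7 14 - g 8 13 / 2), ((1, 3,
    0), g 7 12 / 2), ((2, 0, 0), g 6 12 / 2 + g 8 11 / 2 - g 9 13), ((2, 1, 0), -g 4 12 / 2 - g
    7 13 + g 8 14 / 2), ((3, 0, 0), g 8 13 / 2), ((3, 1, 0), g 7 12 / 2), ((4, 0, 0), -g 8 12 /
    4)] (by simp) fun y z v => by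
    have h1 := h y z v 0 2
    simp [pairsNeg₁, pairsNeg₂, frameProd, frame, eta] at h1 ⊢
    linear_combination h1
  have e3 := coeff_eq_zero [((0, 0, 0), 2 * g 11 11), ((0, 0, 1), 2 * g 4 11), ((0, 1, 0), 2 * g
    11 14), ((0, 1, 1), -2 * g 8 11), ((0, 2, 0), -g 11 12), ((0, 2, 1), -g 4 12 - 2 * g 8 14),
    ((0, 3, 0), -g 12 14), ((0, 3, 1), g 8 12), ((0, 4, 0), g 12 12 / 2), ((1, 0, 0), 2 * g 11
    13), ((1, 0, 1), -2 * g 7 11), ((1, 1, 0), 2 * g 13 14), ((1, 1, 1), -2 * g 7 14 - 2 * g 8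
    13), ((1, 2, 0), -g 12 13), ((1, 2, 1), g 7 12), ((2, 0, 0), -g 11 12 + 2 * g 13 13), ((2,
    0, 1), -g 4 12 - 2 * g 7 13), ((2, 1, 0), -g 12 14), ((2, 1, 1), g 8 12), ((2, 2, 0), g 12
    12), ((3, 0, 0), -g 12 13), ((3, 0, 1), g 7 12), ((4, 0, 0), g 12 12 / 2)] (by simp) fun y z
    v => by
    have h1 := h y z v 0 0
    simp [pairsNeg₁, pairsNeg₂, frameProd, frame, eta] at h1 ⊢
    linear_combination h1
  simp at e1 e2 e3
  simp [pairsNeg₁]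
  grind

theorem FrameRel.pairsNeg₂_eq_zero
    (h : FrameRel (pairsNeg₂) g F) :
    ∀ p ∈ pairsNeg₂, g p.1 p.2 = 0 := by
  have e1 := coeff_eq_zero [((0, 0, 0), 2 * g 11 11), ((0, 1, 0), 2 * g 11 14), ((0, 2, 0), -g
    11 12), ((0, 3, 0), -g 12 14), ((0, 4, 0), g 12 12 / 2), ((1, 0, 0), 2 * g 11 13), ((1, 1,
    0), 2 * g 13 14), ((1, 2, 0), -g 12 13), ((2, 0, 0), -g 11 12 + 2 * g 13 13), ((2, 1, 0), -g
    12 14), ((2, 2, 0), g 12 12), ((3, 0, 0), -g 12 13), ((4, 0, 0), g 12 12 / 2)] (by simp) fun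
    y z v => by
    have h1 := h y z v 0 0
    simp [pairsNeg₂, frameProd, frame, eta] at h1 ⊢
    linear_combination h1
  simp at e1
  simp [pairsNeg₂]
  grind

end

/-! ### The fifteen light cone fields in a null frame. -/

/-- The index pairs of the fifteen conformal Killing covectors. -/
def coneIdx : Fin 15 → Fin 6 × Fin 6 :=
  ![(3, 0), (3, 1), (3, 4), (3, 5), (0, 1), (0, 4), (0, 5), (1, 4), (1, 5), (4, 5), (2, 3), (2, 0),
    (2, 1), (2, 4), (2, 5)]

/-- A null frame along the hypersurface `x₁ = 0`. -/
def frameVec (ε a γ y z v : ℝ) : Fin 4 → Fin 4 → ℝ :=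
  ![tvec γ y z (ε * v - a * (y ^ 2 + z ^ 2) / 2), bvec 1, bvec 2, bvec 3]

/-- Here the transversal vector is normalized to be null, so that `eta` is constant and the
identities become polynomial with parameter-free coefficients. -/
theorem gForm_frameVec (ε a γ y z v : ℝ) (i j : Fin 4) :
    gForm ε a a γ (slice y z v) (frameVec ε a γ y z v i) (frameVec ε a γ y z v j) = eta i j := by
  have hsymm : ∀ x p q, gForm ε a a γ x p q = gForm ε a a γ x q p := by
    intro x p q
    rw [gForm, Finset.sum_comm]
    refine Finset.sum_congr rfl fun i _ => Finset.sum_congr rfl fun j _ => ?_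
    rw [ConeData.G_symm]
    ring
  fin_cases i <;> fin_cases j <;> simp [frameVec, eta, gForm_bvec, gForm_tvec_bvec, gForm_tvec_tvec,
    hsymm _ (bvec _) (tvec _ _ _ _), G]
  ring

namespace ConeData

variable {ε a γ : ℝ} (d : ConeData ε a γ)

/-- The fifteen conformal Killing covectors. -/
def fam (i : Fin 15) : SmCov := d.kf (coneIdx i).1 (coneIdx i).2

theorem emb_slice (y z v : ℝ) (A : Fin 6) :
    ev (slice y z v) (d.emb A) = ![1, -((y ^ 2 + z ^ 2) / 2), 0, v, y, z] A := by
  obtain ⟨h1, h2, h3, h4, h5, h6, h7⟩ := d.init (slice y z v) rfl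
  fin_cases A <;> simp [emb, h1, h2, h3, h4, h5, h6, h7]
  ring

theorem sum_dEmb_slice (y z v : ℝ) (b : Fin 4) (A : Fin 6) :
    ∑ i, frameVec ε a γ y z v b i * ev (slice y z v) (D i (d.emb A)) =
      (![![0, -v, 1, 0, 0, 0], ![0, -y, 0, 0, 1, 0], ![0, -z, 0, 0, 0, 1], ![0, 0, 0, 1, 0, 0]] :
        Fin 4 → Fin 6 → ℝ) b A := by
  obtain ⟨h1, h2, h3, h4, h5, h6, h7⟩ := d.init (slice y z v) rfl
  simp only [D_emb]
  fin_cases b <;> fin_cases A <;> simp [frameVec, tvec, bvec, Pi.single_apply, Fin.sum_univ_four,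
    dEmb, h1, h2, h3, h4, h5, h6, h7] <;> ring

theorem pair_fam (y z v : ℝ) (b : Fin 4) (i : Fin 15) :
    pair (slice y z v) (d.fam i) (frameVec ε a γ y z v b) = frame y z v b i := by
  have h : ∀ A B, pair (slice y z v) (d.kf A B) (frameVec ε a γ y z v b) =
      ev (slice y z v) (d.emb A) *
        ∑ i, frameVec ε a γ y z v b i * ev (slice y z v) (D i (d.emb B)) -
      ev (slice y z v) (d.emb B) *
        ∑ i, frameVec ε a γ y z v b i * ev (slice y z v) (D i (d.emb A)) := by
    intro A B
    simp only [pair, kf, map_sub, map_mul, Fin.sum_univ_four]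
    ring
  rw [fam, h, sum_dEmb_slice, sum_dEmb_slice, emb_slice, emb_slice]
  fin_cases b <;> fin_cases i <;> simp [coneIdx, frame] <;> ring

set_option maxHeartbeats 1000000 in
theorem fam_linearIndependent : LinearIndependent ℝ d.fam := by
  rw [Fintype.linearIndependent_iff]
  intro g hg
  have key : ∀ y z v b, ∑ i, g i * frame y z v b i = 0 := by
    intro y z v b
    have h1 : ∀ c, ∑ i, g i * ev (slice y z v) (d.fam i c) = 0 := fun c => by
      simpa using congrArg (ev (slice y z v)) (congrFun hg c)
    simp only [← d.pair_fam, pair, Finset.mul_sum]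
    rw [Finset.sum_comm]
    refine Finset.sum_eq_zero fun c _ => ?_
    rw [← mul_zero (frameVec ε a γ y z v b c), ← h1 c, Finset.mul_sum]
    exact Finset.sum_congr rfl fun i _ => by ring
  have e0 := coeff_eq_zero [((0, 0, 0), -g 11), ((0, 0, 1), -g 4 - g 10), ((0, 0, 2), -g 1),
    ((1, 0, 1), g 7), ((0, 1, 1), g 8), ((2, 0, 0), g 12 / 2), ((0, 2, 0), g 12 / 2),
    ((1, 0, 0), -g 13), ((0, 1, 0), -g 14)] (by simp) fun y z v => by
    have h := key y z v 0
    simp [Fin.sum_univ_succ, frame] at h ⊢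
    linear_combination h
  have e1 := coeff_eq_zero [((0, 0, 0), g 5), ((1, 0, 0), -g 4), ((0, 1, 0), -g 9),
    ((1, 0, 1), -g 1), ((0, 0, 1), g 2), ((2, 0, 0), g 7 / 2), ((0, 2, 0), -g 7 / 2),
    ((1, 1, 0), g 8)] (by simp) fun y z v => by
    have h := key y z v 1
    simp [Fin.sum_univ_succ, frame] at h ⊢
    linear_combination h
  have e2 := key 0 0 0 2
  have e2' := key 0 0 1 2
  have e3 := key 0 0 0 3
  simp at e0 e1
  simp [Fin.sum_univ_succ, frame] at e2 e2' e3
  have all : ∀ i : Fin 15, g i = 0 := by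
    simp [Fin.forall_fin_succ]
    grind
  exact all

end ConeData

/-! ### Plücker and trace relations, and the dimension 84. -/

/-- The number of the covector field `± k_{AB}` in the family. -/
def coneNum : Fin 6 → Fin 6 → Fin 15 :=
  ![![0, 4, 11, 0, 5, 6], ![4, 0, 12, 1, 7, 8], ![11, 12, 0, 10, 13, 14], ![0, 1, 10, 0, 2, 3],
    ![5, 7, 13, 2, 0, 9], ![6, 8, 14, 3, 9, 0]]

/-- The sign of the covector field `± k_{AB}` in the family. -/
def coneSign : Fin 6 → Fin 6 → ℝ :=
  ![![0, 1, -1, -1, 1, 1], ![-1, 0, -1, -1, 1, 1], ![1, 1, 0, 1, 1, 1], ![1, 1, -1, 0, 1, 1],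
    ![-1, -1, -1, -1, 0, 1], ![-1, -1, -1, -1, -1, 0]]

theorem ConeData.kf_eq {ε a γ : ℝ} (d : ConeData ε a γ) (A B : Fin 6) :
    d.kf A B = coneSign A B • d.fam (coneNum A B) := by
  have hs : ∀ A B, d.kf A B = -d.kf B A := fun A B => by
    ext i : 1
    simp [kf]
  have h0 : ∀ A, d.kf A A = 0 := fun A => by
    ext i : 1
    simp [kf]
  fin_cases A <;> fin_cases B <;> simp [coneSign, coneNum, h0, fam, coneIdx] <;> exact hs _ _

/-- The pairs that are redundant because of the quadratic relations in the conformally flat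
case. -/
def redundantPairs : List (Fin 15 × Fin 15) :=
  [(3, 3), (2, 4), (3, 4), (0, 9), (1, 9), (0, 10), (1, 10), (2, 10), (3, 10), (4, 4), (4, 9),
    (4, 10), (5, 9), (5, 10), (6, 6), (6, 7), (6, 8), (6, 9), (6, 10), (7, 9), (7, 10), (8, 8),
    (8, 9), (8, 10), (9, 9), (9, 10), (10, 10), (4, 13), (4, 14), (9, 11), (9, 12), (10, 11),
    (10, 12), (10, 13), (10, 14), (14, 14)]

/-- The independent pairs in the conformally flat case. -/
def conePairs : List (Fin 15 × Fin 15) := pairs₂ ++ (pairs₁ ++ (pairs₀ ++ (pairsNeg₁ ++ pairsNeg₂)))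

theorem mem_conePairs_or : ∀ i j : Fin 15, i ≤ j →
    (i, j) ∈ conePairs ∨ (i, j) ∈ redundantPairs := by
  decide

section

variable {r : Fin 15 → Fin 15 → ℝ}

/-- The 15 Plücker relations and the 21 trace relations form a linear system that determines the 36
redundant values from the 84 independent ones. -/
theorem redundantPairs_eq_zero (hr : ∀ i j, r i j = r j i) (hz : ∀ p ∈ conePairs, r p.1 p.2 = 0)
    (hP : ∀ A B A' B', coneSign A B * coneSign A' B' * r (coneNum A B) (coneNum A' B')
      + coneSign A A' * coneSign B' B * r (coneNum A A') (coneNum B' B)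
      + coneSign A B' * coneSign B A' * r (coneNum A B') (coneNum B A') = 0)
    (hT : ∀ A B, ∑ E, coneSign A E * coneSign B (ConeData.dual E) *
      r (coneNum A E) (coneNum B (ConeData.dual E)) = 0) : ∀ p ∈ redundantPairs, r p.1 p.2 = 0 := by
  have hz₂ : ∀ p ∈ conePairs, r p.2 p.1 = 0 := fun p hp => (hr _ _).trans (hz p hp)
  have hr₂ : ∀ p ∈ redundantPairs, r p.2 p.1 = r p.1 p.2 := fun p _ => hr _ _
  simp only [conePairs, redundantPairs, pairs₂, pairs₁, pairs₀, pairsNeg₁, pairsNeg₂,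
    List.cons_append, List.nil_append, List.forall_mem_cons] at hz hz₂ hr₂
  have p0 := hP 0 1 2 3
  have p1 := hP 0 1 2 4
  have p2 := hP 0 1 2 5
  have p3 := hP 0 1 3 4
  have p4 := hP 0 1 3 5
  have p5 := hP 0 1 4 5
  have p6 := hP 0 2 3 4
  have p7 := hP 0 2 3 5
  have p8 := hP 0 2 4 5
  have p9 := hP 0 3 4 5
  have p10 := hP 1 2 3 4
  have p11 := hP 1 2 3 5
  have p12 := hP 1 2 4 5
  have p13 := hP 1 3 4 5
  have p14 := hP 2 3 4 5
  have t0 := hT 0 0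
  have t1 := hT 0 1
  have t2 := hT 0 2
  have t3 := hT 0 3
  have t4 := hT 0 4
  have t5 := hT 0 5
  have t6 := hT 1 1
  have t7 := hT 1 2
  have t8 := hT 1 3
  have t9 := hT 1 4
  have t10 := hT 1 5
  have t11 := hT 2 2
  have t12 := hT 2 3
  have t13 := hT 2 4
  have t14 := hT 2 5
  have t15 := hT 3 3
  have t16 := hT 3 4
  have t17 := hT 3 5
  have t18 := hT 4 4
  have t19 := hT 4 5
  have t20 := hT 5 5
  simp [coneSign, coneNum] at p0 p1 p2 p3 p4 p5 p6 p7 p8 p9 p10 p11 p12 p13 p14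
  simp only [hz, hz₂, hr₂] at p0 p1 p2 p3 p4 p5 p6 p7 p8 p9 p10 p11 p12 p13 p14
  simp [coneSign, coneNum, Fin.sum_univ_six, ConeData.dual] at t0 t1 t2 t3 t4 t5 t6 t7 t8 t9 t10 t11 t12 t13 t14 t15 t16 t17 t18 t19 t20
  simp only [hz, hz₂, hr₂] at t0 t1 t2 t3 t4 t5 t6 t7 t8 t9 t10 t11 t12 t13 t14 t15 t16 t17 t18 t19 t20
  clear hr hz hz₂ hr₂ hP hT
  simp only [redundantPairs, List.forall_mem_cons, List.not_mem_nil, false_imp_iff, implies_true, and_true]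
  refine ⟨?_, ?_, ?_, ?_, ?_, ?_, ?_, ?_, ?_, ?_, ?_, ?_, ?_, ?_, ?_, ?_, ?_, ?_, ?_, ?_, ?_, ?_,
    ?_, ?_, ?_, ?_, ?_, ?_, ?_, ?_, ?_, ?_, ?_, ?_, ?_, ?_⟩ <;> linarith

end

theorem sum_of_supportedOn {ι : Type*} [Fintype ι] [DecidableEq ι] {L : List (ι × ι)} (hn : L.Nodup)
    {g : ι → ι → ℝ} (hg : SupportedOn L.toFinset g) (Φ : ι → ι → ℝ) :
    ∑ i, ∑ j, g i j * Φ i j = (L.map fun p => g p.1 p.2 * Φ p.1 p.2).sum := by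
  rw [← Fintype.sum_prod_type' (f := fun i j => g i j * Φ i j), ← List.sum_toFinset _ hn]
  symm
  refine Finset.sum_subset (Finset.subset_univ _) fun p _ hp => ?_
  rw [hg p.1 p.2 hp, zero_mul]

/-- Testing against functionals turns elimination among tensors into a scalar linear system. -/
theorem mem_of_forall_dual {E : Type*} [AddCommGroup E] [Module ℝ E] {W : Submodule ℝ E} {x : E}
    (h : ∀ φ : E →ₗ[ℝ] ℝ, (∀ y ∈ W, φ y = 0) → φ x = 0) : x ∈ W := by
  by_contra hx
  obtain ⟨φ, hφ, hW⟩ := W.exists_le_ker_of_notMem hx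
  exact hφ (h φ fun y hy => hW hy)

namespace ConeData

variable {ε a γ : ℝ} (d : ConeData ε a γ)

theorem frameRel {L : List (Fin 15 × Fin 15)} (hn : L.Nodup) {g : Fin 15 → Fin 15 → ℝ}
    (hg : SupportedOn L.toFinset g) {f : Sm}
    (hf : ∑ i, ∑ j, g i j • prods d.fam (i, j) = f • G ε a a γ) :
    FrameRel L g fun y z v => 2 * ev (slice y z v) f := by
  intro y z v b c
  have h := pairing_sum_prods hf (slice y z v) (frameVec ε a γ y z v b) (frameVec ε a γ y z v c)
  rw [gForm_frameVec] at h
  simp only [d.pair_fam, add_mul, Finset.sum_add_distrib] at h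
  rw [← h, ← sum_of_supportedOn hn hg fun i j => frameProd y z v b c (i, j)]
  simp only [frameProd, mul_add, Finset.sum_add_distrib]
  congr 1
  rw [Finset.sum_comm]
  exact Finset.sum_congr rfl fun i _ => Finset.sum_congr rfl fun j _ => by ring

theorem plucker_fam {E : Type*} [AddCommGroup E] [Module ℝ E] (φ : SmTensor →ₗ[ℝ] E)
    (A B A' B' : Fin 6) :
    (coneSign A B * coneSign A' B') • φ (prods d.fam (coneNum A B, coneNum A' B'))
      + (coneSign A A' * coneSign B' B) • φ (prods d.fam (coneNum A A', coneNum B' B))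
      + (coneSign A B' * coneSign B A') • φ (prods d.fam (coneNum A B', coneNum B A')) = 0 := by
  have h := congrArg φ (d.plucker A B A' B')
  simpa only [kf_eq, map_smul, LinearMap.smul_apply, map_add, map_zero, smul_smul, prods, mul_comm]
    using h

end ConeData

/-- Of the 120 products, 36 are removed by the quadratic relations, and the weight filtration shows
that the rest are independent modulo the metric. -/
theorem finrank_redCK_of_eq {ε a γ : ℝ} : Module.finrank ℝ (redCK ε a a γ) = 84 := by
  obtain ⟨d⟩ := nonempty_coneData ε a γ
  have hV := span_eq_image (V := CK ε a a γ) flatJet flatJet_injective d.fam_linearIndependent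
    (m := id) Function.injective_id (fun i => d.kf_mem_CK _ _)
  have hn : conePairs.Nodup := by decide
  set w : Fin 15 × Fin 15 → SmTensor := fun p => trFree ε a a γ (prods d.fam p) with hwdef
  have hw : ∀ i j, w (i, j) = w (j, i) := fun i j => by
    simp only [hwdef, prods_comm _ i j]
  rw [redCK_eq hV, Submodule.map_span, Set.image_image,
    span_image_pairs (S := conePairs.toFinset) hw]
  · rw [finrank_span_pairs]
    · decide
    · intro g hg hsum
      have h0 : trFree ε a a γ (∑ i, ∑ j, g i j • prods d.fam (i, j)) = 0 := by
        simpa [hwdef] using hsum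
      obtain ⟨f, hf⟩ := (trFree_eq_zero_iff ε a a γ _).1 h0
      have r₂ := d.frameRel hn hg hf
      have r₁ := r₂.of_append r₂.pairs₂_eq_zero
      have r₀ := r₁.of_append r₁.pairs₁_eq_zero
      have rn₁ := r₀.of_append r₀.pairs₀_eq_zero
      have rn₂ := rn₁.of_append rn₁.pairsNeg₁_eq_zero
      intro i j
      by_cases hij : (i, j) ∈ conePairs
      · simp only [conePairs, List.mem_append] at hij
        rcases hij with h | h | h | h | h
        exacts [r₂.pairs₂_eq_zero _ h, r₁.pairs₁_eq_zero _ h, r₀.pairs₀_eq_zero _ h,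
          rn₁.pairsNeg₁_eq_zero _ h, rn₂.pairsNeg₂_eq_zero _ h]
      · exact hg i j (by simpa using hij)
  · simp
  · intro i _ j _ hij hS
    refine mem_of_forall_dual fun φ hφ => ?_
    refine redundantPairs_eq_zero (r := fun i j => φ (w (i, j))) (fun i j => congrArg φ (hw i j))
      (fun p hp => hφ _ (Submodule.subset_span ⟨p, by simpa using hp, rfl⟩))
      (fun A B A' B' => by simpa using d.plucker_fam (φ ∘ₗ trFree ε a a γ) A B A' B')
      (fun A B => ?_) (i, j)
      ((mem_conePairs_or i j hij).resolve_left fun h => hS (by simpa using h))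
    have h := congrArg (φ ∘ₗ trFree ε a a γ) (d.trace_relation A B)
    rw [LinearMap.comp_apply _ _ ((d.emb A * d.emb B) • G ε a a γ), trFree_smul_G, map_zero,
      map_sum] at h
    rw [← h]
    refine Finset.sum_congr rfl fun E _ => ?_
    simp only [d.kf_eq, map_smul, LinearMap.smul_apply, LinearMap.comp_apply, hwdef, prods,
      smul_eq_mul]
    ring

/-! ### The flat case. -/

/-- The independent pairs in the flat case. -/
def flatPairs : List (Fin 15 × Fin 15) :=
  [(0, 0), (0, 2), (0, 3), (0, 5), (0, 6), (0, 10), (0, 11), (0, 13), (0, 14), (2, 2), (2, 3),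
    (2, 5), (2, 6), (2, 9), (2, 10), (2, 11), (2, 13), (2, 14), (3, 3), (3, 5), (3, 6), (3, 9),
    (3, 10), (3, 11), (3, 13), (3, 14), (5, 5), (5, 6), (5, 9), (5, 11), (5, 13), (5, 14), (6,
    6), (6, 9), (6, 11), (6, 13), (6, 14), (9, 9), (9, 13), (9, 14), (10, 10), (10, 11), (10,
    13), (10, 14), (11, 11), (11, 13), (11, 14), (13, 13), (13, 14), (14, 14)]

/-- The numbers of the Killing covectors in the flat case. -/
def flatIdx : Fin 10 → Fin 15 := ![0, 2, 3, 5, 6, 9, 10, 11, 13, 14]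

theorem FrameRel.flatPairs_eq_zero {g : Fin 15 → Fin 15 → ℝ} (h : FrameRel flatPairs g 0) :
    ∀ p ∈ flatPairs, g p.1 p.2 = 0 := by
  have e1 := coeff_eq_zero [((0, 0, 0), 2 * g 0 0), ((0, 1, 0), 2 * g 0 3), ((0, 2, 0), 2 * g 3
    3), ((1, 0, 0), 2 * g 0 2), ((1, 1, 0), 2 * g 2 3), ((2, 0, 0), 2 * g 2 2)] (by simp) fun y
    z v => by
    have h1 := h y z v 3 3
    simp [flatPairs, frameProd, frame] at h1 ⊢
    linear_combination h1
  have e2 := coeff_eq_zero [((0, 0, 0), -g 0 5), ((0, 0, 1), -g 0 2), ((0, 1, 0), -g 3 5), ((0,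
    1, 1), -g 2 3), ((0, 2, 0), g 3 9), ((1, 0, 0), -g 2 5), ((1, 0, 1), -2 * g 2 2), ((1, 1,
    0), g 2 9)] (by simp) fun y z v => by
    have h1 := h y z v 3 1
    simp [flatPairs, frameProd, frame] at h1 ⊢
    linear_combination h1
  have e3 := coeff_eq_zero [((0, 0, 0), -g 0 6), ((0, 0, 1), -g 0 3), ((0, 1, 0), -g 3 6), ((0,
    1, 1), -2 * g 3 3), ((1, 0, 0), -g 2 6), ((1, 0, 1), -g 2 3), ((1, 1, 0), -g 3 9), ((2, 0,
    0), -g 2 9)] (by simp) fun y z v => by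
    have h1 := h y z v 3 2
    simp [flatPairs, frameProd, frame] at h1 ⊢
    linear_combination h1
  have e4 := coeff_eq_zero [((0, 0, 0), g 5 6), ((0, 0, 1), g 2 6 + g 3 5), ((0, 0, 2), g 2 3),
    ((0, 1, 0), -g 6 9), ((0, 1, 1), -g 3 9), ((1, 0, 0), g 5 9), ((1, 0, 1), g 2 9), ((1, 1,
    0), -2 * g 9 9)] (by simp) fun y z v => by
    have h1 := h y z v 1 2
    simp [flatPairs, frameProd, frame] at h1 ⊢
    linear_combination h1
  have e5 := coeff_eq_zero [((0, 0, 0), 2 * g 5 5), ((0, 0, 1), 2 * g 2 5), ((0, 0, 2), 2 * g 2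
    2), ((0, 1, 0), -2 * g 5 9), ((0, 1, 1), -2 * g 2 9), ((0, 2, 0), 2 * g 9 9)] (by simp) fun
    y z v => by
    have h1 := h y z v 1 1
    simp [flatPairs, frameProd, frame] at h1 ⊢
    linear_combination h1
  have e6 := coeff_eq_zero [((0, 0, 0), 2 * g 6 6), ((0, 0, 1), 2 * g 3 6), ((0, 0, 2), 2 * g 3
    3), ((1, 0, 0), 2 * g 6 9), ((1, 0, 1), 2 * g 3 9), ((2, 0, 0), 2 * g 9 9)] (by simp) fun y
    z v => by
    have h1 := h y z v 2 2
    simp [flatPairs, frameProd, frame] at h1 ⊢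
    linear_combination h1
  have e7 := coeff_eq_zero [((0, 0, 0), g 0 11), ((0, 0, 1), g 0 10), ((0, 1, 0), g 0 14 + g 3
    11), ((0, 1, 1), g 3 10), ((0, 2, 0), g 3 14), ((1, 0, 0), g 0 13 + g 2 11), ((1, 0, 1), g 2
    10), ((1, 1, 0), g 2 14 + g 3 13), ((2, 0, 0), g 2 13)] (by simp) fun y z v => by
    have h1 := h y z v 0 3
    simp [flatPairs, frameProd, frame] at h1 ⊢
    linear_combination h1
  have e8 := coeff_eq_zero [((0, 0, 0), -g 5 11), ((0, 0, 1), -g 2 11), ((0, 0, 2), -g 2 10),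
    ((0, 1, 0), -g 5 14), ((0, 1, 1), -g 2 14), ((0, 2, 0), g 9 14), ((1, 0, 0), -g 5 13), ((1,
    0, 1), -g 2 13), ((1, 1, 0), g 9 13)] (by simp) fun y z v => by
    have h1 := h y z v 0 1
    simp [flatPairs, frameProd, frame] at h1 ⊢
    linear_combination h1
  have e9 := coeff_eq_zero [((0, 0, 0), -g 6 11), ((0, 0, 1), -g 3 11), ((0, 0, 2), -g 3 10),
    ((0, 1, 0), -g 6 14), ((0, 1, 1), -g 3 14), ((1, 0, 0), -g 6 13), ((1, 0, 1), -g 3 13), ((1,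
    1, 0), -g 9 14), ((2, 0, 0), -g 9 13)] (by simp) fun y z v => by
    have h1 := h y z v 0 2
    simp [flatPairs, frameProd, frame] at h1 ⊢
    linear_combination h1
  have e10 := coeff_eq_zero [((0, 0, 0), 2 * g 11 11), ((0, 0, 1), 2 * g 10 11), ((0, 0, 2), 2 *
    g 10 10), ((0, 1, 0), 2 * g 11 14), ((0, 1, 1), 2 * g 10 14), ((0, 2, 0), 2 * g 14 14), ((1,
    0, 0), 2 * g 11 13), ((1, 0, 1), 2 * g 10 13), ((1, 1, 0), 2 * g 13 14), ((2, 0, 0), 2 * g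
    13 13)] (by simp) fun y z v => by
    have h1 := h y z v 0 0
    simp [flatPairs, frameProd, frame] at h1 ⊢
    linear_combination h1
  simp at e1 e2 e3 e4 e5 e6 e7 e8 e9 e10
  simp [flatPairs]
  grind

namespace ConeData

variable {ε γ : ℝ} (d : ConeData ε 0 γ)

theorem p_eq_zero : d.p = 0 :=
  linearODE_unique (ι := Unit) (fun _ _ => ε) (fun _ => d.p) (fun _ => d.p_fib)
    (fun _ => by simp) (fun _ => (d.init 0 rfl).2.1) ()

theorem q_eq_one : d.q = 1 := by
  rw [eq_C_of_D_eq_zero d.q_fib (by rw [d.D0q, p_eq_zero]), (d.init 0 rfl).1]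
  exact map_one _

/-- For a = 0 one has p = 0, so every component except E₁ has vanishing Hessian trace. The ten
fields avoiding the ambient index 1 therefore have zero conformal factor. -/
theorem fam_mem_Kil (i : Fin 10) : d.fam (flatIdx i) ∈ Kil ε 0 0 γ := by
  have ht : ∀ A, A ≠ 1 → d.tr A = 0 := by
    intro A hA
    fin_cases A
    · rfl
    · exact absurd rfl hA
    · rfl
    · simp [tr, p_eq_zero]
    · rfl
    · rfl
  rw [mem_Kil, fam, symD_kf, ht, ht]
  · simp
  · revert i
    decide
  · revert i
    decide

/-- This is the trace relation at A = B = 0, where E₀ = q = 1. Its nonzero terms avoid the ambient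
index 1. -/
theorem G_mem_span_flat : G ε 0 0 γ ∈ Submodule.span ℝ (prods d.fam '' flatPairs.toFinset) := by
  have h := d.trace_relation 0 0
  have he : d.emb 0 = 1 := d.q_eq_one
  rw [he, mul_one, one_smul] at h
  rw [← h]
  simp only [Fin.sum_univ_six, kf_eq, map_smul, LinearMap.smul_apply]
  have key : ∀ i j, (i, j) ∈ flatPairs → sp (d.fam i) (d.fam j) ∈
      Submodule.span ℝ (prods d.fam '' flatPairs.toFinset) := fun i j hij =>
    Submodule.subset_span ⟨(i, j), by simpa using hij, rfl⟩
  have k1 := key 0 11 (by decide)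
  have k2 := key 5 5 (by decide)
  have k3 := key 6 6 (by decide)
  have k4 := k1
  rw [sp_comm] at k4
  simp only [coneSign, coneNum, dual]
  simp
  refine Submodule.add_mem _ (Submodule.add_mem _ (Submodule.add_mem _ ?_ ?_) ?_) ?_ <;>
    assumption

end ConeData

/-- Five ambient indices 0, 2, 3, 4, 5 remain. Each four-element subset gives one Plücker relation,
so 5 of the 55 products drop out. -/
theorem finrank_redKil_flat {ε γ : ℝ} : Module.finrank ℝ (redKil ε 0 0 γ) = 50 := by
  obtain ⟨d⟩ := nonempty_coneData ε 0 γ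
  have hV := span_eq_image (V := Kil ε 0 0 γ) flatKilJet flatKilJet_injective
    d.fam_linearIndependent (m := flatIdx) (by decide) d.fam_mem_Kil
  have hn : flatPairs.Nodup := by decide
  rw [redKil_eq hV, span_image_pairs (S := flatPairs.toFinset) (prods_comm _), sup_eq_right.2,
    finrank_span_pairs]
  · decide
  · intro g hg hsum i j
    have hr := d.frameRel hn hg (f := 0) (by rw [hsum, zero_smul])
    have hr' : FrameRel flatPairs g 0 := by
      intro y z v b c
      rw [hr y z v b c]
      simp
    by_cases hij : (i, j) ∈ flatPairs
    · exact hr'.flatPairs_eq_zero _ hij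
    · exact hg i j (by simpa using hij)
  · rw [Submodule.span_singleton_le_iff_mem]
    exact d.G_mem_span_flat
  · rintro ⟨i, j⟩ hp
    revert i j
    decide
  · intro i hi j hj hij hS
    -- One dependent product is singled out in each of the five Plücker relations.
    have hc : (i, j) ∈ [(9, 11), (0, 9), (9, 10), (5, 10), (6, 10)] := by
      revert i j
      decide
    refine mem_of_forall_dual fun φ hφ => ?_
    have hz : ∀ p ∈ flatPairs, φ (prods d.fam p) = 0 := fun p hp =>
      hφ _ (Submodule.subset_span ⟨p, by simpa using hp, rfl⟩)
    have hz₂ : ∀ p ∈ flatPairs, φ (prods d.fam (p.2, p.1)) = 0 := fun p hp => by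
      rw [prods_comm]
      exact hz p hp
    have p1 := d.plucker_fam φ 0 2 3 4
    have p2 := d.plucker_fam φ 0 2 3 5
    have p3 := d.plucker_fam φ 0 2 4 5
    have p4 := d.plucker_fam φ 0 3 4 5
    have p5 := d.plucker_fam φ 2 3 4 5
    simp only [flatPairs, List.forall_mem_cons] at hz hz₂
    simp [coneSign, coneNum] at p1 p2 p3 p4 p5
    simp [hz, hz₂] at p1 p2 p3 p4 p5
    rw [prods_comm] at p3 p5
    simp at hc
    rcases hc with ⟨rfl, rfl⟩ | ⟨rfl, rfl⟩ | ⟨rfl, rfl⟩ | ⟨rfl, rfl⟩ | ⟨rfl, rfl⟩ <;> assumption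

end PlaneWave

end

/-! ### Assembly of the seven dimensions. -/

theorem proposition2p2 (ε a₁ a₂ γ : ℝ) :
    (a₁ ≠ a₂ → Module.finrank ℝ
      (PlaneWave.reducibleConformalKillingTensors (PlaneWave.metric ε a₁ a₂ γ)) = 27) ∧
    (a₁ = a₂ → Module.finrank ℝ
      (PlaneWave.reducibleConformalKillingTensors (PlaneWave.metric ε a₁ a₂ γ)) = 84) ∧
    (ε = 0 → a₁ ≠ a₂ → Module.finrank ℝ
      (PlaneWave.reducibleKillingTensors (PlaneWave.metric ε a₁ a₂ γ)) = 21) ∧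
    (ε = 0 → a₁ = a₂ → a₂ ≠ 0 → Module.finrank ℝ
      (PlaneWave.reducibleKillingTensors (PlaneWave.metric ε a₁ a₂ γ)) = 27) ∧
    (ε ≠ 0 → a₁ ≠ a₂ → Module.finrank ℝ
      (PlaneWave.reducibleKillingTensors (PlaneWave.metric ε a₁ a₂ γ)) = 22) ∧
    (ε ≠ 0 → a₁ = a₂ → a₂ ≠ 0 → Module.finrank ℝ
      (PlaneWave.reducibleKillingTensors (PlaneWave.metric ε a₁ a₂ γ)) = 28) ∧
    (a₁ = 0 → a₂ = 0 → Module.finrank ℝ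
      (PlaneWave.reducibleKillingTensors (PlaneWave.metric ε a₁ a₂ γ)) = 50) := by
  refine ⟨fun h => ?_, fun h => ?_, fun hε h => ?_, fun hε h h₂ => ?_, fun hε h => ?_,
    fun hε h h₂ => ?_, fun h₁ h₂ => ?_⟩
  · rw [PlaneWave.finrank_reducibleConformalKillingTensors, PlaneWave.finrank_redCK_of_ne h]
  · rw [h, PlaneWave.finrank_reducibleConformalKillingTensors, PlaneWave.finrank_redCK_of_eq]
  · rw [PlaneWave.finrank_reducibleKillingTensors, PlaneWave.finrank_redKil_of_ne h, if_pos hε]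
  · rw [h, PlaneWave.finrank_reducibleKillingTensors, PlaneWave.finrank_redKil_of_eq h₂, if_pos hε]
  · rw [PlaneWave.finrank_reducibleKillingTensors, PlaneWave.finrank_redKil_of_ne h, if_neg hε]
  · rw [h, PlaneWave.finrank_reducibleKillingTensors, PlaneWave.finrank_redKil_of_eq h₂, if_neg hε]
  · rw [h₁, h₂, PlaneWave.finrank_reducibleKillingTensors, PlaneWave.finrank_redKil_flat]
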